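/- Let $G\subset GL_n(\mathbb C)$ be a connected complex reductive group (a connected linear algebraic group that is the complexification of a compact subgroup), $T\subset G$ a maximal torus, $\mathfrak t\subset\mathfrak g$ the Lie algebras, and $\mathcal R\subset\mathfrak t^*$ the roots of $G$ relative to $T$. Let $\Delta\subset\mathbb C$ be the closed unit disc with coordinate $z$ (holomorphic on $\Delta$ means holomorphic on a neighbourhood of $\Delta$), and let $\mathcal G$ be the group of holomorphic maps $\Delta\to G$ and $G[\![z]\!]=G(\mathbb C[\![z]\!])$ its completion at $0$. Let $A$ be a meromorphic connection on a holomorphic principal $G$-bundle $P\to\Delta$, viewed as a $\mathfrak g$-valued meromorphic one-form on $P$, with a pole of order at most $k$, where $k\ge 2$, over $0$ and no other poles, and let $s_0\in P_0$ be a point of the fibre over $0$. For a holomorphic section $s$ of $P$ put $A^s:=-s^*(A)=A^h\,dz/z^k$, with $A^h$ holomorphic; $A_0:=A^h(0)$ is the same for all sections $s$ near $0$ with $s(0)=s_0$ and is called the leading coefficient of $(P,A,s_0)$. Assume that $(P,A,s_0)$ is compatibly framed and generic, i.e. that $A_0\in\mathfrak t$ and $\alpha(A_0)\neq 0$ for all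 $\alpha\in\mathcal R$. Then for every global section (trivialisation) $s:\Delta\to P$ with $s(0)=s_0$ there are a unique $\widehat F\in G[\![z]\!]$ and unique $A^0_0,\dots,A^0_{k-2},\Lambda\in\mathfrak t$ such that $\widehat F(0)=1$, $A^0_0=A_0$ and $\widehat F[A^0]=A^s$, where $$A^0:=\Bigl(\frac{A^0_0}{z^k}+\cdots+\frac{A^0_{k-2}}{z^2}+\frac{\Lambda}{z}\Bigr)dz,\qquad \widehat F[A^0]:=\widehat F A^0\widehat F^{-1}+d\widehat F\,\widehat F^{-1},$$ and $A^s$ is identified with its Laurent expansion at $0$. Moreover, replacing $s$ by another trivialisation through $s_0$ does not change $A^0$, and changes $\widehat F$ to $\widehat g\cdot\widehat F$, where $\widehat g\in G[\![z]\!]$ is the Taylor expansion at $0$ of some $g\in\mathcal G$ with $g(0)=1$. -/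

import Mathlib

open scoped Manifold ContDiff Topology PowerSeries

noncomputable section

namespace FormalType

/-! ### Complex linear algebraic groups -/

/-- The square matrix underlying an element of a subgroup of `GL_n(ℂ)`. -/
def toMat {n : ℕ} {G : Subgroup (GL (Fin n) ℂ)} (g : G) : Matrix (Fin n) (Fin n) ℂ :=
  ((g : GL (Fin n) ℂ) : Matrix (Fin n) (Fin n) ℂ)

/-- The value of a polynomial in the `n²` matrix entries at a matrix over a `ℂ`-algebra `R`. -/
def polyAt {n : ℕ} {R : Type*} [CommRing R] [Algebra ℂ R]
    (f : MvPolynomial (Fin n × Fin n) ℂ) (M : Matrix (Fin n) (Fin n) R) : R :=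
  MvPolynomial.aeval (fun ij : Fin n × Fin n => M ij.1 ij.2) f

/-- `G` is a Zariski closed subgroup of `GL_n(ℂ)`. -/
def IsAlgebraic {n : ℕ} (G : Subgroup (GL (Fin n) ℂ)) : Prop :=
  ∃ S : Set (MvPolynomial (Fin n × Fin n) ℂ),
    ∀ g : GL (Fin n) ℂ, g ∈ G ↔ ∀ f ∈ S, polyAt f (g : Matrix (Fin n) (Fin n) ℂ) = 0

/-- The polynomials in the matrix entries that vanish on `G`. -/
def vanishing {n : ℕ} (G : Subgroup (GL (Fin n) ℂ)) : Set (MvPolynomial (Fin n × Fin n) ℂ) :=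
  {f | ∀ g ∈ G, polyAt f (g : Matrix (Fin n) (Fin n) ℂ) = 0}

/-- The Lie algebra of a linear algebraic group `G ⊆ GL_n(ℂ)`, i.e. its tangent space at the
identity: the matrices `X` such that `df(1)(X) = 0` for all polynomials `f` vanishing on `G`. -/
def lieAlg {n : ℕ} (G : Subgroup (GL (Fin n) ℂ)) : Submodule ℂ (Matrix (Fin n) (Fin n) ℂ) where
  carrier := {X | ∀ f ∈ vanishing G,
    ∑ i, ∑ j, X i j * polyAt (MvPolynomial.pderiv (i, j) f) (1 : Matrix (Fin n) (Fin n) ℂ) = 0}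
  zero_mem' := by
    intro f _
    simp
  add_mem' := by
    intro X Y hX hY f hf
    have h1 := hX f hf
    have h2 := hY f hf
    simp only [Matrix.add_apply, add_mul, Finset.sum_add_distrib]
    rw [h1, h2, add_zero]
  smul_mem' := by
    intro c X hX f hf
    have h1 := hX f hf
    simp only [Matrix.smul_apply, smul_eq_mul, mul_assoc, ← Finset.mul_sum]
    rw [h1, mul_zero]

/-- The (real) Lie algebra of a compact subgroup `K` of `GL_n(ℂ)`: the matrices generating a
one-parameter subgroup of `K`. -/
def realLieAlg {n : ℕ} (K : Subgroup (GL (Fin n) ℂ)) : Set (Matrix (Fin n) (Fin n) ℂ) :=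
  {Y | ∀ t : ℝ, ∃ g ∈ K, (g : Matrix (Fin n) (Fin n) ℂ) = NormedSpace.exp (((t : ℂ)) • Y)}

/-- `G ⊆ GL_n(ℂ)` is a connected complex reductive group: it is algebraic, connected, and the
complexification of a compact subgroup `K`, so that `𝔤 = 𝔨 + i𝔨`. -/
structure IsConnectedReductive {n : ℕ} (G : Subgroup (GL (Fin n) ℂ)) : Prop where
  algebraic : IsAlgebraic G
  connected : IsConnected (G : Set (GL (Fin n) ℂ))
  compactForm : ∃ K : Subgroup (GL (Fin n) ℂ), K ≤ G ∧ IsCompact (K : Set (GL (Fin n) ℂ)) ∧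
    ∀ X ∈ lieAlg G, ∃ Y ∈ realLieAlg K, ∃ Z ∈ realLieAlg K, X = Y + Complex.I • Z

/-- A (complex algebraic) torus: a connected, diagonalisable algebraic group. -/
structure IsTorus {n : ℕ} (T : Subgroup (GL (Fin n) ℂ)) : Prop where
  algebraic : IsAlgebraic T
  connected : IsConnected (T : Set (GL (Fin n) ℂ))
  diagonalizable : ∃ h : GL (Fin n) ℂ, ∀ t ∈ T,
    ((h * t * h⁻¹ : GL (Fin n) ℂ) : Matrix (Fin n) (Fin n) ℂ).IsDiag

/-- `T` is a maximal torus of `G`. -/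
structure IsMaximalTorus {n : ℕ} (G T : Subgroup (GL (Fin n) ℂ)) : Prop where
  le : T ≤ G
  torus : IsTorus T
  maximal : ∀ T' : Subgroup (GL (Fin n) ℂ), T' ≤ G → IsTorus T' → T ≤ T' → T' = T

/-- `α ∈ 𝔱*` is a root of `G` relative to `T`: `α ≠ 0` and the space `𝔤_α` of all `X ∈ 𝔤` with
`[H, X] = α(H) X` for all `H ∈ 𝔱` is not zero. -/
def IsRoot {n : ℕ} (G T : Subgroup (GL (Fin n) ℂ)) (α : Module.Dual ℂ (lieAlg T)) : Prop :=
  α ≠ 0 ∧ ∃ X ∈ lieAlg G, X ≠ 0 ∧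
    ∀ H : lieAlg T, (H : Matrix (Fin n) (Fin n) ℂ) * X - X * (H : Matrix (Fin n) (Fin n) ℂ)
      = α H • X

/-- The regular elements `𝔱_reg` of `𝔱`: no root vanishes at them. -/
def IsRegular {n : ℕ} (G T : Subgroup (GL (Fin n) ℂ)) (H : lieAlg T) : Prop :=
  ∀ α : Module.Dual ℂ (lieAlg T), IsRoot G T α → α H ≠ 0

/-- The closed unit disc. "Holomorphic on `Δ`" means holomorphic on a neighbourhood of `Δ`. -/
abbrev Δ : Set ℂ := Metric.closedBall 0 1

/-! ### Principal bundles and connections -/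

section Bundles

variable {n : ℕ} (G : Subgroup (GL (Fin n) ℂ))
  (E : Type*) [NormedAddCommGroup E] [NormedSpace ℂ E]
  (P : Type*) [TopologicalSpace P] [ChartedSpace E P]

/-- A holomorphic (right) principal `G`-bundle `π : P → base`, over an open neighbourhood `base`
of the closed unit disc, with total space the complex manifold `P`. -/
structure PrincipalBundle where
  /-- the projection -/
  π : P → ℂ
  /-- the base, an open neighbourhood of `Δ` -/
  base : Set ℂ
  isOpen_base : IsOpen base
  disc_subset : Δ ⊆ base
  range_π : Set.range π = base
  holomorphic_π : ContMDiff 𝓘(ℂ, E) 𝓘(ℂ, ℂ) ω π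
  /-- the right action `p ↦ p · g` -/
  act : P → G → P
  act_one : ∀ p, act p 1 = p
  act_mul : ∀ p g h, act p (g * h) = act (act p g) h
  holomorphic_act : ∀ g, ContMDiff 𝓘(ℂ, E) 𝓘(ℂ, E) ω (fun p => act p g)
  π_act : ∀ p g, π (act p g) = π p
  /-- `G` acts simply transitively on the fibres -/
  fibre : ∀ p q, π p = π q → ∃! g, act p g = q
  /-- Local triviality: around each point of the base there is a section `σ` over an open set `U`
  for which `U × G → π⁻¹(U)`, `(x, g) ↦ σ(x) · g`, is biholomorphic. -/
  locally_trivial : ∀ x ∈ base, ∃ U : Set ℂ, IsOpen U ∧ x ∈ U ∧ U ⊆ base ∧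
    ∃ σ : ℂ → P, (∀ y ∈ U, π (σ y) = y) ∧
      -- the map `U × G → P` sends holomorphic maps into `U × G` to holomorphic maps into `P`
      (∀ (m : ℕ) (W : Set (Fin m → ℂ)) (u : (Fin m → ℂ) → ℂ) (h : (Fin m → ℂ) → G),
        IsOpen W → AnalyticOnNhd ℂ u W → Set.MapsTo u W U →
        (∀ i j, AnalyticOnNhd ℂ (fun w => toMat (h w) i j) W) →
        ContMDiffOn 𝓘(ℂ, Fin m → ℂ) 𝓘(ℂ, E) ω (fun w => act (σ (u w)) (h w)) W) ∧
      -- the `G`-component of the inverse map is holomorphic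
      (∃ h : P → G, (∀ p, π p ∈ U → act (σ (π p)) (h p) = p) ∧
        ∀ i j, ContMDiffOn 𝓘(ℂ, E) 𝓘(ℂ, ℂ) ω (fun p => toMat (h p) i j) (π ⁻¹' U))

variable {E P}

/-- A holomorphic one-form on the complex manifold `P`. -/
def IsHolomorphicOneForm [IsManifold 𝓘(ℂ, E) ω P]
    (B : ∀ p : P, TangentSpace 𝓘(ℂ, E) p →L[ℂ] ℂ) : Prop :=
  ContMDiff 𝓘(ℂ, E) (𝓘(ℂ, E).prod 𝓘(ℂ, E →L[ℂ] ℂ)) ω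
    (fun p => (Bundle.TotalSpace.mk' (E →L[ℂ] ℂ) p (B p) :
      Bundle.TotalSpace (E →L[ℂ] ℂ)
        (fun p : P => TangentSpace 𝓘(ℂ, E) p →L[ℂ] Bundle.Trivial P ℂ p)))

variable {G}

/-- A meromorphic connection on `P`, as a `𝔤`-valued one-form on the total space, with a pole of
order (at most) `k` along the fibre over `0` and no other poles. The values of `form` on the fibre
over `0` are irrelevant. -/
structure MeromorphicConnection [IsManifold 𝓘(ℂ, E) ω P] (b : PrincipalBundle G E P) (k : ℕ) where
  /-- the one-form -/
  form : ∀ p : P, TangentSpace 𝓘(ℂ, E) p →ₗ[ℂ] Matrix (Fin n) (Fin n) ℂ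
  mem_lieAlg : ∀ p, b.π p ≠ 0 → ∀ v, form p v ∈ lieAlg G
  /-- `z ^ k` times the form extends to a holomorphic one-form on `P` -/
  pole : ∃ B : Fin n → Fin n → ∀ p : P, TangentSpace 𝓘(ℂ, E) p →L[ℂ] ℂ,
    (∀ i j, IsHolomorphicOneForm (B i j)) ∧
    ∀ i j p, b.π p ≠ 0 → ∀ v, B i j p v = b.π p ^ k * form p v i j
  /-- `R_g^* A = Ad(g⁻¹) A` -/
  equivariant : ∀ (g : G) (p : P), b.π p ≠ 0 → ∀ v : TangentSpace 𝓘(ℂ, E) p,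
    form (b.act p g) (mfderiv 𝓘(ℂ, E) 𝓘(ℂ, E) (fun q => b.act q g) p v)
      = toMat g⁻¹ * form p v * toMat g
  /-- The form reproduces the generators of vertical vectors: if `c` is a holomorphic curve in `G`
  with `c(0) = 1` and `c'(0) = X`, then its value on the tangent vector at `t = 0` of the curve
  `p · c(t)` is `X`. -/
  vertical : ∀ p, b.π p ≠ 0 → ∀ c : ℂ → G, c 0 = 1 →
    (∀ i j, AnalyticAt ℂ (fun t => toMat (c t) i j) 0) →
    ∀ i j, form (b.act p (c 0))
        (mfderiv 𝓘(ℂ, ℂ) 𝓘(ℂ, E) (fun t => b.act p (c t)) 0 (1 : ℂ)) i j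
      = deriv (fun t => toMat (c t) i j) 0

/-- `s` is a holomorphic section of the bundle near `z`. -/
def IsSectionNear (b : PrincipalBundle G E P) (s : ℂ → P) (z : ℂ) : Prop :=
  ∀ᶠ w in 𝓝 z, ContMDiffAt 𝓘(ℂ, ℂ) 𝓘(ℂ, E) ω s w ∧ b.π (s w) = w

/-- `s` is a trivialisation of the bundle over `Δ`, i.e. a holomorphic section over `Δ`. -/
def IsTrivialisation (b : PrincipalBundle G E P) (s : ℂ → P) : Prop :=
  ∀ z ∈ Δ, IsSectionNear b s z

variable [IsManifold 𝓘(ℂ, E) ω P] {b : PrincipalBundle G E P} {k : ℕ}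

/-- The coefficient of `dz` in the one-form `A^s = - s^*(A)` on the punctured disc. -/
def MeromorphicConnection.pull (A : MeromorphicConnection b k) (s : ℂ → P) (z : ℂ) :
    Matrix (Fin n) (Fin n) ℂ :=
  - A.form (s z) (mfderiv 𝓘(ℂ, ℂ) 𝓘(ℂ, E) s z (1 : ℂ))

/-- `A₀` is the leading coefficient of `A` in the framing `s₀`: the value at `0` of
`z ^ k A^s(z)` for a holomorphic section `s` near `0` through `s₀`. -/
def MeromorphicConnection.HasLeadingCoeff (A : MeromorphicConnection b k) (s₀ : P)
    (A₀ : Matrix (Fin n) (Fin n) ℂ) : Prop :=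
  ∃ s : ℂ → P, IsSectionNear b s 0 ∧ s 0 = s₀ ∧
    Filter.Tendsto (fun z : ℂ => z ^ k • A.pull s z) (𝓝[≠] 0) (𝓝 A₀)

/-- `Ah` is the holomorphic map on `Δ` with `A^s = Ah dz / z ^ k`. -/
def MeromorphicConnection.IsHolPart (A : MeromorphicConnection b k) (s : ℂ → P)
    (Ah : ℂ → Matrix (Fin n) (Fin n) ℂ) : Prop :=
  (∀ z ∈ Δ, ∀ i j, AnalyticAt ℂ (fun w => Ah w i j) z) ∧
  ∀ z ∈ Δ, z ≠ 0 → A.pull s z = (z ^ k)⁻¹ • Ah z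

end Bundles

/-! ### Formal gauge transformations -/

/-- The Taylor expansion at `0` of a matrix-valued map. -/
def taylor {n : ℕ} (f : ℂ → Matrix (Fin n) (Fin n) ℂ) : Matrix (Fin n) (Fin n) ℂ⟦X⟧ :=
  fun i j => PowerSeries.mk fun m => iteratedDeriv m (fun z => f z i j) 0 / (m.factorial : ℂ)

/-- The group `𝒢` of holomorphic maps `Δ → G`. -/
def IsHolomorphicMap {n : ℕ} (G : Subgroup (GL (Fin n) ℂ)) (g : ℂ → G) : Prop :=
  ∀ z ∈ Δ, ∀ i j, AnalyticAt ℂ (fun w => toMat (g w) i j) z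

/-- `G⟦z⟧ = G(ℂ⟦z⟧)`, the completion at `0` of `𝒢`. -/
def IsFormalPoint {n : ℕ} (G : Subgroup (GL (Fin n) ℂ)) (F : GL (Fin n) ℂ⟦X⟧) : Prop :=
  ∀ f ∈ vanishing G, polyAt f (F : Matrix (Fin n) (Fin n) ℂ⟦X⟧) = 0

/-- `F(0)` for a formal transformation `F`. -/
def atZero {n : ℕ} (F : GL (Fin n) ℂ⟦X⟧) : Matrix (Fin n) (Fin n) ℂ :=
  (F : Matrix (Fin n) (Fin n) ℂ⟦X⟧).map (PowerSeries.constantCoeff (R := ℂ))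

/-- The series `z ^ k A⁰ / dz = a₀ + a₁ z + ⋯ + a_{k-1} z^{k-1}` for
`A⁰ = (a₀ / z ^ k + a₁ / z ^ (k-1) + ⋯ + a_{k-1} / z) dz`; the residue is `Λ = a_{k-1}`. -/
def typeSeries {n k : ℕ} (a : Fin k → Matrix (Fin n) (Fin n) ℂ) :
    Matrix (Fin n) (Fin n) ℂ⟦X⟧ :=
  ∑ m : Fin k, (PowerSeries.X : ℂ⟦X⟧) ^ (m : ℕ) • (a m).map (PowerSeries.C (R := ℂ))

/-- The gauge action `F[B] = F B F⁻¹ + dF F⁻¹` on forms `B = β dz / z ^ k`, `β` a formal power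
series, in terms of the numerator: `F[β dz / z ^ k] = (F β F⁻¹ + z ^ k F' F⁻¹) dz / z ^ k`. -/
def gauge {n : ℕ} (k : ℕ) (F : GL (Fin n) ℂ⟦X⟧) (β : Matrix (Fin n) (Fin n) ℂ⟦X⟧) :
    Matrix (Fin n) (Fin n) ℂ⟦X⟧ :=
  (F : Matrix (Fin n) (Fin n) ℂ⟦X⟧) * β * ((F⁻¹ : GL (Fin n) ℂ⟦X⟧) : Matrix _ _ ℂ⟦X⟧) +
    (PowerSeries.X : ℂ⟦X⟧) ^ k •
      ((F : Matrix (Fin n) (Fin n) ℂ⟦X⟧).map (PowerSeries.derivative ℂ) *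
        ((F⁻¹ : GL (Fin n) ℂ⟦X⟧) : Matrix _ _ ℂ⟦X⟧))

section

variable {n : ℕ} {G : Subgroup (GL (Fin n) ℂ)}
  {E : Type*} [NormedAddCommGroup E] [NormedSpace ℂ E]
  {P : Type*} [TopologicalSpace P] [ChartedSpace E P] [IsManifold 𝓘(ℂ, E) ω P]
  {b : PrincipalBundle G E P} {k : ℕ}

/-- `F ∈ G⟦z⟧` and `A⁰ = (a₀ / z ^ k + ⋯ + a_{k-1} / z) dz`, with coefficients in `𝔱`, satisfy
`F(0) = 1`, `a₀ = A₀` and `F[A⁰] = A^s`. -/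
structure IsFormalNormalisation (T : Subgroup (GL (Fin n) ℂ)) (A : MeromorphicConnection b k)
    (A₀ : Matrix (Fin n) (Fin n) ℂ) (s : ℂ → P)
    (F : GL (Fin n) ℂ⟦X⟧) (a : Fin k → Matrix (Fin n) (Fin n) ℂ) : Prop where
  formal : IsFormalPoint G F
  at_zero : atZero F = 1
  mem_torus : ∀ m, a m ∈ lieAlg T
  leading : ∀ m : Fin k, (m : ℕ) = 0 → a m = A₀
  gauge_eq : ∃ Ah, A.IsHolPart s Ah ∧ gauge k F (typeSeries a) = taylor Ah

end

end FormalType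

end

/-! Everything is expressed through numerators: a form is `β dz / z ^ k` with `β` a matrix of power
series, and `F[α] = β` becomes the linear equation `F α + z ^ k F' = β F` (`gauge_eq_iff`). A series
`F` with `F(0) = 1` is a formal point of `G` exactly when `F' F⁻¹` has coefficients in `𝔤`
(`isFormalPoint_iff_hasLogDeriv`), so the problem lives in the Lie algebra.

Existence (`formal_exists`). Changing the coefficient of `F` in degree `m + 1` by `x` changes that
of `α` by `[A₀, x]`, because for `k ≥ 2` the term `z ^ k F'` only interferes in higher degree. As `𝔤
= 𝔱 + [A₀, 𝔤]`, the connection can be moved into `𝔱⟦z⟧` degree by degree (`formal_diagonalise`).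
There everything commutes, and the part without pole is integrated away.

Uniqueness (`formal_unique`). The quotient `C` of two solutions transforms one normal form into the
other. Degree by degree it commutes with `A₀`, as `ad A₀` is semisimple. Hence `C' C⁻¹` lies in the
centraliser of `A₀`, which is `𝔱`, and `C` acts on the normal form by adding `z ^ k C' C⁻¹`. Both
normal forms stop before degree `k`, so this term is zero and `C = 1`.

Both halves need the centraliser of `A₀` in `𝔤` to be `𝔱` (`mem_lieAlg_torus_of_commute`).
Regularity shows that it centralises `𝔱` (`IsRegular.commute`). Its semisimple elements lie in `𝔱`
by maximality of the torus, since the Zariski closure of `T · exp(ℂ X)` is again a torus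
(`IsMaximalTorus.mem_lieAlg`, `exists_torus_closure`). The compact form makes `𝔤` stable under an
adjoint `†`; hence `𝔤` contains the Jordan components of its elements (`semisimple_part_mem`), and
the positive form `Tr(X X†)` excludes nilpotents centralising `𝔱`.

On the analytic side, `z ^ k A^s` extends holomorphically over `0` with Taylor coefficients in `𝔤`,
and a change of section acts by the gauge law (`MeromorphicConnection.pull_transition`). A
normalisation for one trivialisation is therefore carried to another by the Taylor series of the
transition map, and uniqueness gives the last assertion. -/

noncomputable section

namespace FormalType

/-! ### Matrices of formal power series -/

section Series

variable {n : ℕ}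

/-- The matrix of `m`-th coefficients of a matrix of formal power series. -/
def co (m : ℕ) : Matrix (Fin n) (Fin n) ℂ⟦X⟧ →ₗ[ℂ] Matrix (Fin n) (Fin n) ℂ where
  toFun M := M.map (PowerSeries.coeff m)
  map_add' M N := by ext i j; simp
  map_smul' c M := by ext i j; simp

/-- The entrywise formal derivative. -/
def dz : Matrix (Fin n) (Fin n) ℂ⟦X⟧ →ₗ[ℂ] Matrix (Fin n) (Fin n) ℂ⟦X⟧ where
  toFun M := M.map (PowerSeries.derivative ℂ)
  map_add' M N := by ext i j; simp
  map_smul' c M := by ext i j; simp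

/-- The matrix of power series with given coefficients. -/
def ofCo (c : ℕ → Matrix (Fin n) (Fin n) ℂ) : Matrix (Fin n) (Fin n) ℂ⟦X⟧ :=
  fun i j => PowerSeries.mk fun m => c m i j

@[simp] lemma co_apply (m : ℕ) (M : Matrix (Fin n) (Fin n) ℂ⟦X⟧) (i j : Fin n) :
    co m M i j = PowerSeries.coeff m (M i j) := rfl

lemma dz_apply (M : Matrix (Fin n) (Fin n) ℂ⟦X⟧) (i j : Fin n) :
    dz M i j = PowerSeries.derivative ℂ (M i j) := rfl

@[simp] lemma co_ofCo (c : ℕ → Matrix (Fin n) (Fin n) ℂ) (m : ℕ) : co m (ofCo c) = c m := by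
  ext i j; simp [ofCo]

lemma co_ext {M N : Matrix (Fin n) (Fin n) ℂ⟦X⟧} (h : ∀ m, co m M = co m N) : M = N := by
  ext i j m
  exact congrFun (congrFun (h m) i) j

lemma co_mul (m : ℕ) (M N : Matrix (Fin n) (Fin n) ℂ⟦X⟧) :
    co m (M * N) = ∑ p ∈ Finset.HasAntidiagonal.antidiagonal m, co p.1 M * co p.2 N := by
  ext i j
  simp only [co_apply, Matrix.mul_apply, map_sum, PowerSeries.coeff_mul, Matrix.sum_apply]
  rw [Finset.sum_comm]

lemma co_zero_mul (M N : Matrix (Fin n) (Fin n) ℂ⟦X⟧) : co 0 (M * N) = co 0 M * co 0 N := by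
  simp [co_mul]

@[simp] lemma co_zero_one : co 0 (1 : Matrix (Fin n) (Fin n) ℂ⟦X⟧) = 1 := by
  ext i j
  by_cases h : i = j <;> simp [Matrix.one_apply, h]

@[simp] lemma co_succ_one (m : ℕ) : co (m + 1) (1 : Matrix (Fin n) (Fin n) ℂ⟦X⟧) = 0 := by
  ext i j
  by_cases h : i = j <;> simp [h, PowerSeries.coeff_one]

lemma co_dz (m : ℕ) (M : Matrix (Fin n) (Fin n) ℂ⟦X⟧) :
    co m (dz M) = ((m : ℂ) + 1) • co (m + 1) M := by
  ext i j
  simp only [co_apply, dz_apply, PowerSeries.coeff_derivative, Matrix.smul_apply, smul_eq_mul]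
  ring

lemma co_succ (m : ℕ) (M : Matrix (Fin n) (Fin n) ℂ⟦X⟧) :
    co (m + 1) M = ((m : ℂ) + 1)⁻¹ • co m (dz M) := by
  rw [co_dz, smul_smul, inv_mul_cancel₀ (Nat.cast_add_one_ne_zero m), one_smul]

lemma dz_mul (M N : Matrix (Fin n) (Fin n) ℂ⟦X⟧) : dz (M * N) = dz M * N + M * dz N := by
  ext1 i j
  simp only [dz_apply, Matrix.mul_apply, Matrix.add_apply, map_sum, Derivation.leibniz,
    smul_eq_mul, Finset.sum_add_distrib]
  rw [add_comm]
  congr 1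
  exact Finset.sum_congr rfl fun x _ => mul_comm _ _

@[simp] lemma dz_one : dz (1 : Matrix (Fin n) (Fin n) ℂ⟦X⟧) = 0 := by
  apply co_ext
  intro m
  simp [co_dz]

lemma co_X_pow_smul (k m : ℕ) (M : Matrix (Fin n) (Fin n) ℂ⟦X⟧) :
    co m ((PowerSeries.X : ℂ⟦X⟧) ^ k • M) = if k ≤ m then co (m - k) M else 0 := by
  ext i j
  simp only [co_apply, Matrix.smul_apply, smul_eq_mul, PowerSeries.coeff_X_pow_mul']
  split_ifs <;> simp

lemma eq_of_dz_eq {M N : Matrix (Fin n) (Fin n) ℂ⟦X⟧} (h₀ : co 0 M = co 0 N)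
    (h : dz M = dz N) : M = N := by
  apply co_ext
  rintro (_ | m)
  · exact h₀
  · rw [co_succ, co_succ, h]

/-- A matrix of power series with constant term `1` is invertible. -/
lemma exists_inverse {F : Matrix (Fin n) (Fin n) ℂ⟦X⟧} (h : co 0 F = 1) :
    ∃ U : GL (Fin n) ℂ⟦X⟧, (U : Matrix (Fin n) (Fin n) ℂ⟦X⟧) = F := by
  have : IsUnit F := by
    rw [Matrix.isUnit_iff_isUnit_det, PowerSeries.isUnit_iff_constantCoeff, RingHom.map_det]
    have : (PowerSeries.constantCoeff (R := ℂ)).mapMatrix F = 1 := by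
      rw [← h]; ext i j; simp
    rw [this]; simp
  exact ⟨this.unit, rfl⟩

/-- The matrix `M` has all its coefficients in `V`. -/
def CoMem (V : Submodule ℂ (Matrix (Fin n) (Fin n) ℂ)) (M : Matrix (Fin n) (Fin n) ℂ⟦X⟧) : Prop :=
  ∀ m, co m M ∈ V

lemma CoMem.add {V : Submodule ℂ (Matrix (Fin n) (Fin n) ℂ)} {M N : Matrix (Fin n) (Fin n) ℂ⟦X⟧}
    (hM : CoMem V M) (hN : CoMem V N) : CoMem V (M + N) := fun m => by
  rw [map_add]; exact V.add_mem (hM m) (hN m)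

lemma CoMem.sub {V : Submodule ℂ (Matrix (Fin n) (Fin n) ℂ)} {M N : Matrix (Fin n) (Fin n) ℂ⟦X⟧}
    (hM : CoMem V M) (hN : CoMem V N) : CoMem V (M - N) := fun m => by
  rw [map_sub]; exact V.sub_mem (hM m) (hN m)

lemma CoMem.neg {V : Submodule ℂ (Matrix (Fin n) (Fin n) ℂ)} {M : Matrix (Fin n) (Fin n) ℂ⟦X⟧}
    (hM : CoMem V M) : CoMem V (-M) := fun m => by
  rw [map_neg]; exact V.neg_mem (hM m)

lemma CoMem.derivative {V : Submodule ℂ (Matrix (Fin n) (Fin n) ℂ)}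
    {M : Matrix (Fin n) (Fin n) ℂ⟦X⟧}
    (hM : CoMem V M) : CoMem V (dz M) := fun m => by
  rw [co_dz]; exact V.smul_mem _ (hM _)

lemma CoMem.X_pow_smul {V : Submodule ℂ (Matrix (Fin n) (Fin n) ℂ)}
    {M : Matrix (Fin n) (Fin n) ℂ⟦X⟧} (hM : CoMem V M) (k : ℕ) :
    CoMem V ((PowerSeries.X : ℂ⟦X⟧) ^ k • M) := fun m => by
  rw [co_X_pow_smul]
  split_ifs
  · exact hM _
  · exact V.zero_mem

lemma co_commutator (m : ℕ) (M N : Matrix (Fin n) (Fin n) ℂ⟦X⟧) :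
    co m (M * N - N * M) =
      ∑ p ∈ Finset.HasAntidiagonal.antidiagonal m, (co p.1 M * co p.2 N - co p.2 N * co p.1 M) := by
  rw [map_sub, co_mul, co_mul, Finset.sum_sub_distrib]
  congr 1
  rw [← Finset.Nat.sum_antidiagonal_swap]
  rfl

lemma commute_of_co {M N : Matrix (Fin n) (Fin n) ℂ⟦X⟧}
    (h : ∀ i j, Commute (co i M) (co j N)) : Commute M N := by
  apply sub_eq_zero.mp
  apply co_ext
  intro m
  rw [co_commutator, map_zero]
  exact Finset.sum_eq_zero fun p _ => sub_eq_zero.mpr (h p.1 p.2)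

/-! ### Formal linear differential equations. -/

/-- The solution of `dF/dz = D F`, `F(0) = 1`, in terms of coefficients. -/
def solCo (D : ℕ → Matrix (Fin n) (Fin n) ℂ) : ℕ → Matrix (Fin n) (Fin n) ℂ
  | 0 => 1
  | m + 1 => ((m : ℂ) + 1)⁻¹ • ∑ i : Fin (m + 1), D (m - i) * solCo D i

/-- The solution of `dF/dz = D F`, `F(0) = 1`. -/
def sol (D : Matrix (Fin n) (Fin n) ℂ⟦X⟧) : Matrix (Fin n) (Fin n) ℂ⟦X⟧ :=
  ofCo (solCo fun m => co m D)

lemma co_zero_sol (D : Matrix (Fin n) (Fin n) ℂ⟦X⟧) : co 0 (sol D) = 1 := by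
  rw [sol, co_ofCo, solCo]

lemma dz_sol (D : Matrix (Fin n) (Fin n) ℂ⟦X⟧) : dz (sol D) = D * sol D := by
  apply co_ext
  intro m
  rw [co_dz, co_mul, sol]
  simp only [co_ofCo]
  rw [solCo, smul_smul, mul_inv_cancel₀ (Nat.cast_add_one_ne_zero m), one_smul,
    ← Finset.Nat.sum_antidiagonal_swap, Finset.Nat.sum_antidiagonal_eq_sum_range_succ_mk,
    Finset.sum_range]
  rfl

end Series

/-! ### Invariant vector fields and the Lie algebra of an algebraic group -/

section LieAlgebra

variable {n : ℕ}

/-- The derivation of the polynomial functions on matrices given by the vector field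
`g ↦ X g`. -/
def fieldDeriv (X : Matrix (Fin n) (Fin n) ℂ) :
    Derivation ℂ (MvPolynomial (Fin n × Fin n) ℂ) (MvPolynomial (Fin n × Fin n) ℂ) :=
  MvPolynomial.mkDerivation ℂ fun ij =>
    ∑ l, MvPolynomial.C (X ij.1 l) * MvPolynomial.X (l, ij.2)

lemma fieldDeriv_X (X : Matrix (Fin n) (Fin n) ℂ) (ij : Fin n × Fin n) :
    fieldDeriv X (MvPolynomial.X ij) = ∑ l, MvPolynomial.C (X ij.1 l) * MvPolynomial.X (l, ij.2) :=
  MvPolynomial.mkDerivation_X _ _ _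

section polyAt

variable {R : Type*} [CommRing R] [Algebra ℂ R]

lemma polyAt_C (c : ℂ) (M : Matrix (Fin n) (Fin n) R) :
    polyAt (MvPolynomial.C c) M = algebraMap ℂ R c := by simp [polyAt]

lemma polyAt_X (ij : Fin n × Fin n) (M : Matrix (Fin n) (Fin n) R) :
    polyAt (MvPolynomial.X ij) M = M ij.1 ij.2 := by simp [polyAt]

lemma polyAt_add (f g : MvPolynomial (Fin n × Fin n) ℂ) (M : Matrix (Fin n) (Fin n) R) :
    polyAt (f + g) M = polyAt f M + polyAt g M := by simp [polyAt]

lemma polyAt_mul (f g : MvPolynomial (Fin n × Fin n) ℂ) (M : Matrix (Fin n) (Fin n) R) :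
    polyAt (f * g) M = polyAt f M * polyAt g M := by simp [polyAt]

lemma polyAt_sum {ι : Type*} (s : Finset ι) (f : ι → MvPolynomial (Fin n × Fin n) ℂ)
    (M : Matrix (Fin n) (Fin n) R) : polyAt (∑ i ∈ s, f i) M = ∑ i ∈ s, polyAt (f i) M := by
  simp [polyAt]

lemma map_polyAt {S : Type*} [CommRing S] [Algebra ℂ S] (φ : R →ₐ[ℂ] S)
    (f : MvPolynomial (Fin n × Fin n) ℂ) (M : Matrix (Fin n) (Fin n) R) :
    φ (polyAt f M) = polyAt f (M.map φ) :=
  MvPolynomial.comp_aeval_apply _ _ _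

/-- The chain rule for `f(M)` and a derivation of the coefficient ring. -/
lemma derivation_polyAt (δ : Derivation ℂ R R) (f : MvPolynomial (Fin n × Fin n) ℂ)
    (M : Matrix (Fin n) (Fin n) R) :
    δ (polyAt f M) = ∑ i, ∑ j, δ (M i j) * polyAt (MvPolynomial.pderiv (i, j) f) M := by
  induction f using MvPolynomial.induction_on with
  | C a => simp [polyAt]
  | add p q hp hq =>
    simp only [polyAt_add, map_add, hp, hq, mul_add, Finset.sum_add_distrib]
  | mul_X p ij hp =>
    obtain ⟨a, b⟩ := ij
    rw [polyAt_mul, Derivation.leibniz, hp, polyAt_X]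
    simp only [Derivation.leibniz, polyAt_add, smul_eq_mul, polyAt_mul, MvPolynomial.pderiv_X,
      mul_add, Finset.sum_add_distrib, polyAt_X]
    congr 1
    · rw [Finset.sum_eq_single a, Finset.sum_eq_single b]
      · simp [polyAt, mul_comm]
      · intro j _ hj
        rw [Pi.single_eq_of_ne]
        · simp [polyAt]
        · intro h; exact hj (Prod.ext_iff.mp h).2.symm
      · simp
      · intro i _ hi
        refine Finset.sum_eq_zero fun j _ => ?_
        rw [Pi.single_eq_of_ne]
        · simp [polyAt]
        · intro h; exact hi (Prod.ext_iff.mp h).1.symm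
      · simp
    · rw [Finset.mul_sum]
      refine Finset.sum_congr rfl fun i _ => ?_
      rw [Finset.mul_sum]
      exact Finset.sum_congr rfl fun j _ => by ring

lemma polyAt_fieldDeriv (X : Matrix (Fin n) (Fin n) ℂ) (f : MvPolynomial (Fin n × Fin n) ℂ)
    (M : Matrix (Fin n) (Fin n) R) :
    polyAt (fieldDeriv X f) M =
      ∑ i, ∑ j, (X.map (algebraMap ℂ R) * M) i j * polyAt (MvPolynomial.pderiv (i, j) f) M := by
  -- The chain rule is applied at the generic matrix, where every polynomial evaluates to itself.
  have key := derivation_polyAt (fieldDeriv X) f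
    (fun i j => (MvPolynomial.X (i, j) : MvPolynomial (Fin n × Fin n) ℂ))
  have hself : ∀ g : MvPolynomial (Fin n × Fin n) ℂ, polyAt g
      (fun i j => (MvPolynomial.X (i, j) : MvPolynomial (Fin n × Fin n) ℂ)) = g := fun g => by
    simp [polyAt]
  simp only [hself, fieldDeriv_X] at key
  rw [key]
  simp only [polyAt_sum, polyAt_mul, polyAt_C, polyAt_X, Matrix.mul_apply, Matrix.map_apply]

end polyAt

/-- The differential of `f` at the identity. -/
def dOne (f : MvPolynomial (Fin n × Fin n) ℂ) : Matrix (Fin n) (Fin n) ℂ →ₗ[ℂ] ℂ where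
  toFun X := ∑ i, ∑ j, X i j * polyAt (MvPolynomial.pderiv (i, j) f)
    (1 : Matrix (Fin n) (Fin n) ℂ)
  map_add' X Y := by simp only [Matrix.add_apply, add_mul, Finset.sum_add_distrib]
  map_smul' c X := by
    simp only [Matrix.smul_apply, smul_eq_mul, mul_assoc, ← Finset.mul_sum, RingHom.id_apply]

lemma mem_lieAlg_iff {G : Subgroup (GL (Fin n) ℂ)} {X : Matrix (Fin n) (Fin n) ℂ} :
    X ∈ lieAlg G ↔ ∀ f ∈ vanishing G, dOne f X = 0 := Iff.rfl

lemma lieAlg_mono {G H : Subgroup (GL (Fin n) ℂ)} (h : H ≤ G) : lieAlg H ≤ lieAlg G :=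
  fun _ hX f hf => hX f fun g hg => hf g (h hg)

lemma polyAt_fieldDeriv_one (X : Matrix (Fin n) (Fin n) ℂ) (f : MvPolynomial (Fin n × Fin n) ℂ) :
    polyAt (fieldDeriv X f) (1 : Matrix (Fin n) (Fin n) ℂ) = dOne f X := by
  rw [polyAt_fieldDeriv]
  simp [dOne]

/-- The polynomial `M ↦ f (M N)`. -/
def rightTranslate (N : Matrix (Fin n) (Fin n) ℂ) (f : MvPolynomial (Fin n × Fin n) ℂ) :
    MvPolynomial (Fin n × Fin n) ℂ :=
  polyAt f (Matrix.of (fun i j => (MvPolynomial.X (i, j) : MvPolynomial (Fin n × Fin n) ℂ)) *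
    N.map MvPolynomial.C)

lemma polyAt_rightTranslate (N M : Matrix (Fin n) (Fin n) ℂ)
    (f : MvPolynomial (Fin n × Fin n) ℂ) : polyAt (rightTranslate N f) M = polyAt f (M * N) := by
  have := map_polyAt (MvPolynomial.aeval (R := ℂ) (fun ij : Fin n × Fin n => M ij.1 ij.2)) f
    (Matrix.of (fun i j => (MvPolynomial.X (i, j) : MvPolynomial (Fin n × Fin n) ℂ)) *
      N.map MvPolynomial.C)
  rw [rightTranslate, polyAt, this]
  congr 1
  ext i j
  simp [Matrix.mul_apply]

/-- The field `g ↦ X g` is right-invariant, since left and right multiplications commute. -/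
lemma fieldDeriv_rightTranslate (X N : Matrix (Fin n) (Fin n) ℂ)
    (f : MvPolynomial (Fin n × Fin n) ℂ) :
    fieldDeriv X (rightTranslate N f) = rightTranslate N (fieldDeriv X f) := by
  rw [rightTranslate, derivation_polyAt, rightTranslate, polyAt_fieldDeriv]
  refine Finset.sum_congr rfl fun i _ => Finset.sum_congr rfl fun j _ => ?_
  congr 1
  rw [← Matrix.mul_assoc, Matrix.mul_apply, Matrix.mul_apply, map_sum]
  refine Finset.sum_congr rfl fun l _ => ?_
  rw [Derivation.leibniz, Matrix.of_apply, fieldDeriv_X]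
  simp only [Matrix.map_apply, MvPolynomial.derivation_C, smul_eq_mul,
    Matrix.mul_apply, Matrix.of_apply, MvPolynomial.algebraMap_eq]
  ring

/-- Invariant vector fields of `G` preserve the ideal of `G`. -/
lemma fieldDeriv_mem_vanishing {G : Subgroup (GL (Fin n) ℂ)} {X : Matrix (Fin n) (Fin n) ℂ}
    (hX : X ∈ lieAlg G) {f : MvPolynomial (Fin n × Fin n) ℂ} (hf : f ∈ vanishing G) :
    fieldDeriv X f ∈ vanishing G := by
  intro g hg
  -- By invariance, the derivative at `g` is the derivative at `1` of the right translate by `g`,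
  -- which still vanishes on `G`.
  rw [← one_mul (g : Matrix (Fin n) (Fin n) ℂ), ← polyAt_rightTranslate,
    ← fieldDeriv_rightTranslate, polyAt_fieldDeriv_one]
  refine hX _ fun g' hg' => ?_
  rw [polyAt_rightTranslate]
  exact hf (g' * g) (G.mul_mem hg' hg)

/-- Derivations are determined on the coordinates. The sign appears because the fields are
right-invariant. -/
lemma fieldDeriv_commutator (X Y : Matrix (Fin n) (Fin n) ℂ) :
    fieldDeriv (X * Y - Y * X) = -⁅fieldDeriv X, fieldDeriv Y⁆ := by
  apply MvPolynomial.derivation_ext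
  rintro ⟨i, j⟩
  rw [Derivation.neg_apply, Derivation.commutator_apply]
  simp only [fieldDeriv_X, map_sum, Derivation.leibniz, MvPolynomial.derivation_C,
    smul_eq_mul, Matrix.sub_apply, Matrix.mul_apply, map_sub, map_mul, Finset.mul_sum,
    sub_mul, Finset.sum_mul, Finset.sum_sub_distrib, neg_sub, ← mul_assoc, mul_zero,
    add_zero]
  rw [Finset.sum_comm]
  refine congrArg₂ _ rfl ?_
  rw [Finset.sum_comm]

lemma lieAlg_commutator {G : Subgroup (GL (Fin n) ℂ)} {X Y : Matrix (Fin n) (Fin n) ℂ}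
    (hX : X ∈ lieAlg G) (hY : Y ∈ lieAlg G) : X * Y - Y * X ∈ lieAlg G := by
  rw [mem_lieAlg_iff]
  intro f hf
  rw [← polyAt_fieldDeriv_one, fieldDeriv_commutator, Derivation.neg_apply,
    Derivation.commutator_apply, neg_sub, sub_eq_add_neg, polyAt_add]
  have h1 := fieldDeriv_mem_vanishing hY (fieldDeriv_mem_vanishing hX hf) 1 G.one_mem
  have h2 := fieldDeriv_mem_vanishing hX (fieldDeriv_mem_vanishing hY hf) 1 G.one_mem
  rw [Units.val_one] at h1 h2
  rw [h1, ← neg_one_mul, polyAt_mul, h2, mul_zero, add_zero]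

/-! ### Formal points through the identity -/

/-- `F(0) = 1` and `F' F⁻¹` has its coefficients in `V`. -/
def HasLogDeriv (V : Submodule ℂ (Matrix (Fin n) (Fin n) ℂ)) (F : Matrix (Fin n) (Fin n) ℂ⟦X⟧) :
    Prop :=
  co 0 F = 1 ∧ ∃ D, CoMem V D ∧ dz F = D * F

lemma coeff_zero_polyAt (f : MvPolynomial (Fin n × Fin n) ℂ) (F : Matrix (Fin n) (Fin n) ℂ⟦X⟧) :
    PowerSeries.coeff 0 (polyAt f F) = polyAt f (co 0 F) := by
  let φ : ℂ⟦X⟧ →ₐ[ℂ] ℂ :=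
    { PowerSeries.constantCoeff (R := ℂ) with
      commutes' := fun c => by simp }
  have h := map_polyAt φ f F
  have h2 : F.map φ = co 0 F := by
    ext i j
    rw [co_apply, PowerSeries.coeff_zero_eq_constantCoeff]
    rfl
  rw [← h2, ← h, PowerSeries.coeff_zero_eq_constantCoeff]
  rfl

/-- Along `F' = D F` the derivative of `f(F)` is the sum of `z ^ i` times the invariant derivative
of `f` along the coefficient `D_i`, evaluated at `F`. This drives both inductions on the degree
below. -/
lemma coeff_derivative_polyAt {F D : Matrix (Fin n) (Fin n) ℂ⟦X⟧} (h : dz F = D * F)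
    (f : MvPolynomial (Fin n × Fin n) ℂ) (m : ℕ) :
    PowerSeries.coeff m (PowerSeries.derivative ℂ (polyAt f F)) =
      ∑ p ∈ Finset.HasAntidiagonal.antidiagonal m,
        PowerSeries.coeff p.2 (polyAt (fieldDeriv (co p.1 D) f) F) := by
  rw [derivation_polyAt]
  simp only [polyAt_fieldDeriv, ← dz_apply, h, Matrix.mul_apply, Finset.sum_mul, map_sum,
    mul_assoc, PowerSeries.coeff_mul m, Matrix.map_apply, co_apply,
    PowerSeries.algebraMap_apply, Algebra.algebraMap_self, RingHom.id_apply,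
    PowerSeries.coeff_C_mul]
  rw [Finset.sum_comm]
  refine (Finset.sum_congr rfl fun j _ => Finset.sum_congr rfl fun i _ => Finset.sum_comm).trans ?_
  refine (Finset.sum_congr rfl fun j _ => Finset.sum_comm).trans ?_
  rw [Finset.sum_comm]
  refine Finset.sum_congr rfl fun p _ => ?_
  rw [Finset.sum_comm]

/-- A formal point through the identity is in `G⟦z⟧` if and only if its logarithmic derivative is
in `𝔤⟦z⟧`. -/
lemma isFormalPoint_iff_hasLogDeriv {G : Subgroup (GL (Fin n) ℂ)} {F : GL (Fin n) ℂ⟦X⟧}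
    (h₀ : co 0 (F : Matrix (Fin n) (Fin n) ℂ⟦X⟧) = 1) :
    IsFormalPoint G F ↔ HasLogDeriv (lieAlg G) (F : Matrix (Fin n) (Fin n) ℂ⟦X⟧) := by
  constructor
  · intro hF
    refine ⟨h₀, dz (F : Matrix (Fin n) (Fin n) ℂ⟦X⟧) * (F⁻¹ : GL (Fin n) ℂ⟦X⟧), ?_, ?_⟩
    · have hD : dz (F : Matrix (Fin n) (Fin n) ℂ⟦X⟧) =
          dz (F : Matrix (Fin n) (Fin n) ℂ⟦X⟧) * (F⁻¹ : GL (Fin n) ℂ⟦X⟧) * F := by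
        rw [Matrix.mul_assoc, ← Units.val_mul, inv_mul_cancel, Units.val_one, Matrix.mul_one]
      generalize dz (F : Matrix (Fin n) (Fin n) ℂ⟦X⟧) * (F⁻¹ : GL (Fin n) ℂ⟦X⟧) = D at hD
      intro m
      induction m using Nat.strong_induction_on with
      | _ m ih =>
        rw [mem_lieAlg_iff]
        intro f hf
        have h := coeff_derivative_polyAt hD f m
        -- Terms with `i < m` vanish: `D_i` is already in `𝔤`, so the derived polynomial is again in
        -- the ideal of `G` and is killed by `F`. The remaining term is the differential at `1`
        -- applied to `D_m`.
        rw [hF f hf, map_zero, map_zero, Finset.sum_eq_single (m, 0), coeff_zero_polyAt, h₀,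
          polyAt_fieldDeriv_one] at h
        · exact h.symm
        · rintro ⟨i, j⟩ hij hne
          rw [Finset.HasAntidiagonal.mem_antidiagonal] at hij
          have : i < m := by
            rcases Nat.eq_zero_or_pos j with rfl | hj
            · exact absurd (by simpa using hij) (by simpa using hne)
            · simp only at hij; omega
          rw [hF _ (fieldDeriv_mem_vanishing (ih i this) hf), map_zero]
        · simp
    · rw [Matrix.mul_assoc, ← Units.val_mul, inv_mul_cancel, Units.val_one, Matrix.mul_one]
  · rintro ⟨-, D, hDmem, hD⟩
    -- The induction treats all `f` at once, because it replaces `f` by its invariant derivatives.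
    suffices ∀ m, ∀ f ∈ vanishing G,
        PowerSeries.coeff m (polyAt f (F : Matrix (Fin n) (Fin n) ℂ⟦X⟧)) = 0 by
      intro f hf
      ext m
      rw [this m f hf, map_zero]
    intro m
    induction m using Nat.strong_induction_on with
    | _ m ih =>
      intro f hf
      rcases m with _ | m
      · rw [coeff_zero_polyAt, h₀]
        exact hf 1 G.one_mem
      · have h := coeff_derivative_polyAt hD f m
        rw [PowerSeries.coeff_derivative, Finset.sum_eq_zero] at h
        · exact (mul_eq_zero.mp h).resolve_right (Nat.cast_add_one_ne_zero m)
        · rintro ⟨i, j⟩ hij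
          rw [Finset.HasAntidiagonal.mem_antidiagonal] at hij
          simp only at hij
          exact ih j (by omega) _ (fieldDeriv_mem_vanishing (hDmem i) hf)

end LieAlgebra

/-! ### The formal gauge group of a matrix Lie algebra -/

section FormalGauge

variable {n : ℕ} {V : Submodule ℂ (Matrix (Fin n) (Fin n) ℂ)}

lemma CoMem.commutator (hV : ∀ X ∈ V, ∀ Y ∈ V, X * Y - Y * X ∈ V)
    {M N : Matrix (Fin n) (Fin n) ℂ⟦X⟧} (hM : CoMem V M) (hN : CoMem V N) :
    CoMem V (M * N - N * M) := fun m => by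
  rw [co_commutator]
  exact V.sum_mem fun p _ => hV _ (hM _) _ (hN _)

lemma co_zero_inv {F Fi : Matrix (Fin n) (Fin n) ℂ⟦X⟧} (h : Fi * F = 1) (h₀ : co 0 F = 1) :
    co 0 Fi = 1 := by
  have := congrArg (co 0) h
  rwa [co_zero_mul, h₀, mul_one, co_zero_one] at this

lemma dz_inv {F Fi D : Matrix (Fin n) (Fin n) ℂ⟦X⟧} (h : Fi * F = 1) (h' : F * Fi = 1)
    (hD : dz F = D * F) : dz Fi = -(Fi * D) := by
  have h1 : dz Fi * F = -(Fi * D * F) := by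
    have := congrArg dz h
    rw [dz_mul, dz_one, hD] at this
    rw [eq_neg_iff_add_eq_zero, mul_assoc]
    exact this
  calc dz Fi = dz Fi * F * Fi := by rw [mul_assoc, h', mul_one]
    _ = -(Fi * D) := by rw [h1, neg_mul, mul_assoc, h', mul_one]

/-- `F⁻¹ X F` has its coefficients in `V` if `X` does. -/
lemma CoMem.conj_inv (hV : ∀ X ∈ V, ∀ Y ∈ V, X * Y - Y * X ∈ V)
    {F Fi D : Matrix (Fin n) (Fin n) ℂ⟦X⟧} (h : Fi * F = 1) (h' : F * Fi = 1) (h₀ : co 0 F = 1)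
    (hDV : CoMem V D) (hD : dz F = D * F) {X : Matrix (Fin n) (Fin n) ℂ⟦X⟧} (hX : CoMem V X) :
    CoMem V (Fi * X * F) := by
  intro m
  induction m generalizing X with
  | zero => rw [co_zero_mul, co_zero_mul, co_zero_inv h h₀, h₀, one_mul, mul_one]; exact hX 0
  | succ m ih =>
    -- The derivative is the conjugate of another series with coefficients in `V`, so the induction
    -- has to range over all `X`.
    have : dz (Fi * X * F) = Fi * (dz X + (X * D - D * X)) * F := by
      rw [dz_mul, dz_mul, dz_inv h h' hD, hD]
      noncomm_ring
    rw [co_succ, this]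
    exact V.smul_mem _ (ih (hX.derivative.add (hX.commutator hV hDV)))

/-- `F X F⁻¹` has its coefficients in `V` if `X` does. -/
lemma CoMem.conj (hV : ∀ X ∈ V, ∀ Y ∈ V, X * Y - Y * X ∈ V)
    {F Fi D : Matrix (Fin n) (Fin n) ℂ⟦X⟧} (h : Fi * F = 1) (h' : F * Fi = 1) (h₀ : co 0 F = 1)
    (hDV : CoMem V D) (hD : dz F = D * F) {X : Matrix (Fin n) (Fin n) ℂ⟦X⟧} (hX : CoMem V X) :
    CoMem V (F * X * Fi) := by
  intro m
  induction m using Nat.strong_induction_on generalizing X with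
  | _ m ih =>
    rcases m with _ | m
    · rw [co_zero_mul, co_zero_mul, co_zero_inv h h₀, h₀, one_mul, mul_one]; exact hX 0
    -- In this order the conjugate itself reappears inside the bracket, with all its lower
    -- coefficients; hence strong induction.
    · have : dz (F * X * Fi) = F * dz X * Fi + (D * (F * X * Fi) - F * X * Fi * D) := by
        rw [dz_mul, dz_mul, dz_inv h h' hD, hD]
        noncomm_ring
      rw [co_succ, this, map_add, co_commutator]
      refine V.smul_mem _ (V.add_mem (ih m (Nat.lt_succ_self m) hX.derivative) (V.sum_mem ?_))
      intro p hp
      exact hV _ (hDV _) _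
        (ih p.2 (Nat.lt_succ_of_le (Finset.HasAntidiagonal.antidiagonal.snd_le hp)) hX)

/-- The logarithmic derivative of `F₁ F₂` is `D₁ + F₁ D₂ F₁⁻¹`. -/
lemma HasLogDeriv.mul (hV : ∀ X ∈ V, ∀ Y ∈ V, X * Y - Y * X ∈ V)
    {F₁ F₂ : Matrix (Fin n) (Fin n) ℂ⟦X⟧} (h₁ : HasLogDeriv V F₁) (h₂ : HasLogDeriv V F₂) :
    HasLogDeriv V (F₁ * F₂) := by
  obtain ⟨h10, D₁, hD₁, hF₁⟩ := h₁
  obtain ⟨h20, D₂, hD₂, hF₂⟩ := h₂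
  obtain ⟨U, rfl⟩ := exists_inverse h10
  refine ⟨by rw [co_zero_mul, h10, h20, one_mul], D₁ + U * D₂ * (U⁻¹ : GL (Fin n) ℂ⟦X⟧),
    hD₁.add (CoMem.conj hV U.inv_mul U.mul_inv h10 hD₁ hF₁ hD₂), ?_⟩
  rw [dz_mul, hF₁, hF₂]
  have : (↑U⁻¹ : Matrix (Fin n) (Fin n) ℂ⟦X⟧) * U = 1 := U.inv_mul
  rw [add_mul, mul_assoc D₁, mul_assoc (_ * _) _ (_ * _),
    ← mul_assoc (↑U⁻¹ : Matrix (Fin n) (Fin n) ℂ⟦X⟧), this, one_mul, mul_assoc]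

lemma HasLogDeriv.inv (hV : ∀ X ∈ V, ∀ Y ∈ V, X * Y - Y * X ∈ V) {U : GL (Fin n) ℂ⟦X⟧}
    (h : HasLogDeriv V (U : Matrix (Fin n) (Fin n) ℂ⟦X⟧)) :
    HasLogDeriv V ((U⁻¹ : GL (Fin n) ℂ⟦X⟧) : Matrix (Fin n) (Fin n) ℂ⟦X⟧) := by
  obtain ⟨h0, D, hD, hF⟩ := h
  refine ⟨co_zero_inv U.inv_mul h0, -((U⁻¹ : GL (Fin n) ℂ⟦X⟧) * D * U),
    (CoMem.conj_inv hV U.inv_mul U.mul_inv h0 hD hF hD).neg, ?_⟩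
  have : (U : Matrix (Fin n) (Fin n) ℂ⟦X⟧) * (U⁻¹ : GL (Fin n) ℂ⟦X⟧) = 1 := U.mul_inv
  rw [dz_inv U.inv_mul U.mul_inv hF, neg_mul, mul_assoc _ _ (U⁻¹ : GL (Fin n) ℂ⟦X⟧).val, this,
    mul_one]

/-! ### Commutation with constant matrices and uniqueness of the normal form. -/

/-- The constant matrix of power series. -/
def cst (A : Matrix (Fin n) (Fin n) ℂ) : Matrix (Fin n) (Fin n) ℂ⟦X⟧ := A.map PowerSeries.C

@[simp] lemma co_succ_cst (A : Matrix (Fin n) (Fin n) ℂ) (m : ℕ) : co (m + 1) (cst A) = 0 := by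
  ext i j; simp [cst]

@[simp] lemma dz_cst (A : Matrix (Fin n) (Fin n) ℂ) : dz (cst A) = 0 := by
  apply co_ext; intro m; simp [co_dz]

lemma co_mul_cst (m : ℕ) (M : Matrix (Fin n) (Fin n) ℂ⟦X⟧) (A : Matrix (Fin n) (Fin n) ℂ) :
    co m (M * cst A) = co m M * A := by
  ext i j
  simp [Matrix.mul_apply, cst]

lemma co_cst_mul (m : ℕ) (M : Matrix (Fin n) (Fin n) ℂ⟦X⟧) (A : Matrix (Fin n) (Fin n) ℂ) :
    co m (cst A * M) = A * co m M := by
  ext i j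
  simp [Matrix.mul_apply, cst]

lemma commute_cst_iff {M : Matrix (Fin n) (Fin n) ℂ⟦X⟧} {A : Matrix (Fin n) (Fin n) ℂ} :
    Commute M (cst A) ↔ ∀ m, Commute (co m M) A := by
  constructor
  · intro h m
    have := congrArg (co m) h.eq
    rwa [co_mul_cst, co_cst_mul] at this
  · intro h
    apply co_ext
    intro m
    rw [co_mul_cst, co_cst_mul]
    exact h m

lemma commute_sol {D : Matrix (Fin n) (Fin n) ℂ⟦X⟧} {C : Matrix (Fin n) (Fin n) ℂ⟦X⟧}
    (h₀ : co 0 C = 1) (hC : dz C = D * C) {H : Matrix (Fin n) (Fin n) ℂ}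
    (hD : ∀ m, Commute (co m D) H) (m : ℕ) : Commute (co m C) H := by
  induction m using Nat.strong_induction_on with
  | _ m ih =>
    rcases m with _ | m
    · rw [h₀]; exact Commute.one_left H
    · rw [co_succ, hC, co_mul]
      refine (Commute.sum_left _ _ _ fun p hp => ?_).smul_left _
      exact (hD _).mul_left
        (ih p.2 (Nat.lt_succ_of_le (Finset.HasAntidiagonal.antidiagonal.snd_le hp)))

/-- A series conjugating formal types with the same leading term commutes with it. -/
lemma commute_leading {A₀ : Matrix (Fin n) (Fin n) ℂ} {k : ℕ} (hk : 2 ≤ k)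
    (hss : ∀ X : Matrix (Fin n) (Fin n) ℂ, Commute A₀ (A₀ * X - X * A₀) → Commute A₀ X)
    {C α α' : Matrix (Fin n) (Fin n) ℂ⟦X⟧} (h₀ : co 0 C = 1)
    (hα : ∀ m, Commute A₀ (co m α)) (hα' : ∀ m, Commute A₀ (co m α'))
    (hα₀ : co 0 α = A₀) (hα'₀ : co 0 α' = A₀)
    (h : C * α + (PowerSeries.X : ℂ⟦X⟧) ^ k • dz C = α' * C) (m : ℕ) :
    Commute A₀ (co m C) := by
  induction m using Nat.strong_induction_on with
  | _ m ih =>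
    rcases m with _ | m
    · rw [h₀]; exact Commute.one_right A₀
    · apply hss
      have e := congrArg (co (m + 1)) h
      rw [map_add, co_mul, co_mul, Finset.Nat.sum_antidiagonal_succ',
        Finset.Nat.sum_antidiagonal_succ, hα₀, hα'₀] at e
      have e2 : A₀ * co (m + 1) C - co (m + 1) C * A₀ =
          (∑ p ∈ Finset.HasAntidiagonal.antidiagonal m, co p.1 C * co (p.2 + 1) α) +
          co (m + 1) ((PowerSeries.X : ℂ⟦X⟧) ^ k • dz C) -
          ∑ p ∈ Finset.HasAntidiagonal.antidiagonal m, co (p.1 + 1) α' * co p.2 C := by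
        rw [sub_eq_sub_iff_add_eq_add, ← e]
        abel
      rw [e2]
      refine (Commute.add_right (Commute.sum_right _ _ _ fun p hp => ?_) ?_).sub_right
        (Commute.sum_right _ _ _ fun p hp => ?_)
      · exact (ih _ (Nat.lt_succ_of_le (Finset.HasAntidiagonal.antidiagonal.fst_le hp))).mul_right
          (hα _)
      · rw [co_X_pow_smul]
        split_ifs with hkm
        · rw [co_dz]
          exact (ih _ (by omega)).smul_right _
        · exact Commute.zero_right _
      · exact (hα' _).mul_right
          (ih _ (Nat.lt_succ_of_le (Finset.HasAntidiagonal.antidiagonal.snd_le hp)))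

/-- Uniqueness of the formal normal form. -/
lemma formal_unique {𝔤 𝔱 : Submodule ℂ (Matrix (Fin n) (Fin n) ℂ)}
    {A₀ : Matrix (Fin n) (Fin n) ℂ} {k : ℕ} (hk : 2 ≤ k)
    (hcomm : ∀ X ∈ 𝔱, ∀ Y ∈ 𝔱, Commute X Y) (hA₀ : A₀ ∈ 𝔱)
    (hker : ∀ X ∈ 𝔤, Commute A₀ X → X ∈ 𝔱)
    (hss : ∀ X : Matrix (Fin n) (Fin n) ℂ, Commute A₀ (A₀ * X - X * A₀) → Commute A₀ X)
    {C α α' : Matrix (Fin n) (Fin n) ℂ⟦X⟧} (hC : HasLogDeriv 𝔤 C)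
    (hα : CoMem 𝔱 α) (hα' : CoMem 𝔱 α') (hα₀ : co 0 α = A₀) (hα'₀ : co 0 α' = A₀)
    (hαk : ∀ m, k ≤ m → co m α = 0) (hαk' : ∀ m, k ≤ m → co m α' = 0)
    (h : C * α + (PowerSeries.X : ℂ⟦X⟧) ^ k • dz C = α' * C) : C = 1 ∧ α = α' := by
  obtain ⟨h₀, D, hD, hCD⟩ := hC
  obtain ⟨U, rfl⟩ := exists_inverse h₀
  have hUA : Commute (U : Matrix (Fin n) (Fin n) ℂ⟦X⟧) (cst A₀) := commute_cst_iff.mpr fun m =>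
    (commute_leading hk hss h₀ (fun m => hcomm _ hA₀ _ (hα m)) (fun m => hcomm _ hA₀ _ (hα' m))
      hα₀ hα'₀ h m).symm
  have hD' : D = dz (U : Matrix (Fin n) (Fin n) ℂ⟦X⟧) * (U⁻¹ : GL (Fin n) ℂ⟦X⟧) := by
    rw [hCD, mul_assoc, ← Units.val_mul, mul_inv_cancel, Units.val_one, mul_one]
  have hUi : Commute ((U⁻¹ : GL (Fin n) ℂ⟦X⟧) : Matrix (Fin n) (Fin n) ℂ⟦X⟧) (cst A₀) :=
    hUA.units_inv_left
  have hUd : Commute (dz (U : Matrix (Fin n) (Fin n) ℂ⟦X⟧)) (cst A₀) := by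
    have := congrArg dz hUA.eq
    rwa [dz_mul, dz_mul, dz_cst, mul_zero, zero_mul, add_zero, zero_add] at this
  have hDA : Commute D (cst A₀) := by
    rw [hD']; exact hUd.mul_left hUi
  -- The logarithmic derivative lies in `𝔤` and centralises `A₀`, hence is in `𝔱`; from here on
  -- everything commutes.
  have hDt : CoMem 𝔱 D := fun m => hker _ (hD m) (commute_cst_iff.mp hDA m).symm
  have hUα : Commute (U : Matrix (Fin n) (Fin n) ℂ⟦X⟧) α := commute_of_co fun i j =>
    commute_sol h₀ hCD (fun m => hcomm _ (hDt m) _ (hα j)) i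
  have key : α + (PowerSeries.X : ℂ⟦X⟧) ^ k • D = α' := by
    have h2 : (α + (PowerSeries.X : ℂ⟦X⟧) ^ k • D) * U = α' * U := by
      rw [← h, hCD, add_mul, hUα.eq, Matrix.smul_mul]
    calc _ = (α + (PowerSeries.X : ℂ⟦X⟧) ^ k • D) * U * (U⁻¹ : GL (Fin n) ℂ⟦X⟧) := by
          rw [mul_assoc, ← Units.val_mul, mul_inv_cancel, Units.val_one, mul_one]
      _ = α' := by
          rw [h2, mul_assoc, ← Units.val_mul, mul_inv_cancel, Units.val_one, mul_one]
  -- Both normal forms end before degree `k`, where `z ^ k D` begins.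
  have hD0 : D = 0 := by
    apply co_ext
    intro m
    have := congrArg (co (m + k)) key
    rw [map_add, hαk _ (Nat.le_add_left _ _), hαk' _ (Nat.le_add_left _ _), co_X_pow_smul,
      if_pos (Nat.le_add_left _ _), Nat.add_sub_cancel, zero_add] at this
    rw [this, map_zero]
  constructor
  · refine eq_of_dz_eq (h₀.trans co_zero_one.symm) ?_
    rw [hCD, hD0, zero_mul, dz_one]
  · rw [← key, hD0, smul_zero, add_zero]

/-! ### Existence of the normal form, degree by degree. -/

/-- Sequences constructed term by term. -/
lemma exists_seq_of_prefix {α : Type*} [Inhabited α] (Q : ℕ → (ℕ → α) → Prop)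
    (hdep : ∀ m d d', (∀ j ≤ m, d j = d' j) → Q m d → Q m d')
    (hstep : ∀ m d, ∃ x, Q m (Function.update d m x)) : ∃ d, ∀ m, Q m d := by
  choose next hnext using hstep
  -- Stage `m + 1` sets entry `m`, and later stages leave it alone, so the diagonal `e (j + 1) j` is
  -- the limit; no default value survives in it.
  let e : ℕ → ℕ → α := fun m => Nat.rec (fun _ => default)
    (fun m d => Function.update d m (next m d)) m
  have he : ∀ m, e (m + 1) = Function.update (e m) m (next m (e m)) := fun m => rfl
  have hst : ∀ j m, j < m → e m j = e (j + 1) j := by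
    intro j m hjm
    induction m, hjm using Nat.le_induction with
    | base => rfl
    | succ m hm ih =>
      rw [he, Function.update_of_ne (by omega), ih]
  refine ⟨fun j => e (j + 1) j, fun m => hdep m (e (m + 1)) _ (fun j hj => ?_) ?_⟩
  · exact hst j (m + 1) (Nat.lt_succ_of_le hj)
  · rw [he]; exact hnext m (e m)

lemma co_mul_add_two (m : ℕ) (M N : Matrix (Fin n) (Fin n) ℂ⟦X⟧) :
    co (m + 1 + 1) (M * N) = co 0 M * co (m + 1 + 1) N + (co (m + 1 + 1) M * co 0 N +
      ∑ p ∈ Finset.HasAntidiagonal.antidiagonal m, co (p.1 + 1) M * co (p.2 + 1) N) := by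
  rw [co_mul, Finset.Nat.sum_antidiagonal_succ, Finset.Nat.sum_antidiagonal_succ']

/-- Changing `D` in degree `m` changes the solution of `F' = D F` from degree `m + 1` on. -/
lemma co_sol_perturb {D D' : Matrix (Fin n) (Fin n) ℂ⟦X⟧} {m : ℕ} {x : Matrix (Fin n) (Fin n) ℂ}
    (hlt : ∀ j < m, co j D = co j D') (hm : co m D' = co m D + x) :
    (∀ j ≤ m, co j (sol D') = co j (sol D)) ∧
      co (m + 1) (sol D') = co (m + 1) (sol D) + ((m : ℂ) + 1)⁻¹ • x := by
  have h1 : ∀ j ≤ m, co j (sol D') = co j (sol D) := by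
    intro j
    induction j using Nat.strong_induction_on with
    | _ j ih =>
      intro hj
      rcases j with _ | j
      · rw [co_zero_sol, co_zero_sol]
      · rw [co_succ, co_succ, dz_sol, dz_sol, co_mul, co_mul]
        congr 1
        refine Finset.sum_congr rfl fun p hp => ?_
        have := Finset.HasAntidiagonal.antidiagonal.fst_le hp
        have := Finset.HasAntidiagonal.antidiagonal.snd_le hp
        rw [ih p.2 (by omega) (by omega), hlt p.1 (by omega)]
  refine ⟨h1, ?_⟩
  rw [co_succ, co_succ, dz_sol, dz_sol, co_mul, co_mul, ← smul_add]
  congr 1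
  rcases m with _ | m
  · simp [hm, co_zero_sol]
  · rw [Finset.Nat.sum_antidiagonal_succ', Finset.Nat.sum_antidiagonal_succ', hm, co_zero_sol,
      co_zero_sol, mul_one, mul_one]
    have : ∀ p ∈ Finset.HasAntidiagonal.antidiagonal m,
        co p.1 D' * co (p.2 + 1) (sol D') = co p.1 D * co (p.2 + 1) (sol D) := by
      intro p hp
      have := Finset.HasAntidiagonal.antidiagonal.fst_le hp
      have := Finset.HasAntidiagonal.antidiagonal.snd_le hp
      rw [h1 _ (by omega), hlt p.1 (by omega)]
    rw [Finset.sum_congr rfl this]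
    abel

/-- The effect of such a change on the gauge transform. -/
lemma co_gauge_perturb {k : ℕ} (hk : 2 ≤ k) {F F' γ γ' β : Matrix (Fin n) (Fin n) ℂ⟦X⟧} {m : ℕ}
    {x : Matrix (Fin n) (Fin n) ℂ} (h₀ : co 0 F = 1) (h₀' : co 0 F' = 1)
    (hlt : ∀ j ≤ m, co j F' = co j F) (hm : co (m + 1) F' = co (m + 1) F + x)
    (h : F * γ + (PowerSeries.X : ℂ⟦X⟧) ^ k • dz F = β * F)
    (h' : F' * γ' + (PowerSeries.X : ℂ⟦X⟧) ^ k • dz F' = β * F') :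
    co (m + 1) γ' = co (m + 1) γ + (co 0 β * x - x * co 0 β) := by
  -- This is where `k ≥ 2` is needed: up to degree `m + 1`, the term `z ^ k F'` sees only
  -- coefficients of degree at most `m`.
  have hX : ∀ j ≤ m + 1, co j ((PowerSeries.X : ℂ⟦X⟧) ^ k • dz F') =
      co j ((PowerSeries.X : ℂ⟦X⟧) ^ k • dz F) := by
    intro j hj
    rw [co_X_pow_smul, co_X_pow_smul]
    split_ifs
    · rw [co_dz, co_dz, hlt _ (by omega)]
    · rfl
  have hβ : ∀ j ≤ m, co j (β * F') = co j (β * F) := by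
    intro j hj
    rw [co_mul, co_mul]
    refine Finset.sum_congr rfl fun p hp => ?_
    have := Finset.HasAntidiagonal.antidiagonal.snd_le hp
    rw [hlt _ (by omega)]
  have h1 : ∀ j ≤ m, co j γ' = co j γ := by
    intro j
    induction j using Nat.strong_induction_on with
    | _ j ih =>
      intro hj
      have e := congrArg (co j) h
      have e' := congrArg (co j) h'
      rw [map_add, hX j (by omega), hβ j hj, ← e, map_add, add_left_inj, co_mul, co_mul] at e'
      rcases j with _ | j
      · simpa [h₀, h₀'] using e'
      · rw [Finset.Nat.sum_antidiagonal_succ, Finset.Nat.sum_antidiagonal_succ, h₀, h₀', one_mul,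
          one_mul] at e'
        have : ∀ p ∈ Finset.HasAntidiagonal.antidiagonal j,
            co (p.1 + 1) F' * co p.2 γ' = co (p.1 + 1) F * co p.2 γ := by
          intro p hp
          have := Finset.HasAntidiagonal.antidiagonal.fst_le hp
          have := Finset.HasAntidiagonal.antidiagonal.snd_le hp
          rw [hlt _ (by omega), ih p.2 (by omega) (by omega)]
        rw [Finset.sum_congr rfl this] at e'
        exact add_right_cancel e'
  have hγ₀ : co 0 γ = co 0 β := by
    have e := congrArg (co 0) h
    rwa [map_add, co_X_pow_smul, if_neg (by omega), add_zero, co_zero_mul, co_zero_mul, h₀,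
      one_mul, mul_one] at e
  have e := congrArg (co (m + 1)) h
  have e' := congrArg (co (m + 1)) h'
  rw [map_add, hX _ le_rfl] at e'
  rw [map_add] at e
  have e2 : co (m + 1) (F' * γ') - co (m + 1) (F * γ) =
      co (m + 1) (β * F') - co (m + 1) (β * F) := by
    rw [← e, ← e']; abel
  have hβ2 : co (m + 1) (β * F') - co (m + 1) (β * F) = co 0 β * x := by
    rw [co_mul, co_mul, Finset.Nat.sum_antidiagonal_succ, Finset.Nat.sum_antidiagonal_succ, hm]
    have : ∀ p ∈ Finset.HasAntidiagonal.antidiagonal m,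
        co (p.1 + 1) β * co p.2 F' = co (p.1 + 1) β * co p.2 F := by
      intro p hp
      have := Finset.HasAntidiagonal.antidiagonal.snd_le hp
      rw [hlt _ (by omega)]
    rw [Finset.sum_congr rfl this, mul_add]
    abel
  have hγ2 : co (m + 1) (F' * γ') - co (m + 1) (F * γ) =
      co (m + 1) γ' - co (m + 1) γ + x * co 0 β := by
    rcases m with _ | m
    · simp only [co_mul, zero_add, Finset.Nat.antidiagonal_succ, Finset.Nat.antidiagonal_zero,
        Finset.map_singleton, Finset.sum_cons, Finset.sum_singleton, h₀, h₀', one_mul]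
      simp only [Function.Embedding.prodMap, Function.Embedding.coeFn_mk, Prod.map_apply,
        Nat.succ_eq_add_one, zero_add, Function.Embedding.refl_apply]
      have hm' : co 1 F' = co 1 F + x := hm
      rw [hm', h1 0 le_rfl, hγ₀, add_mul]
      abel
    · rw [co_mul_add_two, co_mul_add_two, hm, h₀, h₀', one_mul, one_mul, h1 0 (Nat.zero_le _), hγ₀]
      have : ∀ p ∈ Finset.HasAntidiagonal.antidiagonal m,
          co (p.1 + 1) F' * co (p.2 + 1) γ' = co (p.1 + 1) F * co (p.2 + 1) γ := by
        intro p hp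
        have := Finset.HasAntidiagonal.antidiagonal.fst_le hp
        have := Finset.HasAntidiagonal.antidiagonal.snd_le hp
        rw [hlt _ (by omega), h1 _ (by omega)]
      rw [Finset.sum_congr rfl this, add_mul]
      abel
  rw [hβ2, hγ2] at e2
  rw [← e2]
  abel

/-- A formal connection with regular leading term can be brought into `𝔱⟦z⟧`. -/
lemma formal_diagonalise {𝔤 𝔱 : Submodule ℂ (Matrix (Fin n) (Fin n) ℂ)}
    {A₀ : Matrix (Fin n) (Fin n) ℂ} {k : ℕ} (hk : 2 ≤ k)
    (hV : ∀ X ∈ 𝔤, ∀ Y ∈ 𝔤, X * Y - Y * X ∈ 𝔤) (hA₀ : A₀ ∈ 𝔱)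
    (hdec : ∀ X ∈ 𝔤, ∃ Y ∈ 𝔤, X + (A₀ * Y - Y * A₀) ∈ 𝔱)
    {β : Matrix (Fin n) (Fin n) ℂ⟦X⟧} (hβ : CoMem 𝔤 β) (hβ₀ : co 0 β = A₀) :
    ∃ F γ : Matrix (Fin n) (Fin n) ℂ⟦X⟧, HasLogDeriv 𝔤 F ∧ CoMem 𝔱 γ ∧
      F * γ + (PowerSeries.X : ℂ⟦X⟧) ^ k • dz F = β * F := by
  -- The gauge transformation is parametrised by its logarithmic derivative `d`, which is free in
  -- `𝔤`, so that it never leaves the formal group. The transformed connection is `F⁻¹ (β - z ^ k D)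
  -- F`.
  have hex : ∀ d : ℕ → 𝔤, ∃ γ : Matrix (Fin n) (Fin n) ℂ⟦X⟧, CoMem 𝔤 γ ∧
      sol (ofCo fun m => (d m : Matrix (Fin n) (Fin n) ℂ)) * γ + (PowerSeries.X : ℂ⟦X⟧) ^ k •
        dz (sol (ofCo fun m => (d m : Matrix (Fin n) (Fin n) ℂ))) =
      β * sol (ofCo fun m => (d m : Matrix (Fin n) (Fin n) ℂ)) := by
    intro d
    have hD : CoMem 𝔤 (ofCo fun m => (d m : Matrix (Fin n) (Fin n) ℂ)) := fun m => by
      rw [co_ofCo]; exact (d m).2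
    generalize (ofCo fun m => (d m : Matrix (Fin n) (Fin n) ℂ)) = D at hD
    have h0 := co_zero_sol D
    have hdz := dz_sol D
    obtain ⟨U, hU⟩ := exists_inverse h0
    rw [← hU] at h0 hdz ⊢
    refine ⟨(U⁻¹ : GL (Fin n) ℂ⟦X⟧) * (β - (PowerSeries.X : ℂ⟦X⟧) ^ k • D) * U,
      CoMem.conj_inv hV U.inv_mul U.mul_inv h0 hD hdz (hβ.sub (hD.X_pow_smul k)), ?_⟩
    rw [← mul_assoc, ← mul_assoc, ← Units.val_mul, mul_inv_cancel, Units.val_one, one_mul, hdz,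
      sub_mul, Matrix.smul_mul, sub_add_cancel]
  choose γ hγ𝔤 hγ using hex
  have hdep : ∀ (m : ℕ) (d d' : ℕ → 𝔤), (∀ j ≤ m, d j = d' j) →
      co (m + 1) (γ d) ∈ 𝔱 → co (m + 1) (γ d') ∈ 𝔱 := by
    intro m d d' hdd h
    obtain ⟨h1, h2⟩ := co_sol_perturb (D := ofCo fun m => (d m : Matrix (Fin n) (Fin n) ℂ))
      (D' := ofCo fun m => (d' m : Matrix (Fin n) (Fin n) ℂ)) (m := m) (x := 0)
      (fun j hj => by rw [co_ofCo, co_ofCo, hdd j hj.le])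
      (by rw [co_ofCo, co_ofCo, hdd m le_rfl, add_zero])
    have := co_gauge_perturb hk (co_zero_sol _) (co_zero_sol _) h1 h2 (hγ d) (hγ d')
    simp only [smul_zero, mul_zero, zero_mul, sub_zero, add_zero] at this
    simpa only [this] using h
  have hstep : ∀ (m : ℕ) (d : ℕ → 𝔤), ∃ x, co (m + 1) (γ (Function.update d m x)) ∈ 𝔱 := by
    intro m d
    obtain ⟨Y, hY, hYt⟩ := hdec _ (hγ𝔤 d (m + 1))
    -- The factor `m + 1` cancels the one from integrating `F' = D F`, so the coefficient of `F`
    -- changes by exactly `Y`.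
    let y : 𝔤 := ⟨((m : ℂ) + 1) • Y, 𝔤.smul_mem _ hY⟩
    refine ⟨d m + y, ?_⟩
    obtain ⟨h1, h2⟩ := co_sol_perturb (D := ofCo fun m => (d m : Matrix (Fin n) (Fin n) ℂ))
      (D' := ofCo fun j => ((Function.update d m (d m + y) j : 𝔤) : Matrix (Fin n) (Fin n) ℂ))
      (m := m) (x := y)
      (fun j hj => by rw [co_ofCo, co_ofCo, Function.update_of_ne hj.ne])
      (by rw [co_ofCo, co_ofCo, Function.update_self]; rfl)
    have := co_gauge_perturb hk (co_zero_sol _) (co_zero_sol _) h1 h2 (hγ d) (hγ _)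
    rw [smul_smul, inv_mul_cancel₀ (Nat.cast_add_one_ne_zero m), one_smul, hβ₀] at this
    rw [this]
    exact hYt
  obtain ⟨d, hd⟩ := exists_seq_of_prefix (α := 𝔤) (fun m d => co (m + 1) (γ d) ∈ 𝔱) hdep hstep
  refine ⟨_, γ d, ⟨co_zero_sol _, _, ?_, dz_sol _⟩, ?_, hγ d⟩
  · intro m
    rw [co_ofCo]; exact (d m).2
  · rintro (_ | m)
    · have e := congrArg (co 0) (hγ d)
      rw [map_add, co_X_pow_smul, if_neg (by omega), add_zero, co_zero_mul, co_zero_mul,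
        co_zero_sol, one_mul, mul_one] at e
      rw [e, hβ₀]; exact hA₀
    · exact hd m

/-- Existence of the formal normal form. -/
lemma formal_exists {𝔤 𝔱 : Submodule ℂ (Matrix (Fin n) (Fin n) ℂ)}
    {A₀ : Matrix (Fin n) (Fin n) ℂ} {k : ℕ} (hk : 2 ≤ k)
    (hV : ∀ X ∈ 𝔤, ∀ Y ∈ 𝔤, X * Y - Y * X ∈ 𝔤) (hle : 𝔱 ≤ 𝔤)
    (hcomm : ∀ X ∈ 𝔱, ∀ Y ∈ 𝔱, Commute X Y) (hA₀ : A₀ ∈ 𝔱)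
    (hdec : ∀ X ∈ 𝔤, ∃ Y ∈ 𝔤, X + (A₀ * Y - Y * A₀) ∈ 𝔱)
    {β : Matrix (Fin n) (Fin n) ℂ⟦X⟧} (hβ : CoMem 𝔤 β) (hβ₀ : co 0 β = A₀) :
    ∃ F α : Matrix (Fin n) (Fin n) ℂ⟦X⟧, HasLogDeriv 𝔤 F ∧ CoMem 𝔱 α ∧
      (∀ m, k ≤ m → co m α = 0) ∧ co 0 α = A₀ ∧
      F * α + (PowerSeries.X : ℂ⟦X⟧) ^ k • dz F = β * F := by
  obtain ⟨F, γ, hF, hγ, h⟩ := formal_diagonalise hk hV hA₀ hdec hβ hβ₀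
  -- Split `γ = α + z ^ k η` at degree `k`. The tail is absorbed by the solution of `E' = η E`,
  -- which commutes with `α`.
  set α : Matrix (Fin n) (Fin n) ℂ⟦X⟧ := ofCo fun m => if k ≤ m then 0 else co m γ with hαdef
  set η : Matrix (Fin n) (Fin n) ℂ⟦X⟧ := ofCo fun m => co (m + k) γ with hηdef
  have hα : CoMem 𝔱 α := fun m => by
    rw [hαdef, co_ofCo]
    split_ifs
    · exact 𝔱.zero_mem
    · exact hγ m
  have hη : CoMem 𝔱 η := fun m => by rw [hηdef, co_ofCo]; exact hγ _
  have hsplit : γ = α + (PowerSeries.X : ℂ⟦X⟧) ^ k • η := by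
    apply co_ext
    intro m
    rw [map_add, co_X_pow_smul, hαdef, hηdef, co_ofCo, co_ofCo]
    split_ifs with hm
    · rw [zero_add, Nat.sub_add_cancel hm]
    · rw [add_zero]
  have hcs : Commute (sol η) α := commute_of_co fun i j =>
    commute_sol (co_zero_sol η) (dz_sol η) (fun m => hcomm _ (hη m) _ (hα j)) i
  refine ⟨F * sol η, α, hF.mul hV ⟨co_zero_sol η, η, fun m => hle (hη m), dz_sol η⟩, hα, ?_, ?_, ?_⟩
  · intro m hm
    rw [hαdef, co_ofCo, if_pos hm]
  · have e := congrArg (co 0) h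
    rw [map_add, co_X_pow_smul, if_neg (by omega), add_zero, co_zero_mul, co_zero_mul,
      hF.1, one_mul, mul_one, hβ₀] at e
    rw [hαdef, co_ofCo, if_neg (by omega), e]
  · rw [mul_assoc, hcs.eq, dz_mul, dz_sol, ← mul_assoc β, ← h, hsplit, smul_add, mul_add, add_mul,
      add_mul, Matrix.mul_smul, Matrix.smul_mul, Matrix.smul_mul]
    simp only [mul_assoc]
    abel

end FormalGauge

/-! ### Diagonalisable groups -/

section Torus

variable {n : ℕ}

/-- The value at `d` of the character of the diagonal torus with exponent `m`. -/
def charVal (d : Fin n → ℂˣ) (m : Fin n → ℤ) : ℂˣ := ∏ i, d i ^ m i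

lemma charVal_add (d : Fin n → ℂˣ) (m m' : Fin n → ℤ) :
    charVal d (m + m') = charVal d m * charVal d m' := by
  simp [charVal, zpow_add, Finset.prod_mul_distrib]

lemma charVal_zero (d : Fin n → ℂˣ) : charVal d 0 = 1 := by simp [charVal]

lemma charVal_zsmul (d : Fin n → ℂˣ) (c : ℤ) (m : Fin n → ℤ) :
    charVal d (c • m) = charVal d m ^ c := by
  simp [charVal, zpow_mul, Finset.prod_zpow, mul_comm c]

lemma charVal_neg (d : Fin n → ℂˣ) (m : Fin n → ℤ) : charVal d (-m) = (charVal d m)⁻¹ := by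
  simp [charVal]

lemma charVal_mul (d d' : Fin n → ℂˣ) (m : Fin n → ℤ) :
    charVal (d * d') m = charVal d m * charVal d' m := by
  simp [charVal, mul_zpow, Finset.prod_mul_distrib]

lemma charVal_one (m : Fin n → ℤ) : charVal (1 : Fin n → ℂˣ) m = 1 := by simp [charVal]

lemma charVal_inv (d : Fin n → ℂˣ) (m : Fin n → ℤ) : charVal d⁻¹ m = (charVal d m)⁻¹ := by
  simp [charVal]

/-- The exponents of the characters trivial on `H`. -/
def trivialChars (H : Subgroup (Fin n → ℂˣ)) : Submodule ℤ (Fin n → ℤ) where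
  carrier := {m | ∀ d ∈ H, charVal d m = 1}
  zero_mem' := fun d _ => charVal_zero d
  add_mem' := fun {m m'} h h' d hd => by rw [charVal_add, h d hd, h' d hd, mul_one]
  smul_mem' := fun c m h d hd => by rw [charVal_zsmul, h d hd, one_zpow]

/-- The common kernel of a set of characters of the diagonal torus. -/
def charKernel (M : Submodule ℤ (Fin n → ℤ)) : Subgroup (Fin n → ℂˣ) where
  carrier := {d | ∀ m ∈ M, charVal d m = 1}
  one_mem' := fun m _ => charVal_one m
  mul_mem' := fun {d d'} h h' m hm => by rw [charVal_mul, h m hm, h' m hm, mul_one]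
  inv_mem' := fun {d} h m hm => by rw [charVal_inv, h m hm, inv_one]

/-- A polynomial vanishing on a subgroup of the diagonal torus vanishes on the common kernel of
the characters trivial on the subgroup. -/
lemma eval_eq_zero_of_mem_charKernel {H : Subgroup (Fin n → ℂˣ)} {F : MvPolynomial (Fin n) ℂ}
    (hF : ∀ d ∈ H, MvPolynomial.eval (fun i => (d i : ℂ)) F = 0) {d : Fin n → ℂˣ}
    (hd : d ∈ charKernel (trivialChars H)) : MvPolynomial.eval (fun i => (d i : ℂ)) F = 0 := by
  classical
  let mon : (Fin n → ℂˣ) → (Fin n →₀ ℕ) → ℂ := fun d p => ∏ i, (d i : ℂ) ^ p i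
  have hmon : ∀ d p, mon d p = (charVal d (fun i => (p i : ℤ)) : ℂ) := by
    intro d p; simp [mon, charVal]
  let χ : (Fin n →₀ ℕ) → (H →* ℂ) := fun p =>
    { toFun := fun d => mon d p
      map_one' := by simp [mon]
      map_mul' := fun a b => by simp [mon, mul_pow, Finset.prod_mul_distrib] }
  have hχ : ∀ p q, χ p = χ q → mon d p = mon d q := by
    intro p q hpq
    have : (fun i => (p i : ℤ)) - (fun i => (q i : ℤ)) ∈ trivialChars H := by
      intro e he
      have h := DFunLike.congr_fun hpq ⟨e, he⟩
      have h' : charVal e (fun i => (p i : ℤ)) = charVal e (fun i => (q i : ℤ)) :=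
        Units.ext ((hmon e p).symm.trans (h.trans (hmon e q)))
      rw [sub_eq_add_neg, charVal_add, charVal_neg, h', mul_inv_cancel]
    have h2 := hd _ this
    rw [sub_eq_add_neg, charVal_add, charVal_neg, mul_inv_eq_one] at h2
    rw [hmon, hmon, h2]
  -- A monomial's value at `d` depends only on its restriction to `H`, by `hχ`. The value `0` at
  -- other characters plays no role.
  let θ : (H →* ℂ) → ℂ := fun ψ => if h : ∃ p, χ p = ψ then mon d h.choose else 0
  have hθ : ∀ p, θ (χ p) = mon d p := by
    intro p
    have h : ∃ q, χ q = χ p := ⟨p, rfl⟩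
    simp only [θ, dif_pos h]
    exact hχ _ _ h.choose_spec
  -- Monomials are grouped by restriction to `H`. Dedekind's independence of characters makes each
  -- total coefficient vanish, and pairing with `θ` evaluates `F` at `d`.
  let c : (H →* ℂ) →₀ ℂ := ∑ p ∈ F.support, Finsupp.single (χ p) (MvPolynomial.coeff p F)
  have hc : c = 0 := by
    refine (linearIndependent_iff.mp (linearIndependent_monoidHom H ℂ)) c ?_
    ext e
    simp only [c, map_sum, Finsupp.linearCombination_single, Finset.sum_apply, Pi.smul_apply,
      smul_eq_mul, Pi.zero_apply]
    have := hF e e.2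
    rw [MvPolynomial.eval_eq'] at this
    exact this
  have h0 : Finsupp.linearCombination ℂ θ c = 0 := by rw [hc, map_zero]
  simp only [c, map_sum, Finsupp.linearCombination_single, hθ, smul_eq_mul] at h0
  rw [MvPolynomial.eval_eq']
  exact h0

/-- Exponential coordinates on the common kernel of a saturated group of characters. -/
lemma exists_log_of_mem_charKernel {M : Submodule ℤ (Fin n → ℤ)}
    (hM : ∀ (c : ℤ) (m : Fin n → ℤ), c ≠ 0 → c • m ∈ M → m ∈ M) {d : Fin n → ℂˣ}
    (hd : d ∈ charKernel M) :
    ∃ y : Fin n → ℂ, (∀ i, Complex.exp (y i) = d i) ∧ ∀ m ∈ M, ∑ i, (m i : ℂ) * y i = 0 := by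
  -- Saturation makes the quotient torsion-free, hence free and projective; the homomorphism to `ℂˣ`
  -- given by `d` then lifts through the surjection `exp : ℂ → ℂˣ`.
  have : Module.IsTorsionFree ℤ ((Fin n → ℤ) ⧸ M) := by
    constructor
    intro r hr x y hxy
    induction x using Submodule.Quotient.induction_on with | _ x
    induction y using Submodule.Quotient.induction_on with | _ y
    have h1 : Submodule.Quotient.mk (p := M) (r • x) = Submodule.Quotient.mk (r • y) := hxy
    rw [Submodule.Quotient.eq] at h1 ⊢
    rw [← smul_sub] at h1
    exact hM r _ (isRegular_iff_ne_zero.mp hr) h1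
  have : Module.Free ℤ ((Fin n → ℤ) ⧸ M) := Module.free_of_finite_type_torsion_free'
  let φ : (Fin n → ℤ) →ₗ[ℤ] Additive ℂˣ := AddMonoidHom.toIntLinearMap
    { toFun := fun m => Additive.ofMul (charVal d m)
      map_zero' := by rw [charVal_zero]; rfl
      map_add' := fun m m' => by rw [charVal_add]; rfl }
  let e : ℂ →ₗ[ℤ] Additive ℂˣ := AddMonoidHom.toIntLinearMap
    { toFun := fun z => Additive.ofMul (Units.mk0 (Complex.exp z) (Complex.exp_ne_zero z))
      map_zero' := by
        apply Additive.toMul.injective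
        ext; simp
      map_add' := fun m m' => by
        apply Additive.toMul.injective
        ext; simp [Complex.exp_add] }
  have he : Function.Surjective e := by
    intro u
    refine ⟨Complex.log (Additive.toMul u : ℂˣ), ?_⟩
    apply Additive.toMul.injective
    ext
    exact Complex.exp_log (Additive.toMul u : ℂˣ).ne_zero
  have hker : M ≤ LinearMap.ker φ := by
    intro m hm
    rw [LinearMap.mem_ker]
    exact congrArg Additive.ofMul (hd m hm)
  obtain ⟨ψ, hψ⟩ := Module.projective_lifting_property e (M.liftQ φ hker) he
  have hval : ∀ m, Complex.exp (ψ (Submodule.Quotient.mk m)) = charVal d m := by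
    intro m
    have := LinearMap.congr_fun hψ (Submodule.Quotient.mk m)
    exact congrArg (fun u : Additive ℂˣ => ((Additive.toMul u : ℂˣ) : ℂ)) this
  refine ⟨fun i => ψ (Submodule.Quotient.mk (Pi.single i 1)), ?_, ?_⟩
  · intro i
    rw [hval, charVal, Finset.prod_eq_single i]
    · simp
    · intro j _ hj
      simp [Pi.single_eq_of_ne hj]
    · simp
  · intro m hm
    have h1 : (Submodule.Quotient.mk m : (Fin n → ℤ) ⧸ M) = 0 :=
      (Submodule.Quotient.mk_eq_zero M).mpr hm
    have h2 : m = ∑ i, m i • (Pi.single i 1 : Fin n → ℤ) := by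
      ext j
      simp [Finset.sum_apply, Pi.single_apply]
    have h3 : ψ (M.mkQ m) = 0 := by
      rw [Submodule.mkQ_apply, h1, map_zero]
    rw [h2, map_sum, map_sum] at h3
    refine Eq.trans (Finset.sum_congr rfl fun i _ => ?_) h3
    rw [map_smul, map_smul, zsmul_eq_mul]
    rfl

/-! ### Diagonalisable subgroups and their Zariski closures. -/

/-- The diagonal matrices in the coordinates given by `h`. -/
def diagConj (h : GL (Fin n) ℂ) : (Fin n → ℂˣ) →* GL (Fin n) ℂ :=
  (MulAut.conj h⁻¹).toMonoidHom.comp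
    ((Units.map (Matrix.diagonalRingHom (Fin n) ℂ : (Fin n → ℂ) →* Matrix (Fin n) (Fin n) ℂ)).comp
      MulEquiv.piUnits.symm.toMonoidHom)

lemma conj_diagConj (h : GL (Fin n) ℂ) (d : Fin n → ℂˣ) :
    ((h * diagConj h d * h⁻¹ : GL (Fin n) ℂ) : Matrix (Fin n) (Fin n) ℂ) =
      Matrix.diagonal fun i => (d i : ℂ) := by
  have : h * diagConj h d * h⁻¹ = Units.map
      (Matrix.diagonalRingHom (Fin n) ℂ : (Fin n → ℂ) →* Matrix (Fin n) (Fin n) ℂ)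
      (MulEquiv.piUnits.symm d) := by
    simp [diagConj, mul_assoc]
  rw [this]
  rfl

lemma coe_diagConj (h : GL (Fin n) ℂ) (d : Fin n → ℂˣ) :
    (diagConj h d : Matrix (Fin n) (Fin n) ℂ) =
      ((h⁻¹ : GL (Fin n) ℂ) : Matrix (Fin n) (Fin n) ℂ) *
        Matrix.diagonal (fun i => (d i : ℂ)) * h := by
  rw [← conj_diagConj h d, ← Units.val_mul, ← Units.val_mul]
  simp [mul_assoc]

lemma exists_diagConj {h t : GL (Fin n) ℂ}
    (ht : ((h * t * h⁻¹ : GL (Fin n) ℂ) : Matrix (Fin n) (Fin n) ℂ).IsDiag) :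
    ∃ d, diagConj h d = t := by
  obtain ⟨u, hu⟩ : ∃ u : GL (Fin n) ℂ, u = h * t * h⁻¹ := ⟨_, rfl⟩
  rw [← hu] at ht
  have hdet : (u : Matrix (Fin n) (Fin n) ℂ).det ≠ 0 := by
    have := (Matrix.isUnit_iff_isUnit_det _).mp u.isUnit
    exact this.ne_zero
  rw [← ht.diagonal_diag, Matrix.det_diagonal, Finset.prod_ne_zero_iff] at hdet
  refine ⟨fun i => Units.mk0 _ (hdet i (Finset.mem_univ i)), ?_⟩
  have : h * diagConj h (fun i => Units.mk0 _ (hdet i (Finset.mem_univ i))) * h⁻¹ =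
      h * t * h⁻¹ := by
    rw [← hu]
    ext1
    rw [conj_diagConj]
    exact ht.diagonal_diag
  exact mul_left_cancel (mul_right_cancel this)

/-- The entries of `h M h⁻¹` as polynomials in those of `M`. -/
def conjEntry (h : GL (Fin n) ℂ) (i j : Fin n) : MvPolynomial (Fin n × Fin n) ℂ :=
  ∑ a, ∑ b, MvPolynomial.C ((h : Matrix (Fin n) (Fin n) ℂ) i a *
    ((h⁻¹ : GL (Fin n) ℂ) : Matrix (Fin n) (Fin n) ℂ) b j) * MvPolynomial.X (a, b)

lemma polyAt_conjEntry (h : GL (Fin n) ℂ) (i j : Fin n) (M : Matrix (Fin n) (Fin n) ℂ) :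
    polyAt (conjEntry h i j) M =
      ((h : Matrix (Fin n) (Fin n) ℂ) * M * ((h⁻¹ : GL (Fin n) ℂ) : Matrix (Fin n) (Fin n) ℂ)) i j
      := by
  simp only [conjEntry, polyAt_sum, polyAt_mul, polyAt_C, polyAt_X, Matrix.mul_apply,
    Finset.sum_mul, Algebra.algebraMap_self, RingHom.id_apply]
  rw [Finset.sum_comm]
  exact Finset.sum_congr rfl fun a _ => Finset.sum_congr rfl fun b _ => by ring

lemma polyAt_conjEntry_diagConj (h : GL (Fin n) ℂ) (i j : Fin n) (d : Fin n → ℂˣ) :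
    polyAt (conjEntry h i j) (diagConj h d : Matrix (Fin n) (Fin n) ℂ) =
      Matrix.diagonal (fun i => (d i : ℂ)) i j := by
  rw [polyAt_conjEntry, ← conj_diagConj h d, Units.val_mul, Units.val_mul]

lemma isAlgebraic_map_diagConj (h : GL (Fin n) ℂ) (M : Submodule ℤ (Fin n → ℤ)) :
    IsAlgebraic ((charKernel M).map (diagConj h)) := by
  -- The equations say that off-diagonal entries vanish and that `x ^ p = x ^ q` on the diagonal for
  -- `p - q ∈ M`. Positive and negative parts write any integral exponent as such a difference.
  refine ⟨{f | ∃ i j, i ≠ j ∧ f = conjEntry h i j} ∪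
    {f | ∃ p q : Fin n → ℕ, (fun i => (p i : ℤ)) - (fun i => (q i : ℤ)) ∈ M ∧
      f = ∏ i, conjEntry h i i ^ p i + MvPolynomial.C (-1) * ∏ i, conjEntry h i i ^ q i}, ?_⟩
  have hprod : ∀ (d : Fin n → ℂˣ) (p : Fin n → ℕ),
      polyAt (∏ i, conjEntry h i i ^ p i) (diagConj h d : Matrix (Fin n) (Fin n) ℂ) =
        charVal d (fun i => (p i : ℤ)) := by
    intro d p
    have : ∀ i, polyAt (conjEntry h i i ^ p i) (diagConj h d : Matrix (Fin n) (Fin n) ℂ) =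
        (d i : ℂ) ^ p i := by
      intro i
      rw [polyAt, map_pow]
      congr 1
      have := polyAt_conjEntry_diagConj h i i d
      rw [Matrix.diagonal_apply_eq] at this
      exact this
    rw [polyAt, map_prod]
    simp only [polyAt] at this
    simp [this, charVal]
  have hdiff : ∀ (d : Fin n → ℂˣ) (p q : Fin n → ℕ),
      polyAt (∏ i, conjEntry h i i ^ p i + MvPolynomial.C (-1) * ∏ i, conjEntry h i i ^ q i)
        (diagConj h d : Matrix (Fin n) (Fin n) ℂ) = 0 ↔
        charVal d ((fun i => (p i : ℤ)) - (fun i => (q i : ℤ))) = 1 := by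
    intro d p q
    rw [polyAt_add, polyAt_mul, hprod, hprod, polyAt_C, sub_eq_add_neg, charVal_add, charVal_neg,
      mul_inv_eq_one, ← Units.val_inj]
    simp [add_neg_eq_zero]
  intro g
  constructor
  · rintro ⟨d, hd, rfl⟩ f (⟨i, j, hij, rfl⟩ | ⟨p, q, hpq, rfl⟩)
    · rw [polyAt_conjEntry_diagConj, Matrix.diagonal_apply_ne _ hij]
    · exact (hdiff d p q).mpr (hd _ hpq)
  · intro hg
    obtain ⟨d, rfl⟩ : ∃ d, diagConj h d = g := by
      apply exists_diagConj
      intro i j hij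
      have := hg _ (Or.inl ⟨i, j, hij, rfl⟩)
      rwa [polyAt_conjEntry, ← Units.val_mul, ← Units.val_mul] at this
    refine ⟨d, fun m hm => ?_, rfl⟩
    have hm' : (fun i => ((m i).toNat : ℤ)) - (fun i => ((-m i).toNat : ℤ)) = m := by
      ext i
      exact Int.toNat_sub_toNat_neg (m i)
    have := (hdiff d (fun i => (m i).toNat) (fun i => (-m i).toNat)).mp
      (hg _ (Or.inr ⟨_, _, by rw [hm']; exact hm, rfl⟩))
    rwa [hm'] at this

/-- An equation of `G`, restricted to the diagonal torus, is a polynomial in the diagonal entries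
that vanishes on `H`, so `eval_eq_zero_of_mem_charKernel` applies. -/
lemma map_diagConj_le {h : GL (Fin n) ℂ} {H G : Subgroup (GL (Fin n) ℂ)} (hG : IsAlgebraic G)
    (hHG : H ≤ G) :
    (charKernel (trivialChars (H.comap (diagConj h)))).map (diagConj h) ≤ G := by
  obtain ⟨S, hS⟩ := hG
  rintro _ ⟨d, hd, rfl⟩
  rw [hS]
  intro f hf
  let F : MvPolynomial (Fin n) ℂ := polyAt f
    (((h⁻¹ : GL (Fin n) ℂ) : Matrix (Fin n) (Fin n) ℂ).map MvPolynomial.C *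
      Matrix.diagonal MvPolynomial.X * (h : Matrix (Fin n) (Fin n) ℂ).map MvPolynomial.C)
  have hFe : ∀ e : Fin n → ℂˣ, MvPolynomial.eval (fun i => (e i : ℂ)) F =
      polyAt f (diagConj h e : Matrix (Fin n) (Fin n) ℂ) := by
    intro e
    have := map_polyAt (MvPolynomial.aeval (R := ℂ) (fun i => (e i : ℂ))) f
      (((h⁻¹ : GL (Fin n) ℂ) : Matrix (Fin n) (Fin n) ℂ).map MvPolynomial.C *
      Matrix.diagonal MvPolynomial.X * (h : Matrix (Fin n) (Fin n) ℂ).map MvPolynomial.C)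
    refine (DFunLike.congr_fun (MvPolynomial.coe_aeval_eq_eval _) F).symm.trans (this.trans ?_)
    congr 1
    rw [coe_diagConj]
    ext i j
    simp [Matrix.mul_apply, Matrix.diagonal_apply]
  rw [← hFe]
  refine eval_eq_zero_of_mem_charKernel (fun e he => ?_) hd
  rw [hFe]
  exact (hS _).mp (hHG he) f hf

/-- The characters trivial on a connected group form a saturated subgroup. -/
lemma saturated_trivialChars {h : GL (Fin n) ℂ} {H : Subgroup (GL (Fin n) ℂ)}
    (hconn : IsConnected (H : Set (GL (Fin n) ℂ)))
    (hd : ∀ t ∈ H, ((h * t * h⁻¹ : GL (Fin n) ℂ) : Matrix (Fin n) (Fin n) ℂ).IsDiag)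
    {c : ℤ} {m : Fin n → ℤ} (hc : c ≠ 0)
    (hm : c • m ∈ trivialChars (H.comap (diagConj h))) :
    m ∈ trivialChars (H.comap (diagConj h)) := by
  let f : GL (Fin n) ℂ → ℂ := fun g =>
    ∏ i, ((h * g * h⁻¹ : GL (Fin n) ℂ) : Matrix (Fin n) (Fin n) ℂ) i i ^ m i
  have hf : ∀ d, f (diagConj h d) = charVal d m := by
    intro d
    simp only [f, conj_diagConj, Matrix.diagonal_apply_eq]
    simp [charVal]
  have hcont : ContinuousOn f H := by
    refine continuousOn_finsetProd _ fun i _ => ?_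
    intro g hg
    have h1 : Continuous fun g : GL (Fin n) ℂ =>
        ((h * g * h⁻¹ : GL (Fin n) ℂ) : Matrix (Fin n) (Fin n) ℂ) i i := by
      have : Continuous fun g : GL (Fin n) ℂ => h * g * h⁻¹ := by fun_prop
      exact (Units.continuous_val.comp this).matrix_elem i i
    refine (h1.continuousAt.zpow₀ _ (Or.inl ?_)).continuousWithinAt
    obtain ⟨d, rfl⟩ := exists_diagConj (hd g hg)
    rw [conj_diagConj, Matrix.diagonal_apply_eq]
    exact (d i).ne_zero
  -- On `H` the character takes roots of unity of order dividing `c` as values; a connected set has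
  -- a single image point among these finitely many.
  have hfin : (f '' H).Finite := by
    have hN : 0 < c.natAbs := Int.natAbs_pos.mpr hc
    refine Set.Finite.subset (s := {z : ℂ | z ^ c.natAbs = 1}) ?_ ?_
    · have := (Polynomial.nthRoots c.natAbs (1 : ℂ)).toFinset.finite_toSet
      refine this.subset fun z hz => ?_
      simpa [Polynomial.mem_nthRoots hN] using hz
    · rintro _ ⟨g, hg, rfl⟩
      obtain ⟨d, rfl⟩ := exists_diagConj (hd g hg)
      have h1 := hm d hg
      rw [charVal_zsmul] at h1
      rw [Set.mem_ofPred_eq, hf, ← Units.val_pow_eq_pow_val, Units.val_eq_one]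
      rcases Int.natAbs_eq c with h2 | h2
      · rw [h2, zpow_natCast] at h1; exact h1
      · rw [h2, zpow_neg, inv_eq_one, zpow_natCast] at h1; exact h1
  have hsub : (f '' H).Subsingleton := by
    by_contra hns
    rw [Set.not_subsingleton_iff] at hns
    exact (hconn.isPreconnected.image f hcont).infinite_of_nontrivial hns hfin
  intro d hd'
  have := hsub ⟨_, hd', rfl⟩ ⟨_, (H.comap (diagConj h)).one_mem, rfl⟩
  rw [hf, hf, charVal_one] at this
  exact Units.ext this

/-- The Zariski closure of a connected diagonalisable group is a torus and is covered by
one-parameter groups. -/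
theorem exists_torus_closure {H : Subgroup (GL (Fin n) ℂ)}
    (hconn : IsConnected (H : Set (GL (Fin n) ℂ))) {h : GL (Fin n) ℂ}
    (hd : ∀ t ∈ H, ((h * t * h⁻¹ : GL (Fin n) ℂ) : Matrix (Fin n) (Fin n) ℂ).IsDiag) :
    ∃ T : Subgroup (GL (Fin n) ℂ), IsTorus T ∧ H ≤ T ∧
      (∀ G : Subgroup (GL (Fin n) ℂ), IsAlgebraic G → H ≤ G → T ≤ G) ∧
      ∀ t ∈ T, ∃ Y : Matrix (Fin n) (Fin n) ℂ, (t : Matrix (Fin n) (Fin n) ℂ) = NormedSpace.exp Y ∧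
        ∀ s : ℂ, ∃ g ∈ T, (g : Matrix (Fin n) (Fin n) ℂ) = NormedSpace.exp (s • Y) := by
  set M := trivialChars (H.comap (diagConj h)) with hMdef
  have hlog : ∀ d ∈ charKernel M, ∃ y : Fin n → ℂ, (∀ i, Complex.exp (y i) = d i) ∧
      ∀ s : ℂ, (fun i => Units.mk0 (Complex.exp (s * y i)) (Complex.exp_ne_zero _)) ∈
        charKernel M := by
    intro d hdM
    obtain ⟨y, hy, hyM⟩ := exists_log_of_mem_charKernel
      (fun c m hc hm => saturated_trivialChars hconn hd hc hm) hdM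
    refine ⟨y, hy, fun s m hm => Units.ext ?_⟩
    have : ((charVal (fun i => Units.mk0 (Complex.exp (s * y i)) (Complex.exp_ne_zero _)) m : ℂˣ)
        : ℂ) = ∏ i, Complex.exp (s * y i) ^ m i := by simp [charVal]
    rw [this, Units.val_one]
    simp_rw [← Complex.exp_int_mul]
    rw [← Complex.exp_sum]
    have h2 : ∑ i, (m i : ℂ) * (s * y i) = s * ∑ i, (m i : ℂ) * y i := by
      rw [Finset.mul_sum]; exact Finset.sum_congr rfl fun i _ => by ring
    rw [h2, hyM m hm, mul_zero, Complex.exp_zero]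
  have hexp : ∀ (y : Fin n → ℂ) (s : ℂ), (diagConj h
      (fun i => Units.mk0 (Complex.exp (s * y i)) (Complex.exp_ne_zero _)) :
      Matrix (Fin n) (Fin n) ℂ) =
      NormedSpace.exp (s • (((h⁻¹ : GL (Fin n) ℂ) : Matrix (Fin n) (Fin n) ℂ) *
        Matrix.diagonal y * h)) := by
    intro y s
    rw [← Matrix.smul_mul, ← Matrix.mul_smul, Matrix.exp_units_conj', coe_diagConj,
      ← Matrix.diagonal_smul, Matrix.exp_diagonal]
    congr 3
    ext i
    rw [Pi.coe_exp, ← Complex.exp_eq_exp_ℂ]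
    rfl
  refine ⟨(charKernel M).map (diagConj h), ⟨isAlgebraic_map_diagConj h M, ?_, h, ?_⟩, ?_,
    fun G hG hHG => map_diagConj_le hG hHG, ?_⟩
  · refine ⟨⟨1, Subgroup.one_mem _⟩, isPreconnected_of_forall 1 ?_⟩
    rintro _ ⟨d, hdM, rfl⟩
    obtain ⟨y, hy, hyM⟩ := hlog d hdM
    let γ : ℂ → GL (Fin n) ℂ := fun s => diagConj h
      (fun i => Units.mk0 (Complex.exp (s * y i)) (Complex.exp_ne_zero _))
    have hval : Continuous fun s => (γ s : Matrix (Fin n) (Fin n) ℂ) := by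
      simp only [γ, coe_diagConj]
      refine (continuous_const.matrix_mul (Continuous.matrix_diagonal ?_)).matrix_mul
        continuous_const
      exact continuous_pi fun i => by simpa using by fun_prop
    have hγ : Continuous γ := by
      rw [Units.continuous_iff]
      refine ⟨hval, ?_⟩
      have : ∀ s, (γ s)⁻¹ = γ (-s) := by
        intro s
        simp only [γ]
        rw [← map_inv]
        congr 1
        ext i
        simp [Complex.exp_neg]
      simp only [this]
      exact hval.comp continuous_neg
    refine ⟨Set.range γ, ?_, ⟨0, ?_⟩, ⟨1, ?_⟩, isPreconnected_range hγ⟩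
    · rintro _ ⟨s, rfl⟩
      exact ⟨_, hyM s, rfl⟩
    · have : (fun i => Units.mk0 (Complex.exp (0 * y i)) (Complex.exp_ne_zero _)) =
        (1 : Fin n → ℂˣ) := by ext i; simp
      simp only [γ]
      rw [this, map_one]
    · simp only [γ]
      congr 1
      ext i
      simp [hy i]
  · rintro _ ⟨d, -, rfl⟩
    rw [conj_diagConj]
    exact Matrix.isDiag_diagonal _
  · intro t ht
    obtain ⟨d, rfl⟩ := exists_diagConj (hd t ht)
    exact ⟨d, fun m hm => hm d ht, rfl⟩
  · rintro _ ⟨d, hdM, rfl⟩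
    obtain ⟨y, hy, hyM⟩ := hlog d hdM
    refine ⟨_, ?_, fun s => ⟨_, ⟨_, hyM s, rfl⟩, hexp y s⟩⟩
    rw [← one_smul ℂ (((h⁻¹ : GL (Fin n) ℂ) : Matrix (Fin n) (Fin n) ℂ) *
        Matrix.diagonal y * h), ← hexp y 1]
    congr 2
    ext i
    simp [hy i]

end Torus

/-! ### One-parameter groups -/

section Exponential

variable {n : ℕ}

lemma hasDerivAt_polyAt {M : ℂ → Matrix (Fin n) (Fin n) ℂ} {M' : Matrix (Fin n) (Fin n) ℂ} {t : ℂ}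
    (hM : ∀ i j, HasDerivAt (fun s => M s i j) (M' i j) t)
    (f : MvPolynomial (Fin n × Fin n) ℂ) :
    HasDerivAt (fun s => polyAt f (M s))
      (∑ i, ∑ j, M' i j * polyAt (MvPolynomial.pderiv (i, j) f) (M t)) t := by
  induction f using MvPolynomial.induction_on with
  | C a =>
    simp only [polyAt_C, MvPolynomial.pderiv_C]
    simpa [polyAt] using hasDerivAt_const t a
  | add p q hp hq =>
    simp only [polyAt_add, map_add, mul_add, Finset.sum_add_distrib]
    exact hp.add hq
  | mul_X p ij hp =>
    obtain ⟨a, b⟩ := ij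
    simp only [polyAt_mul, polyAt_X]
    refine (hp.mul (hM a b)).congr_deriv ?_
    simp only [Derivation.leibniz, polyAt_add, smul_eq_mul, polyAt_mul, MvPolynomial.pderiv_X,
      mul_add, Finset.sum_add_distrib, polyAt_X]
    rw [add_comm]
    congr 1
    · rw [Finset.sum_eq_single a, Finset.sum_eq_single b]
      · simp [polyAt, mul_comm]
      · intro j _ hj
        rw [Pi.single_eq_of_ne]
        · simp [polyAt]
        · intro h; exact hj (Prod.ext_iff.mp h).2.symm
      · simp
      · intro i _ hi
        refine Finset.sum_eq_zero fun j _ => ?_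
        rw [Pi.single_eq_of_ne]
        · simp [polyAt]
        · intro h; exact hi (Prod.ext_iff.mp h).1.symm
      · simp
    · rw [Finset.sum_mul]
      refine Finset.sum_congr rfl fun i _ => ?_
      rw [Finset.sum_mul]
      exact Finset.sum_congr rfl fun j _ => by ring

section

attribute [local instance] Matrix.linftyOpNormedRing Matrix.linftyOpNormedAlgebra

lemma hasDerivAt_exp_entry (Y : Matrix (Fin n) (Fin n) ℂ) (t : ℂ) (i j : Fin n) :
    HasDerivAt (fun s : ℂ => NormedSpace.exp (s • Y) i j)
      ((Y * NormedSpace.exp (t • Y)) i j) t := by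
  have h := hasDerivAt_exp_smul_const' (𝕂 := ℂ) Y t
  exact ((Matrix.entryLinearMap ℂ ℂ i j).toContinuousLinearMap.hasFDerivAt.comp_hasDerivAt t h)

lemma continuous_exp_smul (Y : Matrix (Fin n) (Fin n) ℂ) :
    Continuous fun s : ℂ => NormedSpace.exp (s • Y) :=
  continuous_iff_continuousAt.mpr fun t => (hasDerivAt_exp_smul_const (𝕂 := ℂ) Y t).continuousAt

end

/-- A polynomial vanishing on `G` vanishes on the one-parameter groups of elements of `𝔤`. -/
lemma polyAt_exp_eq_zero {G : Subgroup (GL (Fin n) ℂ)} {Y : Matrix (Fin n) (Fin n) ℂ}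
    (hY : Y ∈ lieAlg G) {f : MvPolynomial (Fin n × Fin n) ℂ} (hf : f ∈ vanishing G) (t : ℂ) :
    polyAt f (NormedSpace.exp (t • Y)) = 0 := by
  have hder : ∀ (g : MvPolynomial (Fin n × Fin n) ℂ) (t : ℂ),
      HasDerivAt (fun s : ℂ => polyAt g (NormedSpace.exp (s • Y)))
        (polyAt (fieldDeriv Y g) (NormedSpace.exp (t • Y))) t := by
    intro g t
    refine (hasDerivAt_polyAt (hasDerivAt_exp_entry Y t) g).congr_deriv ?_
    rw [polyAt_fieldDeriv]
    rfl
  -- Each derivative in `t` replaces `g` by an invariant derivative, again in the ideal of `G`. All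
  -- Taylor coefficients of an entire function thus vanish at `0`.
  have hiter : ∀ (m : ℕ) (g : MvPolynomial (Fin n × Fin n) ℂ), g ∈ vanishing G →
      iteratedDeriv m (fun s : ℂ => polyAt g (NormedSpace.exp (s • Y))) 0 = 0 := by
    intro m
    induction m with
    | zero =>
      intro g hg
      rw [iteratedDeriv_zero, zero_smul, NormedSpace.exp_zero]
      exact hg 1 G.one_mem
    | succ m ih =>
      intro g hg
      rw [iteratedDeriv_succ', funext fun t => (hder g t).deriv]
      exact ih _ (fieldDeriv_mem_vanishing hY hg)
  have := Complex.taylorSeries_eq_of_entire' 0 t (fun t => (hder f t).differentiableAt)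
  rw [← this]
  simp [hiter _ f hf]

lemma exp_mem_of_mem_lieAlg {G : Subgroup (GL (Fin n) ℂ)} (hG : IsAlgebraic G)
    {Y : Matrix (Fin n) (Fin n) ℂ} (hY : Y ∈ lieAlg G) {g : GL (Fin n) ℂ} {t : ℂ}
    (hg : (g : Matrix (Fin n) (Fin n) ℂ) = NormedSpace.exp (t • Y)) : g ∈ G := by
  obtain ⟨S, hS⟩ := hG
  rw [hS]
  intro f hf
  rw [hg]
  exact polyAt_exp_eq_zero hY (fun g' hg' => (hS g').mp hg' f hf) t

lemma realLieAlg_subset_lieAlg (G : Subgroup (GL (Fin n) ℂ)) : realLieAlg G ⊆ lieAlg G := by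
  intro Y hY
  rw [SetLike.mem_coe, mem_lieAlg_iff]
  intro f hf
  have h := hasDerivAt_polyAt (t := ((0 : ℝ) : ℂ)) (hasDerivAt_exp_entry Y _) f
  have h2 := h.comp_ofReal
  have h3 : (fun s : ℝ => polyAt f (NormedSpace.exp ((s : ℂ) • Y))) = fun _ => 0 := by
    funext s
    obtain ⟨g, hg, hgY⟩ := hY s
    rw [← hgY]
    exact hf g hg
  rw [h3] at h2
  have h4 := h2.unique (hasDerivAt_const _ _)
  simpa [dOne] using h4

lemma realLieAlg_mono {K G : Subgroup (GL (Fin n) ℂ)} (h : K ≤ G) :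
    realLieAlg K ⊆ realLieAlg G := fun _ hY t =>
  let ⟨g, hg, hgY⟩ := hY t
  ⟨g, h hg, hgY⟩

/-- The one-parameter group generated by `Y`. -/
def oneParam (Y : Matrix (Fin n) (Fin n) ℂ) (t : ℂ) : GL (Fin n) ℂ where
  val := NormedSpace.exp (t • Y)
  inv := NormedSpace.exp ((-t) • Y)
  val_inv := by
    rw [← Matrix.exp_add_of_commute _ _ (((Commute.refl Y).smul_left t).smul_right (-t)),
      ← add_smul, add_neg_cancel, zero_smul, NormedSpace.exp_zero]
  inv_val := by
    rw [← Matrix.exp_add_of_commute _ _ (((Commute.refl Y).smul_left (-t)).smul_right t),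
      ← add_smul, neg_add_cancel, zero_smul, NormedSpace.exp_zero]

@[simp] lemma coe_oneParam (Y : Matrix (Fin n) (Fin n) ℂ) (t : ℂ) :
    (oneParam Y t : Matrix (Fin n) (Fin n) ℂ) = NormedSpace.exp (t • Y) := rfl

lemma oneParam_add (Y : Matrix (Fin n) (Fin n) ℂ) (s t : ℂ) :
    oneParam Y (s + t) = oneParam Y s * oneParam Y t := by
  ext1
  rw [Units.val_mul, coe_oneParam, coe_oneParam, coe_oneParam, add_smul,
    Matrix.exp_add_of_commute _ _ (((Commute.refl Y).smul_left s).smul_right t)]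

@[simp] lemma oneParam_zero (Y : Matrix (Fin n) (Fin n) ℂ) : oneParam Y 0 = 1 := by
  ext1
  simp [NormedSpace.exp_zero]

lemma oneParam_neg (Y : Matrix (Fin n) (Fin n) ℂ) (t : ℂ) :
    oneParam Y (-t) = (oneParam Y t)⁻¹ := by
  rw [eq_inv_iff_mul_eq_one, ← oneParam_add, neg_add_cancel, oneParam_zero]

lemma continuous_oneParam (Y : Matrix (Fin n) (Fin n) ℂ) : Continuous (oneParam Y) := by
  rw [Units.continuous_iff]
  refine ⟨continuous_exp_smul Y, ?_⟩
  simp only [← oneParam_neg]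
  exact (continuous_exp_smul Y).comp continuous_neg

/-- The Lie algebra of a torus consists of simultaneously diagonalisable matrices. -/
lemma isDiag_of_mem_lieAlg {T : Subgroup (GL (Fin n) ℂ)} {h : GL (Fin n) ℂ}
    (hd : ∀ t ∈ T, ((h * t * h⁻¹ : GL (Fin n) ℂ) : Matrix (Fin n) (Fin n) ℂ).IsDiag)
    {X : Matrix (Fin n) (Fin n) ℂ} (hX : X ∈ lieAlg T) :
    ((h : Matrix (Fin n) (Fin n) ℂ) * X *
      ((h⁻¹ : GL (Fin n) ℂ) : Matrix (Fin n) (Fin n) ℂ)).IsDiag := by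
  intro i j hij
  -- An off-diagonal entry is a linear function vanishing on `T`, and it equals its own
  -- differential.
  have hv : conjEntry h i j ∈ vanishing T := by
    intro t ht
    rw [polyAt_conjEntry, ← Units.val_mul, ← Units.val_mul]
    exact hd t ht hij
  have h1 := hX _ hv
  change dOne _ X = 0 at h1
  rw [← polyAt_fieldDeriv_one, conjEntry] at h1
  simp only [map_sum, Derivation.leibniz, MvPolynomial.derivation_C, smul_eq_mul, mul_zero,
    add_zero, fieldDeriv_X, polyAt_sum, polyAt_mul, polyAt_C, polyAt_X] at h1
  simp only [Matrix.one_apply, mul_ite, mul_one, mul_zero, Finset.sum_ite_eq', Finset.mem_univ,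
    if_true, Algebra.algebraMap_self, RingHom.id_apply] at h1
  rw [← h1]
  simp only [Matrix.mul_apply, Finset.sum_mul]
  rw [Finset.sum_comm]
  exact Finset.sum_congr rfl fun a _ => Finset.sum_congr rfl fun b _ => by ring

/-- A torus is covered by the exponentials of its Lie algebra. -/
lemma IsTorus.exists_exp {T : Subgroup (GL (Fin n) ℂ)} (hT : IsTorus T) {t : GL (Fin n) ℂ}
    (ht : t ∈ T) :
    ∃ Y ∈ lieAlg T, (t : Matrix (Fin n) (Fin n) ℂ) = NormedSpace.exp Y := by
  obtain ⟨h, hd⟩ := hT.diagonalizable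
  obtain ⟨T', -, hle, hmin, hexp⟩ := exists_torus_closure hT.connected hd
  obtain ⟨Y, hY, hY'⟩ := hexp t (hle ht)
  refine ⟨Y, realLieAlg_subset_lieAlg T fun s => ?_, hY⟩
  obtain ⟨g, hg, hgY⟩ := hY' s
  exact ⟨g, hmin T hT.algebraic le_rfl hg, hgY⟩

end Exponential

/-! ### Semisimple matrices -/

section Semisimple

variable {n : ℕ}

/-- A matrix annihilated by a squarefree polynomial. -/
def IsSemisimpleMat (X : Matrix (Fin n) (Fin n) ℂ) : Prop :=
  ∃ p : Polynomial ℂ, Squarefree p ∧ Polynomial.aeval X p = 0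

lemma isSemisimpleMat_iff {X : Matrix (Fin n) (Fin n) ℂ} :
    IsSemisimpleMat X ↔ Module.End.IsSemisimple (Matrix.toLinAlgEquiv' X) := by
  constructor
  · rintro ⟨p, hp, hX⟩
    refine Module.End.isSemisimple_of_squarefree_aeval_eq_zero hp ?_
    rw [Polynomial.aeval_algHom_apply, hX, map_zero]
  · intro h
    refine ⟨_, h.minpoly_squarefree, ?_⟩
    apply (Matrix.toLinAlgEquiv' (R := ℂ) (n := Fin n)).injective
    rw [← Polynomial.aeval_algHom_apply, minpoly.aeval, map_zero]

lemma units_conj_mul (h : GL (Fin n) ℂ) (Z W : Matrix (Fin n) (Fin n) ℂ) :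
    (h : Matrix (Fin n) (Fin n) ℂ) * Z * ((h⁻¹ : GL (Fin n) ℂ) : Matrix (Fin n) (Fin n) ℂ) *
      ((h : Matrix (Fin n) (Fin n) ℂ) * W * ((h⁻¹ : GL (Fin n) ℂ) : Matrix (Fin n) (Fin n) ℂ)) =
    (h : Matrix (Fin n) (Fin n) ℂ) * (Z * W) *
      ((h⁻¹ : GL (Fin n) ℂ) : Matrix (Fin n) (Fin n) ℂ) := by
  simp only [mul_assoc]
  rw [← mul_assoc ((h⁻¹ : GL (Fin n) ℂ) : Matrix (Fin n) (Fin n) ℂ) h, h.inv_mul, one_mul]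

lemma aeval_units_conj (h : GL (Fin n) ℂ) (X : Matrix (Fin n) (Fin n) ℂ) (p : Polynomial ℂ) :
    Polynomial.aeval ((h : Matrix (Fin n) (Fin n) ℂ) * X *
      ((h⁻¹ : GL (Fin n) ℂ) : Matrix (Fin n) (Fin n) ℂ)) p =
    (h : Matrix (Fin n) (Fin n) ℂ) * Polynomial.aeval X p *
      ((h⁻¹ : GL (Fin n) ℂ) : Matrix (Fin n) (Fin n) ℂ) := by
  induction p using Polynomial.induction_on' with
  | add p q hp hq => simp only [map_add, hp, hq, mul_add, add_mul]
  | monomial m a =>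
    rw [Polynomial.aeval_monomial, Polynomial.aeval_monomial, Units.conj_pow,
      ← Algebra.smul_def, ← Algebra.smul_def, Matrix.mul_smul, Matrix.smul_mul]

lemma aeval_diagonal (d : Fin n → ℂ) (p : Polynomial ℂ) :
    Polynomial.aeval (Matrix.diagonal d) p = Matrix.diagonal fun i => p.eval (d i) := by
  have := Polynomial.aeval_algHom_apply (Matrix.diagonalAlgHom ℂ (α := ℂ)) d p
  refine this.trans ?_
  rw [Polynomial.aeval_pi_apply]
  rfl

lemma eq_zero_of_units_conj {h : GL (Fin n) ℂ} {Z : Matrix (Fin n) (Fin n) ℂ}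
    (hZ : (h : Matrix (Fin n) (Fin n) ℂ) * Z *
      ((h⁻¹ : GL (Fin n) ℂ) : Matrix (Fin n) (Fin n) ℂ) = 0) : Z = 0 := by
  have h3 := congrArg (fun Z => ((h⁻¹ : GL (Fin n) ℂ) : Matrix (Fin n) (Fin n) ℂ) * Z * h) hZ
  simp only [mul_zero, zero_mul] at h3
  rwa [← mul_assoc, ← mul_assoc, h.inv_mul, one_mul, mul_assoc, h.inv_mul, mul_one] at h3

lemma isSemisimpleMat_of_isDiag {X : Matrix (Fin n) (Fin n) ℂ} {h : GL (Fin n) ℂ}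
    (hX : ((h : Matrix (Fin n) (Fin n) ℂ) * X *
      ((h⁻¹ : GL (Fin n) ℂ) : Matrix (Fin n) (Fin n) ℂ)).IsDiag) : IsSemisimpleMat X := by
  classical
  set D := (h : Matrix (Fin n) (Fin n) ℂ) * X *
      ((h⁻¹ : GL (Fin n) ℂ) : Matrix (Fin n) (Fin n) ℂ) with hD
  refine ⟨∏ a ∈ Finset.univ.image D.diag, (Polynomial.X - Polynomial.C a),
    (Polynomial.separable_prod_X_sub_C_iff'.mpr fun x _ y _ h => h).squarefree, ?_⟩
  apply eq_zero_of_units_conj (h := h)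
  rw [← aeval_units_conj, ← hD, ← hX.diagonal_diag, aeval_diagonal, ← Matrix.diagonal_zero]
  congr 1
  funext j
  rw [Polynomial.eval_prod]
  refine Finset.prod_eq_zero (Finset.mem_image_of_mem _ (Finset.mem_univ j)) ?_
  simp

/-- `Y ↦ [X, Y]`. -/
def adMat (X : Matrix (Fin n) (Fin n) ℂ) : Module.End ℂ (Matrix (Fin n) (Fin n) ℂ) :=
  LinearMap.mulLeft ℂ X - LinearMap.mulRight ℂ X

@[simp] lemma adMat_apply (X Y : Matrix (Fin n) (Fin n) ℂ) : adMat X Y = X * Y - Y * X := rfl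

lemma adMat_add (X Y : Matrix (Fin n) (Fin n) ℂ) : adMat (X + Y) = adMat X + adMat Y := by
  ext1 Z
  simp only [adMat_apply, LinearMap.add_apply, add_mul, mul_add]
  abel

lemma adMat_commute {X Y : Matrix (Fin n) (Fin n) ℂ} (h : Commute X Y) :
    Commute (adMat X) (adMat Y) := by
  ext1 Z
  simp only [Module.End.mul_apply, adMat_apply]
  have h' : X * Y = Y * X := h
  have e1 : X * (Y * Z) = Y * (X * Z) := by rw [← mul_assoc, h', mul_assoc]
  have e2 : Z * Y * X = Z * X * Y := by rw [mul_assoc, ← h', mul_assoc]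
  simp only [mul_sub, sub_mul, e1, e2, mul_assoc]
  abel

/-- Left and right multiplication by `X` commute and satisfy the same squarefree polynomial as `X`;
over `ℂ` the difference of commuting semisimple maps is semisimple. -/
lemma IsSemisimpleMat.adMat {X : Matrix (Fin n) (Fin n) ℂ} (h : IsSemisimpleMat X) :
    (adMat X).IsSemisimple := by
  obtain ⟨p, hp, hX⟩ := h
  refine Module.End.IsSemisimple.sub_of_commute (LinearMap.commute_mulLeft_right X X) ?_ ?_
  · refine Module.End.isSemisimple_of_squarefree_aeval_eq_zero hp ?_
    have := Polynomial.aeval_algHom_apply (Algebra.lmul ℂ (Matrix (Fin n) (Fin n) ℂ)) X p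
    rw [hX, map_zero] at this
    exact this
  · refine Module.End.isSemisimple_of_squarefree_aeval_eq_zero hp ?_
    ext1 Z
    rw [Polynomial.aeval_eq_sum_range] at hX ⊢
    have := congrArg (fun W => Z * W) hX
    simpa [LinearMap.pow_mulRight, Finset.mul_sum, LinearMap.sum_apply] using this

lemma adMat_isNilpotent {X : Matrix (Fin n) (Fin n) ℂ} (h : IsNilpotent X) :
    IsNilpotent (adMat X) :=
  (LinearMap.commute_mulLeft_right X X).isNilpotent_sub
    ((LinearMap.isNilpotent_mulLeft_iff ℂ X).mpr h) ((LinearMap.isNilpotent_mulRight_iff ℂ X).mpr h)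

/-- For a semisimple map the kernel of the square is the kernel, and `ad X` is semisimple. -/
lemma IsSemisimpleMat.commute_of_commute_commutator {X : Matrix (Fin n) (Fin n) ℂ}
    (h : IsSemisimpleMat X) {Y : Matrix (Fin n) (Fin n) ℂ}
    (hY : Commute X (X * Y - Y * X)) : Commute X Y := by
  have h1 := h.adMat.isFinitelySemisimple.maxGenEigenspace_eq_eigenspace 0
  have h2 : Y ∈ (FormalType.adMat X).maxGenEigenspace 0 := by
    rw [Module.End.mem_maxGenEigenspace]
    refine ⟨2, ?_⟩
    rw [zero_smul, sub_zero, pow_two, Module.End.mul_apply, adMat_apply, adMat_apply]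
    exact sub_eq_zero.mpr hY
  rw [h1, Module.End.mem_eigenspace_iff, zero_smul, adMat_apply] at h2
  exact sub_eq_zero.mp h2

/-! ### Jordan decomposition and simultaneous diagonalisation. -/

/-- Jordan decomposition of matrices. -/
lemma exists_jordan (X : Matrix (Fin n) (Fin n) ℂ) :
    ∃ S N : Matrix (Fin n) (Fin n) ℂ, IsSemisimpleMat S ∧ IsNilpotent N ∧ X = S + N ∧
      ∀ Z, Commute Z X → Commute Z S ∧ Commute Z N := by
  obtain ⟨N, hN, S, hS, hNn, hSs, hX⟩ :=
    Module.End.exists_isNilpotent_isSemisimple (f := Matrix.toLinAlgEquiv' X)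
  let e := Matrix.toLinAlgEquiv' (R := ℂ) (n := Fin n)
  have hcomm : ∀ Z, Commute Z X → ∀ Y ∈ Algebra.adjoin ℂ {Matrix.toLinAlgEquiv' X},
      Commute Z (e.symm Y) := by
    intro Z hZ Y hY
    have hle : Algebra.adjoin ℂ {Matrix.toLinAlgEquiv' X} ≤ Subalgebra.centralizer ℂ {e Z} := by
      refine Algebra.adjoin_le ?_
      rintro _ rfl
      rw [SetLike.mem_coe, Subalgebra.mem_centralizer_iff]
      rintro _ rfl
      exact (hZ.map e).eq
    have := (Subalgebra.mem_centralizer_iff ℂ).mp (hle hY) (e Z) rfl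
    apply e.injective
    rw [map_mul, map_mul, AlgEquiv.apply_symm_apply]
    exact this
  refine ⟨e.symm S, e.symm N, ?_, hNn.map e.symm, ?_,
    fun Z hZ => ⟨hcomm Z hZ S hS, hcomm Z hZ N hN⟩⟩
  · rw [isSemisimpleMat_iff]
    have : Matrix.toLinAlgEquiv' (e.symm S) = S := e.apply_symm_apply S
    rwa [this]
  · rw [← map_add, add_comm, ← hX]
    exact (e.symm_apply_apply X).symm

/-- A subspace stable under `ad X` is stable under `ad S`, for `S` the semisimple part of `X`. -/
lemma commutator_semisimple_part_mem {V : Submodule ℂ (Matrix (Fin n) (Fin n) ℂ)}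
    {S N : Matrix (Fin n) (Fin n) ℂ} (hS : IsSemisimpleMat S) (hN : IsNilpotent N)
    (hSN : Commute S N) (hV : ∀ Y ∈ V, (S + N) * Y - Y * (S + N) ∈ V)
    {Y : Matrix (Fin n) (Fin n) ℂ} (hY : Y ∈ V) : S * Y - Y * S ∈ V := by
  obtain ⟨N', hN', S', hS', hN'n, hS's, hX⟩ :=
    Module.End.exists_isNilpotent_isSemisimple (f := adMat (S + N))
  have hcomm : ∀ f : Module.End ℂ (Matrix (Fin n) (Fin n) ℂ), Commute f (adMat (S + N)) →
      ∀ g ∈ Algebra.adjoin ℂ {adMat (S + N)}, Commute f g := by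
    intro f hf g hg
    have hle : Algebra.adjoin ℂ {adMat (S + N)} ≤ Subalgebra.centralizer ℂ {f} := by
      refine Algebra.adjoin_le ?_
      rintro _ rfl
      rw [SetLike.mem_coe, Subalgebra.mem_centralizer_iff]
      rintro _ rfl
      exact hf.eq
    exact (Subalgebra.mem_centralizer_iff ℂ).mp (hle hg) f rfl
  -- Two Jordan decompositions of `ad (S + N)` are compared: the difference is both semisimple and
  -- nilpotent. So `ad S` is a polynomial in `ad (S + N)` and preserves what the latter preserves.
  have h1 : adMat S - S' = N' - adMat N := by
    rw [sub_eq_sub_iff_add_eq_add, ← adMat_add, hX]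
  have h2 : (adMat S - S').IsSemisimple :=
    hS.adMat.sub_of_commute (hcomm _ (adMat_commute ((Commute.refl S).add_right hSN)) _ hS') hS's
  have h3 : IsNilpotent (adMat S - S') := by
    rw [h1]
    exact (hcomm _ (adMat_commute (hSN.symm.add_right (Commute.refl N))) _ hN').symm.isNilpotent_sub
      hN'n (adMat_isNilpotent hN)
  have h4 : adMat S = S' :=
    sub_eq_zero.mp (Module.End.eq_zero_of_isNilpotent_isSemisimple h3 h2)
  rw [← adMat_apply, h4]
  clear h1 h2 h3 h4 hS's hX
  induction hS' using Algebra.adjoin_induction generalizing Y with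
  | mem x hx =>
    rw [Set.mem_singleton_iff.mp hx]
    exact hV Y hY
  | algebraMap r => exact V.smul_mem r hY
  | add x y _ _ hx hy => exact V.add_mem (hx hY) (hy hY)
  | mul x y _ _ hx hy => exact hx (hy hY)

/-- Commuting semisimple matrices are simultaneously diagonalisable. -/
lemma exists_simultaneous_diag {ι : Type*} (f : ι → Matrix (Fin n) (Fin n) ℂ)
    (hc : ∀ i j, Commute (f i) (f j)) (hs : ∀ i, IsSemisimpleMat (f i)) :
    ∃ h : GL (Fin n) ℂ, ∀ i, ((h : Matrix (Fin n) (Fin n) ℂ) * f i *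
      ((h⁻¹ : GL (Fin n) ℂ) : Matrix (Fin n) (Fin n) ℂ)).IsDiag := by
  let F : ι → Module.End ℂ (Fin n → ℂ) := fun i => Matrix.toLinAlgEquiv' (f i)
  have hF : ⨆ χ : ι → ℂ, ⨅ i, (F i).maxGenEigenspace (χ i) = ⊤ :=
    Module.End.iSup_iInf_maxGenEigenspace_eq_top_of_forall_mapsTo F
      (fun i j φ => Module.End.mapsTo_maxGenEigenspace_of_comm ((hc j i).map _) φ)
      (fun i => Module.End.iSup_maxGenEigenspace_eq_top _)
  let s : Set (Fin n → ℂ) := {v | ∃ χ : ι → ℂ, ∀ i, F i v = χ i • v}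
  have hspan : ⊤ ≤ Submodule.span ℂ s := by
    rw [← hF]
    refine iSup_le fun χ v hv => Submodule.subset_span ⟨χ, fun i => ?_⟩
    have := (Submodule.mem_iInf _).mp hv i
    rw [(isSemisimpleMat_iff.mp (hs i)).isFinitelySemisimple.maxGenEigenspace_eq_eigenspace] at this
    exact Module.End.mem_eigenspace_iff.mp this
  let b₀ := Module.Basis.ofSpan hspan
  let c := Pi.basisFun ℂ (Fin n)
  have : Finite ((linearIndepOn_empty ℂ id).extend (Set.empty_subset s)) :=
    Module.Finite.finite_basis b₀
  let b := b₀.reindex (b₀.indexEquiv c)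
  have hb : ∀ j, b j ∈ s := fun j => by
    rw [Module.Basis.reindex_apply]
    exact Module.Basis.ofSpan_subset hspan ⟨_, rfl⟩
  choose χ hχ using hb
  refine ⟨⟨b.toMatrix c, c.toMatrix b, b.toMatrix_mul_toMatrix_flip c,
    c.toMatrix_mul_toMatrix_flip b⟩, fun i => ?_⟩
  have h1 : f i * c.toMatrix b = c.toMatrix b * Matrix.diagonal (fun j => χ j i) := by
    ext a j
    have := congrFun (hχ j i) a
    rw [Matrix.mul_diagonal]
    simpa [F, Matrix.mulVec, dotProduct, Matrix.mul_apply, c, Module.Basis.toMatrix_apply,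
      mul_comm] using this
  change (b.toMatrix c * f i * c.toMatrix b).IsDiag
  rw [mul_assoc, h1, ← mul_assoc, b.toMatrix_mul_toMatrix_flip c, one_mul]
  exact Matrix.isDiag_diagonal _

end Semisimple

/-! ### Maximal tori -/

section MaximalTorus

variable {n : ℕ}

lemma IsTorus.commute_of_commute_lieAlg {T : Subgroup (GL (Fin n) ℂ)} (hT : IsTorus T)
    {X : Matrix (Fin n) (Fin n) ℂ} (hX : ∀ H ∈ lieAlg T, Commute X H) {t : GL (Fin n) ℂ}
    (ht : t ∈ T) : Commute X (t : Matrix (Fin n) (Fin n) ℂ) := by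
  obtain ⟨Y, hY, htY⟩ := hT.exists_exp ht
  rw [htY]
  exact (hX Y hY).exp_right

lemma IsTorus.commute {T : Subgroup (GL (Fin n) ℂ)} (hT : IsTorus T)
    {X Y : Matrix (Fin n) (Fin n) ℂ} (hX : X ∈ lieAlg T) (hY : Y ∈ lieAlg T) : Commute X Y := by
  obtain ⟨h, hd⟩ := hT.diagonalizable
  have h1 := isDiag_of_mem_lieAlg hd hX
  have h2 := isDiag_of_mem_lieAlg hd hY
  have h3 : Commute ((h : Matrix (Fin n) (Fin n) ℂ) * X *
      ((h⁻¹ : GL (Fin n) ℂ) : Matrix (Fin n) (Fin n) ℂ)) ((h : Matrix (Fin n) (Fin n) ℂ) * Y *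
      ((h⁻¹ : GL (Fin n) ℂ) : Matrix (Fin n) (Fin n) ℂ)) := by
    rw [← h1.diagonal_diag, ← h2.diagonal_diag]
    exact Matrix.commute_diagonal _ _
  have h4 := h3.eq
  rw [units_conj_mul, units_conj_mul] at h4
  exact h.isUnit.mul_left_cancel (h⁻¹.isUnit.mul_right_cancel h4)

lemma IsTorus.isSemisimpleMat {T : Subgroup (GL (Fin n) ℂ)} (hT : IsTorus T)
    {X : Matrix (Fin n) (Fin n) ℂ} (hX : X ∈ lieAlg T) : IsSemisimpleMat X := by
  obtain ⟨h, hd⟩ := hT.diagonalizable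
  exact isSemisimpleMat_of_isDiag (isDiag_of_mem_lieAlg hd hX)

/-- The group generated by `T` and the one-parameter group of a matrix commuting with `T`. -/
def extendByOneParam (T : Subgroup (GL (Fin n) ℂ)) (X : Matrix (Fin n) (Fin n) ℂ)
    (hX : ∀ t ∈ T, ∀ s, Commute (oneParam X s) t) : Subgroup (GL (Fin n) ℂ) where
  carrier := {g | ∃ t ∈ T, ∃ s, g = t * oneParam X s}
  one_mem' := ⟨1, T.one_mem, 0, by simp⟩
  mul_mem' := by
    rintro _ _ ⟨t, ht, s, rfl⟩ ⟨t', ht', s', rfl⟩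
    refine ⟨t * t', T.mul_mem ht ht', s + s', ?_⟩
    rw [oneParam_add, mul_assoc, ← mul_assoc (oneParam X s), (hX t' ht' s).eq]
    simp only [mul_assoc]
  inv_mem' := by
    rintro _ ⟨t, ht, s, rfl⟩
    refine ⟨t⁻¹, T.inv_mem ht, -s, ?_⟩
    rw [mul_inv_rev, oneParam_neg, ((hX t ht s).inv_inv).eq]

/-- A semisimple element of `𝔤` commuting with the Lie algebra of a maximal torus lies in it. -/
lemma IsMaximalTorus.mem_lieAlg {G T : Subgroup (GL (Fin n) ℂ)} (hG : IsAlgebraic G)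
    (hT : IsMaximalTorus G T) {X : Matrix (Fin n) (Fin n) ℂ} (hXG : X ∈ lieAlg G)
    (hXs : IsSemisimpleMat X) (hX : ∀ H ∈ lieAlg T, Commute X H) : X ∈ lieAlg T := by
  have hXT : ∀ t ∈ T, Commute X (t : Matrix (Fin n) (Fin n) ℂ) := fun t ht =>
    hT.torus.commute_of_commute_lieAlg hX ht
  have hXc : ∀ t ∈ T, ∀ s, Commute (oneParam X s) t := by
    intro t ht s
    apply Units.ext
    rw [Units.val_mul, Units.val_mul, coe_oneParam]
    exact ((hXT t ht).symm.smul_right s).exp_right.symm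
  -- The group `T · exp(ℂ X)` is connected and simultaneously diagonalisable inside `G`, so its
  -- closure is a torus of `G` containing `T`. By maximality `exp(ℂ X)` was in `T` already.
  set H := extendByOneParam T X hXc with hH
  have hconn : IsConnected (H : Set (GL (Fin n) ℂ)) := by
    have h1 : (H : Set (GL (Fin n) ℂ)) = (fun p : GL (Fin n) ℂ × ℂ => p.1 * oneParam X p.2) ''
        ((T : Set (GL (Fin n) ℂ)) ×ˢ Set.univ) := by
      ext g
      constructor
      · rintro ⟨t, ht, s, rfl⟩
        exact ⟨(t, s), ⟨ht, trivial⟩, rfl⟩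
      · rintro ⟨⟨t, s⟩, ⟨ht, -⟩, rfl⟩
        exact ⟨t, ht, s, rfl⟩
    rw [h1]
    refine (hT.torus.connected.prod isConnected_univ).image _ (Continuous.continuousOn ?_)
    exact continuous_fst.mul ((continuous_oneParam X).comp continuous_snd)
  obtain ⟨h₀, hd₀⟩ := hT.torus.diagonalizable
  have hTs : ∀ t ∈ T, IsSemisimpleMat (t : Matrix (Fin n) (Fin n) ℂ) := fun t ht => by
    have := hd₀ t ht
    rw [Units.val_mul, Units.val_mul] at this
    exact isSemisimpleMat_of_isDiag this
  obtain ⟨h, hd⟩ := exists_simultaneous_diag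
    (fun o : Option T => o.elim X fun t => ((t : GL (Fin n) ℂ) : Matrix (Fin n) (Fin n) ℂ))
    (by
      rintro (_ | t) (_ | t')
      · exact Commute.refl X
      · exact hXT t' t'.2
      · exact (hXT t t.2).symm
      · obtain ⟨Y, hY, htY⟩ := hT.torus.exists_exp t'.2
        have : Commute Y ((t : GL (Fin n) ℂ) : Matrix (Fin n) (Fin n) ℂ) :=
          hT.torus.commute_of_commute_lieAlg (fun Z hZ => hT.torus.commute hY hZ) t.2
        simp only [Option.elim_some]
        rw [htY]
        exact this.symm.exp_right)
    (by
      rintro (_ | t)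
      · exact hXs
      · exact hTs t t.2)
  have hdH : ∀ g ∈ H, ((h * g * h⁻¹ : GL (Fin n) ℂ) : Matrix (Fin n) (Fin n) ℂ).IsDiag := by
    rintro _ ⟨t, ht, s, rfl⟩
    have h1 := hd (some ⟨t, ht⟩)
    have h2 := hd none
    simp only [Option.elim_some, Option.elim_none] at h1 h2
    have h3 : h * (t * oneParam X s) * h⁻¹ = (h * t * h⁻¹) * (h * oneParam X s * h⁻¹) := by group
    have h4 : ((h * oneParam X s * h⁻¹ : GL (Fin n) ℂ) : Matrix (Fin n) (Fin n) ℂ).IsDiag := by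
      rw [Units.val_mul, Units.val_mul, coe_oneParam, ← Matrix.exp_units_conj, Matrix.mul_smul,
        Matrix.smul_mul, ← h2.diagonal_diag, ← Matrix.diagonal_smul, Matrix.exp_diagonal]
      exact Matrix.isDiag_diagonal _
    rw [h3, Units.val_mul, ← h4.diagonal_diag]
    rw [Units.val_mul, Units.val_mul, ← h1.diagonal_diag, Matrix.diagonal_mul_diagonal]
    exact Matrix.isDiag_diagonal _
  obtain ⟨T', hT', hle, hmin, -⟩ := exists_torus_closure hconn hdH
  have hHG : H ≤ G := by
    rintro _ ⟨t, ht, s, rfl⟩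
    exact G.mul_mem (hT.le ht) (exp_mem_of_mem_lieAlg hG hXG rfl)
  have hTT' : T' = T := hT.maximal T' (hmin G hG hHG) hT' fun t ht =>
    hle ⟨t, ht, 0, by simp⟩
  refine realLieAlg_subset_lieAlg T fun s => ⟨oneParam X s, ?_, rfl⟩
  rw [← hTT']
  exact hle ⟨1, T.one_mem, s, by simp⟩

end MaximalTorus

/-! ### Compact forms -/

section Compact

variable {n : ℕ}

/-- The adjoint with respect to the Hermitian form given by `S`. -/
def dag (S : GL (Fin n) ℂ) (X : Matrix (Fin n) (Fin n) ℂ) : Matrix (Fin n) (Fin n) ℂ :=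
  ((S⁻¹ : GL (Fin n) ℂ) : Matrix (Fin n) (Fin n) ℂ) * Matrix.conjTranspose
    ((S : Matrix (Fin n) (Fin n) ℂ) * X * ((S⁻¹ : GL (Fin n) ℂ) : Matrix (Fin n) (Fin n) ℂ)) * S

lemma conj_dag (S : GL (Fin n) ℂ) (X : Matrix (Fin n) (Fin n) ℂ) :
    (S : Matrix (Fin n) (Fin n) ℂ) * dag S X * ((S⁻¹ : GL (Fin n) ℂ) : Matrix (Fin n) (Fin n) ℂ) =
      Matrix.conjTranspose ((S : Matrix (Fin n) (Fin n) ℂ) * X *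
        ((S⁻¹ : GL (Fin n) ℂ) : Matrix (Fin n) (Fin n) ℂ)) := by
  rw [dag, mul_assoc, mul_assoc, S.mul_inv, mul_one, ← mul_assoc, S.mul_inv, one_mul]

lemma dag_dag (S : GL (Fin n) ℂ) (X : Matrix (Fin n) (Fin n) ℂ) : dag S (dag S X) = X := by
  rw [dag, conj_dag, Matrix.conjTranspose_conjTranspose, ← mul_assoc, ← mul_assoc,
    S.inv_mul, one_mul, mul_assoc, S.inv_mul, mul_one]

lemma dag_add (S : GL (Fin n) ℂ) (X Y : Matrix (Fin n) (Fin n) ℂ) :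
    dag S (X + Y) = dag S X + dag S Y := by
  simp only [dag, mul_add, add_mul, Matrix.conjTranspose_add]

lemma dag_smul (S : GL (Fin n) ℂ) (c : ℂ) (X : Matrix (Fin n) (Fin n) ℂ) :
    dag S (c • X) = star c • dag S X := by
  simp only [dag, Matrix.mul_smul, Matrix.smul_mul, Matrix.conjTranspose_smul]

lemma dag_mul (S : GL (Fin n) ℂ) (X Y : Matrix (Fin n) (Fin n) ℂ) :
    dag S (X * Y) = dag S Y * dag S X := by
  rw [dag, ← units_conj_mul, Matrix.conjTranspose_mul, dag, dag]
  simp only [mul_assoc]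
  rw [← mul_assoc (S : Matrix (Fin n) (Fin n) ℂ) ((S⁻¹ : GL (Fin n) ℂ) : Matrix (Fin n) (Fin n) ℂ),
    S.mul_inv, one_mul]

lemma trace_dag (S : GL (Fin n) ℂ) (X : Matrix (Fin n) (Fin n) ℂ) :
    (dag S X).trace = star X.trace := by
  rw [dag, Matrix.trace_mul_cycle, S.mul_inv, one_mul, Matrix.trace_conjTranspose,
    Matrix.trace_mul_cycle, S.inv_mul, one_mul]

open scoped ComplexOrder in
lemma eq_zero_of_trace_mul_dag {S : GL (Fin n) ℂ} {X : Matrix (Fin n) (Fin n) ℂ}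
    (h : (X * dag S X).trace = 0) : X = 0 := by
  have h1 : (((S : Matrix (Fin n) (Fin n) ℂ) * X *
      ((S⁻¹ : GL (Fin n) ℂ) : Matrix (Fin n) (Fin n) ℂ))
      * Matrix.conjTranspose ((S : Matrix (Fin n) (Fin n) ℂ) * X *
        ((S⁻¹ : GL (Fin n) ℂ) : Matrix (Fin n) (Fin n) ℂ))).trace = 0 := by
    rw [← h, dag, mul_assoc, mul_assoc, Matrix.trace_mul_comm]
    simp only [mul_assoc]
  rw [Matrix.trace_mul_conjTranspose_self_eq_zero_iff] at h1
  exact eq_zero_of_units_conj h1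

open scoped ComplexOrder MatrixOrder in
/-- A compact group of matrices preserves a Hermitian form. -/
lemma exists_invariant_form {K : Subgroup (GL (Fin n) ℂ)}
    (hK : IsCompact (K : Set (GL (Fin n) ℂ))) :
    ∃ S : GL (Fin n) ℂ, ∀ g ∈ K, Matrix.conjTranspose (g : Matrix (Fin n) (Fin n) ℂ) *
      (Matrix.conjTranspose (S : Matrix (Fin n) (Fin n) ℂ) * S) * g =
      Matrix.conjTranspose (S : Matrix (Fin n) (Fin n) ℂ) * S := by
  have : CompactSpace K := isCompact_iff_compactSpace.mp hK
  let _ : MeasurableSpace K := borel K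
  have : BorelSpace K := ⟨rfl⟩
  let μ : MeasureTheory.Measure K := MeasureTheory.Measure.haar
  -- The inverse turns right multiplication by `g` into the left translation by `g⁻¹` on `K`, under
  -- which Haar measure is invariant.
  let M : K → Matrix (Fin n) (Fin n) ℂ := fun k => ((k⁻¹ : K) : GL (Fin n) ℂ)
  let N : K → Matrix (Fin n) (Fin n) ℂ := fun k => Matrix.conjTranspose (M k) * M k
  have hM : Continuous M :=
    Units.continuous_val.comp (continuous_subtype_val.comp continuous_inv)
  have hN : Continuous N := hM.matrix_conjTranspose.matrix_mul hM
  have hint : ∀ i j, MeasureTheory.Integrable (fun k => N k i j) μ := fun i j =>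
    (hN.matrix_elem i j).integrable_of_hasCompactSupport (HasCompactSupport.of_compactSpace _)
  let P : Matrix (Fin n) (Fin n) ℂ := fun i j => ∫ k, N k i j ∂μ
  have hlin : ∀ c : Fin n → Fin n → ℂ, ∑ i, ∑ j, c i j * P i j =
      ∫ k, ∑ i, ∑ j, c i j * N k i j ∂μ := by
    intro c
    rw [MeasureTheory.integral_finsetSum _ fun i _ =>
      MeasureTheory.integrable_finsetSum _ fun j _ => (hint i j).const_mul _]
    refine Finset.sum_congr rfl fun i _ => ?_
    rw [MeasureTheory.integral_finsetSum _ fun j _ => (hint i j).const_mul _]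
    exact Finset.sum_congr rfl fun j _ => (MeasureTheory.integral_const_mul _ _).symm
  have hherm : P.IsHermitian := by
    ext i j
    rw [Matrix.conjTranspose_apply]
    change (starRingEnd ℂ) (∫ k, N k j i ∂μ) = ∫ k, N k i j ∂μ
    rw [← integral_conj]
    refine MeasureTheory.integral_congr_ae (Filter.Eventually.of_forall fun k => ?_)
    have := (Matrix.isHermitian_conjTranspose_mul_self (M k)).apply i j
    exact this
  have hquad : ∀ (A : Matrix (Fin n) (Fin n) ℂ) (v : Fin n → ℂ),
      star v ⬝ᵥ (A.mulVec v) = ∑ i, ∑ j, (star (v i) * v j) * A i j := by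
    intro A v
    simp only [dotProduct, Matrix.mulVec, Finset.mul_sum, Pi.star_apply]
    exact Finset.sum_congr rfl fun i _ => Finset.sum_congr rfl fun j _ => by ring
  have hpos : P.PosDef := by
    refine Matrix.PosDef.of_dotProduct_mulVec_pos hherm fun v hv => ?_
    let q : K → ℝ := fun k => ∑ i, Complex.normSq ((M k).mulVec v i)
    have hq : ∀ k, ∑ i, ∑ j, (star (v i) * v j) * N k i j = (q k : ℂ) := by
      intro k
      rw [← hquad, ← Matrix.mulVec_mulVec, Matrix.dotProduct_mulVec, Matrix.vecMul_conjTranspose,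
        star_star]
      simp only [dotProduct, q, Complex.ofReal_sum, Pi.star_apply, Complex.normSq_eq_conj_mul_self]
      rfl
    rw [hquad, hlin]
    simp only [hq]
    rw [integral_complex_ofReal]
    have hqc : Continuous q := by
      refine continuous_finsetSum _ fun i _ => Complex.continuous_normSq.comp ?_
      exact (continuous_apply i).comp (hM.matrix_mulVec continuous_const)
    have hq0 : ∀ k, 0 ≤ q k := fun k => Finset.sum_nonneg fun i _ => Complex.normSq_nonneg _
    have hq1 : q 1 ≠ 0 := by
      intro h
      apply hv
      have h' := (Finset.sum_eq_zero_iff_of_nonneg fun i _ => Complex.normSq_nonneg _).mp h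
      funext i
      have := Complex.normSq_eq_zero.mp (h' i (Finset.mem_univ i))
      simpa [M] using this
    exact Complex.zero_lt_real.mpr (hqc.integral_pos_of_hasCompactSupport_nonneg_nonzero
      (HasCompactSupport.of_compactSpace _) hq0 hq1)
  have hinv : ∀ g ∈ K, Matrix.conjTranspose (g : Matrix (Fin n) (Fin n) ℂ) * P * g = P := by
    intro g hg
    have hexp : ∀ (A : Matrix (Fin n) (Fin n) ℂ) (i j : Fin n),
        (Matrix.conjTranspose (g : Matrix (Fin n) (Fin n) ℂ) * A * g) i j =
        ∑ a, ∑ b, (star ((g : Matrix (Fin n) (Fin n) ℂ) a i) *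
          (g : Matrix (Fin n) (Fin n) ℂ) b j) * A a b := by
      intro A i j
      simp only [Matrix.mul_apply, Matrix.conjTranspose_apply, Finset.sum_mul]
      rw [Finset.sum_comm]
      exact Finset.sum_congr rfl fun a _ => Finset.sum_congr rfl fun b _ => by ring
    ext i j
    rw [hexp, hlin]
    simp only [← hexp]
    have h1 : ∀ k : K, (Matrix.conjTranspose (g : Matrix (Fin n) (Fin n) ℂ) * N k * g) =
        N ((⟨g, hg⟩ : K)⁻¹ * k) := by
      intro k
      have h2 : M ((⟨g, hg⟩ : K)⁻¹ * k) = M k * g := by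
        simp only [M]
        rw [mul_inv_rev, inv_inv, Subgroup.coe_mul, Units.val_mul]
      simp only [N]
      rw [h2, Matrix.conjTranspose_mul]
      simp only [mul_assoc]
    simp only [h1]
    exact MeasureTheory.integral_mul_left_eq_self (fun k => N k i j) _
  obtain ⟨B, hB⟩ := CStarAlgebra.nonneg_iff_eq_star_mul_self.mp hpos.posSemidef.nonneg
  have hBu : IsUnit B := by
    have h1 := hpos.isUnit
    rw [hB, Matrix.isUnit_iff_isUnit_det, Matrix.det_mul] at h1
    exact (Matrix.isUnit_iff_isUnit_det _).mpr (isUnit_of_mul_isUnit_right h1)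
  refine ⟨hBu.unit, fun g hg => ?_⟩
  have h1 := hinv g hg
  rw [hB] at h1
  exact h1

/-- The Lie algebra of a group with a compact form is closed under an adjoint. -/
lemma IsConnectedReductive.exists_dag {G : Subgroup (GL (Fin n) ℂ)} (hG : IsConnectedReductive G) :
    ∃ S : GL (Fin n) ℂ, ∀ X ∈ lieAlg G, dag S X ∈ lieAlg G := by
  obtain ⟨K, hKG, hK, hform⟩ := hG.compactForm
  obtain ⟨S, hS⟩ := exists_invariant_form hK
  -- Conjugation by `S` makes `K` unitary, so its one-parameter groups have skew-Hermitian
  -- generators.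
  have hskew : ∀ Y ∈ realLieAlg K, dag S Y = -Y := by
    intro Y hY
    set Z := (S : Matrix (Fin n) (Fin n) ℂ) * Y *
      ((S⁻¹ : GL (Fin n) ℂ) : Matrix (Fin n) (Fin n) ℂ) with hZ
    have hexp : ∀ t : ℝ, NormedSpace.exp ((t : ℂ) • Matrix.conjTranspose Z) =
        NormedSpace.exp ((t : ℂ) • (-Z)) := by
      intro t
      obtain ⟨g, hg, hgY⟩ := hY t
      have h1 : NormedSpace.exp ((t : ℂ) • Z) = (S : Matrix (Fin n) (Fin n) ℂ) * g *
          ((S⁻¹ : GL (Fin n) ℂ) : Matrix (Fin n) (Fin n) ℂ) := by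
        rw [hgY, ← Matrix.exp_units_conj, hZ, Matrix.mul_smul, Matrix.smul_mul]
      have h2 : Matrix.conjTranspose (NormedSpace.exp ((t : ℂ) • Z)) *
          NormedSpace.exp ((t : ℂ) • Z) = 1 := by
        have h3 := hS g hg
        rw [h1, Matrix.conjTranspose_mul, Matrix.conjTranspose_mul]
        calc _ = Matrix.conjTranspose ((S⁻¹ : GL (Fin n) ℂ) : Matrix (Fin n) (Fin n) ℂ) *
              (Matrix.conjTranspose (g : Matrix (Fin n) (Fin n) ℂ) *
              (Matrix.conjTranspose (S : Matrix (Fin n) (Fin n) ℂ) * S) * g) *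
              ((S⁻¹ : GL (Fin n) ℂ) : Matrix (Fin n) (Fin n) ℂ) := by simp only [mul_assoc]
          _ = 1 := by
            rw [h3, mul_assoc, mul_assoc, S.mul_inv, mul_one, ← Matrix.conjTranspose_mul,
              S.mul_inv, Matrix.conjTranspose_one]
      have h4 : NormedSpace.exp ((t : ℂ) • Matrix.conjTranspose Z) =
          Matrix.conjTranspose (NormedSpace.exp ((t : ℂ) • Z)) := by
        rw [← Matrix.exp_conjTranspose, Matrix.conjTranspose_smul]
        congr 2
        exact (Complex.conj_ofReal t).symm
      have h5 : NormedSpace.exp ((t : ℂ) • Z) * NormedSpace.exp ((t : ℂ) • (-Z)) = 1 := by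
        have := (oneParam Z (t : ℂ)).val_inv
        rw [smul_neg, ← neg_smul]
        exact this
      rw [h4]
      exact left_inv_eq_right_inv h2 h5
    have hZs : Matrix.conjTranspose Z = -Z := by
      ext i j
      have h1 := (hasDerivAt_exp_entry (Matrix.conjTranspose Z) ((0 : ℝ) : ℂ) i j).comp_ofReal
      have h2 := (hasDerivAt_exp_entry (-Z) ((0 : ℝ) : ℂ) i j).comp_ofReal
      simp only [hexp] at h1
      have h3 := h1.unique h2
      simpa [NormedSpace.exp_zero] using h3
    rw [dag, ← hZ, hZs, hZ, mul_neg, neg_mul, ← mul_assoc, ← mul_assoc, S.inv_mul, one_mul,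
      mul_assoc, S.inv_mul, mul_one]
  refine ⟨S, fun X hX => ?_⟩
  obtain ⟨Y, hY, Z, hZ, rfl⟩ := hform X hX
  have hY' := realLieAlg_subset_lieAlg G (realLieAlg_mono hKG hY)
  have hZ' := realLieAlg_subset_lieAlg G (realLieAlg_mono hKG hZ)
  rw [dag_add, dag_smul, hskew Y hY, hskew Z hZ]
  exact (lieAlg G).add_mem ((lieAlg G).neg_mem hY') ((lieAlg G).smul_mem _ ((lieAlg G).neg_mem hZ'))

/-- The trace of the product of a nilpotent matrix with a matrix commuting with it. -/
lemma trace_mul_eq_zero_of_commute {N Z : Matrix (Fin n) (Fin n) ℂ} (hN : IsNilpotent N)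
    (h : Commute N Z) : (N * Z).trace = 0 :=
  (Matrix.isNilpotent_trace_of_isNilpotent (h.isNilpotent_mul_right hN)).eq_zero

/-- A Lie algebra of matrices closed under an adjoint contains the semisimple parts of its
elements. -/
lemma semisimple_part_mem {𝔤 : Submodule ℂ (Matrix (Fin n) (Fin n) ℂ)} {S : GL (Fin n) ℂ}
    (hbr : ∀ X ∈ 𝔤, ∀ Y ∈ 𝔤, X * Y - Y * X ∈ 𝔤) (hdag : ∀ X ∈ 𝔤, dag S X ∈ 𝔤)
    {s N : Matrix (Fin n) (Fin n) ℂ} (hs : IsSemisimpleMat s) (hN : IsNilpotent N)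
    (hX : s + N ∈ 𝔤) (hcomm : ∀ Z, Commute Z (s + N) → Commute Z s ∧ Commute Z N) : s ∈ 𝔤 := by
  have hsN : Commute s N := ((hcomm s (by
    have := (hcomm (s + N) (Commute.refl _)).1
    exact this.symm)).2)
  let B : LinearMap.BilinForm ℂ (Matrix (Fin n) (Fin n) ℂ) :=
    LinearMap.mk₂ ℂ (fun X Y => (X * Y).trace)
      (fun _ _ _ => by rw [add_mul, Matrix.trace_add])
      (fun _ _ _ => by rw [Matrix.smul_mul, Matrix.trace_smul])
      (fun _ _ _ => by rw [mul_add, Matrix.trace_add])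
      (fun _ _ _ => by rw [Matrix.mul_smul, Matrix.trace_smul])
  have hB : ∀ X Y, B X Y = (X * Y).trace := fun _ _ => rfl
  have hrefl : B.IsRefl := fun X Y h => by rw [hB, Matrix.trace_mul_comm]; exact h
  -- The trace form pairs `X` with `X†` positively, so `s` splits as `P + Q` with `P ∈ 𝔤` and `Q`
  -- orthogonal to `𝔤`.
  have hnd : (B.restrict 𝔤).Nondegenerate := by
    refine (LinearMap.IsRefl.nondegenerate_iff_separatingLeft ?_).mpr ?_
    · intro X Y h
      exact hrefl _ _ h
    · intro X h
      have := h ⟨dag S X, hdag X X.2⟩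
      exact Subtype.ext (eq_zero_of_trace_mul_dag this)
  have hcompl := LinearMap.BilinForm.isCompl_orthogonal_of_restrict_nondegenerate hrefl hnd
  obtain ⟨P, hP, Q, hQ, hPQ⟩ : ∃ P ∈ 𝔤, ∃ Q ∈ B.orthogonal 𝔤, P + Q = s :=
    Submodule.mem_sup.mp (hcompl.sup_eq_top ▸ Submodule.mem_top)
  have hQ' : ∀ Y ∈ 𝔤, (Y * Q).trace = 0 := fun Y hY => hQ Y hY
  -- The bracket `[Q, Y]` lies in `𝔤`, since `ad s` preserves `𝔤`, and by invariance of the trace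
  -- form it is orthogonal to `𝔤`.
  have hQc : ∀ Y ∈ 𝔤, Q * Y - Y * Q = 0 := by
    intro Y hY
    have h1 : s * Y - Y * s ∈ 𝔤 :=
      commutator_semisimple_part_mem hs hN hsN (fun Z hZ => hbr _ hX _ hZ) hY
    have h2 : Q * Y - Y * Q ∈ 𝔤 := by
      have : Q * Y - Y * Q = (s * Y - Y * s) - (P * Y - Y * P) := by
        rw [← hPQ]; noncomm_ring
      rw [this]
      exact 𝔤.sub_mem h1 (hbr _ hP _ hY)
    have h3 := hdag _ h2
    apply eq_zero_of_trace_mul_dag (S := S)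
    set W := dag S (Q * Y - Y * Q)
    have h4 : ((Q * Y - Y * Q) * W).trace = ((Y * W - W * Y) * Q).trace := by
      rw [sub_mul, sub_mul, Matrix.trace_sub, Matrix.trace_sub]
      congr 1
      · rw [mul_assoc, Matrix.trace_mul_comm]
      · rw [mul_assoc, Matrix.trace_mul_comm, mul_assoc, Matrix.trace_mul_comm,
          mul_assoc, Matrix.trace_mul_comm]
    rw [h4]
    exact hQ' _ (hbr _ hY _ h3)
  have hQdX : Commute (dag S Q) (s + N) := by
    have h1 := congrArg (dag S) (sub_eq_zero.mp (hQc _ (hdag _ hX)))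
    rw [dag_mul, dag_mul, dag_dag] at h1
    exact h1.symm
  -- The adjoint `Q†` commutes with `N` and is orthogonal to `𝔤`. Since `N = (s + N - P) - Q` with
  -- the bracket in `𝔤`, this gives `Tr(Q Q†) = 0`.
  have h1 : (N * dag S Q).trace = 0 := trace_mul_eq_zero_of_commute hN (hcomm _ hQdX).2.symm
  have h2 : ∀ Y ∈ 𝔤, (Y * dag S Q).trace = 0 := by
    intro Y hY
    have h3 : Y * dag S Q = dag S (Q * dag S Y) := by rw [dag_mul, dag_dag]
    rw [h3, trace_dag, Matrix.trace_mul_comm, hQ' _ (hdag _ hY), star_zero]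
  have h3 : N = (s + N - P) - Q := by rw [← hPQ]; abel
  rw [h3, sub_mul, Matrix.trace_sub, h2 _ (𝔤.sub_mem hX hP), zero_sub, neg_eq_zero] at h1
  have hQ0 := eq_zero_of_trace_mul_dag h1
  rw [← hPQ, hQ0, add_zero]
  exact hP

/-- A diagonalisable matrix `H` with `Tr(H p(H)) = 0` for all polynomials `p` vanishes. -/
lemma eq_zero_of_trace_mul_aeval {H : Matrix (Fin n) (Fin n) ℂ} {h : GL (Fin n) ℂ}
    (hd : ((h : Matrix (Fin n) (Fin n) ℂ) * H *
      ((h⁻¹ : GL (Fin n) ℂ) : Matrix (Fin n) (Fin n) ℂ)).IsDiag)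
    (htr : ∀ p : Polynomial ℂ, (H * Polynomial.aeval H p).trace = 0) : H = 0 := by
  classical
  set D := (h : Matrix (Fin n) (Fin n) ℂ) * H *
      ((h⁻¹ : GL (Fin n) ℂ) : Matrix (Fin n) (Fin n) ℂ) with hD
  -- Interpolating complex conjugation on the eigenvalues turns `Tr(H p(H))` into the sum of `|λ|²`.
  let p : Polynomial ℂ := Lagrange.interpolate (Finset.univ.image D.diag) id star
  have hp : ∀ i, p.eval (D.diag i) = star (D.diag i) := fun i =>
    Lagrange.eval_interpolate_at_node (v := id) star Function.injective_id.injOn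
      (Finset.mem_image_of_mem _ (Finset.mem_univ i))
  have h1 : (D * Polynomial.aeval D p).trace = 0 := by
    rw [hD, aeval_units_conj, units_conj_mul, Matrix.trace_units_conj]
    exact htr p
  have h2 : Polynomial.aeval D p = Matrix.diagonal fun i => star (D.diag i) := by
    have := aeval_diagonal D.diag p
    rw [hd.diagonal_diag] at this
    rw [this]
    congr 1
    funext i
    exact hp i
  have h3 : ∑ i, Complex.normSq (D.diag i) = 0 := by
    rw [h2, ← hd.diagonal_diag, Matrix.diagonal_mul_diagonal, Matrix.trace_diagonal] at h1
    have h4 : ((∑ i, Complex.normSq (D.diag i) : ℝ) : ℂ) = 0 := by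
      rw [← h1, Complex.ofReal_sum]
      refine Finset.sum_congr rfl fun i _ => ?_
      rw [Matrix.diag_diagonal]
      exact (Complex.mul_conj _).symm
    exact_mod_cast h4
  have h5 : D = 0 := by
    rw [← hd.diagonal_diag, ← Matrix.diagonal_zero]
    congr 1
    funext i
    exact Complex.normSq_eq_zero.mp ((Finset.sum_eq_zero_iff_of_nonneg
      fun i _ => Complex.normSq_nonneg _).mp h3 i (Finset.mem_univ i))
  exact eq_zero_of_units_conj h5

end Compact

/-! ### The centraliser of a maximal torus -/

section Centraliser

variable {n : ℕ} {G T : Subgroup (GL (Fin n) ℂ)}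

/-- If `ad A₀` is semisimple and preserves `V` then `V` is the sum of its kernel and image. -/
lemma exists_commutator_decomposition {V : Submodule ℂ (Matrix (Fin n) (Fin n) ℂ)}
    {A₀ : Matrix (Fin n) (Fin n) ℂ} (hs : IsSemisimpleMat A₀)
    (hV : ∀ Y ∈ V, A₀ * Y - Y * A₀ ∈ V) {X : Matrix (Fin n) (Fin n) ℂ} (hX : X ∈ V) :
    ∃ Y ∈ V, Commute A₀ (X + (A₀ * Y - Y * A₀)) := by
  let f : V →ₗ[ℂ] V := (adMat A₀).restrict hV
  have hf : ∀ Y : V, (f Y : Matrix (Fin n) (Fin n) ℂ) = A₀ * Y - Y * A₀ := fun Y => rfl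
  -- Semisimplicity makes kernel and image disjoint, and rank-nullity then makes them span.
  have hdisj : Disjoint (LinearMap.range f) (LinearMap.ker f) := by
    rw [Submodule.disjoint_def]
    rintro _ ⟨Y, rfl⟩ h
    have h1 : A₀ * (f Y : Matrix (Fin n) (Fin n) ℂ) - (f Y : Matrix (Fin n) (Fin n) ℂ) * A₀ = 0 :=
      congrArg Subtype.val h
    have h2 := hs.commute_of_commute_commutator (Y := (Y : Matrix (Fin n) (Fin n) ℂ))
      (sub_eq_zero.mp h1)
    apply Subtype.ext
    rw [hf]
    exact sub_eq_zero.mpr h2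
  have htop := Submodule.eq_top_of_disjoint _ _
    (LinearMap.finrank_range_add_finrank_ker f).ge hdisj
  obtain ⟨_, ⟨Y, rfl⟩, Z, hZ, hYZ⟩ : ∃ y ∈ LinearMap.range f, ∃ z ∈ LinearMap.ker f,
      y + z = ⟨X, hX⟩ := Submodule.mem_sup.mp (htop ▸ Submodule.mem_top)
  refine ⟨-Y, V.neg_mem Y.2, ?_⟩
  have h1 : X + (A₀ * -(Y : Matrix (Fin n) (Fin n) ℂ) -
      -(Y : Matrix (Fin n) (Fin n) ℂ) * A₀) = Z := by
    have := congrArg Subtype.val hYZ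
    simp only [Submodule.coe_add, hf] at this
    rw [← this]
    noncomm_ring
  rw [h1]
  exact sub_eq_zero.mp (congrArg Subtype.val hZ)

/-- A subspace stable under the commutators with a commuting family of semisimple matrices is
spanned by joint eigenvectors. -/
lemma le_of_joint_eigenvectors_mem {V 𝔱 W : Submodule ℂ (Matrix (Fin n) (Fin n) ℂ)}
    (hcomm : ∀ X ∈ 𝔱, ∀ Y ∈ 𝔱, Commute X Y) (hss : ∀ X ∈ 𝔱, IsSemisimpleMat X)
    (hstab : ∀ H : 𝔱, V ∈ (adMat (H : Matrix (Fin n) (Fin n) ℂ)).invtSubmodule)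
    (hW : ∀ Y ∈ V, ∀ χ : 𝔱 → ℂ, (∀ H : 𝔱, (H : Matrix (Fin n) (Fin n) ℂ) * Y - Y * H = χ H • Y) →
      Y ∈ W) : V ≤ W := by
  let F : 𝔱 → Module.End ℂ V := fun H =>
    (adMat (H : Matrix (Fin n) (Fin n) ℂ)).restrict (hstab H)
  have hF : ∀ (H : 𝔱) (Y : V), (F H Y : Matrix (Fin n) (Fin n) ℂ) =
      adMat (H : Matrix (Fin n) (Fin n) ℂ) Y := fun H Y => rfl
  have hFc : ∀ H H', Commute (F H) (F H') := by
    intro H H'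
    refine LinearMap.ext fun Y => Subtype.ext ?_
    have h := LinearMap.congr_fun (adMat_commute (hcomm H H.2 H' H'.2)).eq
      (Y : Matrix (Fin n) (Fin n) ℂ)
    rw [Module.End.mul_apply, Module.End.mul_apply] at h ⊢
    rw [hF, hF, hF, hF]
    exact h
  have htop : ⨆ χ : 𝔱 → ℂ, ⨅ H, (F H).maxGenEigenspace (χ H) = ⊤ :=
    Module.End.iSup_iInf_maxGenEigenspace_eq_top_of_forall_mapsTo F
      (fun i j φ => Module.End.mapsTo_maxGenEigenspace_of_comm (hFc j i) φ)
      (fun i => Module.End.iSup_maxGenEigenspace_eq_top _)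
  have hle : ⊤ ≤ W.comap V.subtype := by
    rw [← htop]
    refine iSup_le fun χ Y hY => hW Y Y.2 χ fun H => ?_
    have h1 := (Submodule.mem_iInf _).mp hY H
    have h2 : (F H).IsSemisimple := (hss H H.2).adMat.restrict (hstab H)
    rw [h2.isFinitelySemisimple.maxGenEigenspace_eq_eigenspace,
      Module.End.mem_eigenspace_iff] at h1
    exact congrArg Subtype.val h1
  exact fun X hX => hle (Submodule.mem_top : (⟨X, hX⟩ : V) ∈ ⊤)

/-- An element of `𝔤` commuting with a regular element of `𝔱` commutes with `𝔱`. -/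
lemma IsRegular.commute (hT : IsMaximalTorus G T) {A₀ : lieAlg T} (hreg : IsRegular G T A₀)
    {X : Matrix (Fin n) (Fin n) ℂ} (hX : X ∈ lieAlg G) (hXA : Commute (A₀ : Matrix _ _ ℂ) X)
    {H : Matrix (Fin n) (Fin n) ℂ} (hH : H ∈ lieAlg T) : Commute X H := by
  have hle : lieAlg G ⊓ LinearMap.ker (adMat (A₀ : Matrix (Fin n) (Fin n) ℂ)) ≤
      LinearMap.ker (adMat H) := by
    refine le_of_joint_eigenvectors_mem (𝔱 := lieAlg T) (fun X hX Y hY => hT.torus.commute hX hY)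
      (fun X hX => hT.torus.isSemisimpleMat hX) ?_ ?_
    · rintro H Y ⟨hY, hYA⟩
      refine ⟨lieAlg_commutator (lieAlg_mono hT.le H.2) hY, ?_⟩
      rw [SetLike.mem_coe, LinearMap.mem_ker] at hYA ⊢
      have := adMat_commute (hT.torus.commute A₀.2 H.2)
      rw [← Module.End.mul_apply, this.eq, Module.End.mul_apply, hYA, map_zero]
    · rintro Y ⟨hY, hYA⟩ χ hYe
      by_cases hY0 : Y = 0
      · rw [hY0]
        exact Submodule.zero_mem _
      have hinj := smul_left_injective ℂ hY0
      -- The eigenvalue function of a nonzero joint eigenvector is linear. Were it nonzero it would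
      -- be a root, yet it vanishes at `A₀`.
      let α : Module.Dual ℂ (lieAlg T) :=
        { toFun := χ
          map_add' := fun H H' => hinj <| by
            simp only [add_smul, ← hYe, Submodule.coe_add]
            noncomm_ring
          map_smul' := fun c H => hinj <| by
            simp only [RingHom.id_apply, smul_eq_mul, mul_smul, ← hYe, Submodule.coe_smul,
              Matrix.smul_mul, Matrix.mul_smul, smul_sub] }
      have hα0 : α = 0 := by
        by_contra hne
        refine hreg α ⟨hne, Y, hY, hY0, hYe⟩ ?_
        rw [SetLike.mem_coe, LinearMap.mem_ker, adMat_apply, hYe A₀] at hYA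
        exact (smul_eq_zero.mp hYA).resolve_right hY0
      have h3 : χ ⟨H, hH⟩ = 0 := LinearMap.congr_fun hα0 ⟨H, hH⟩
      rw [LinearMap.mem_ker, adMat_apply]
      refine (hYe ⟨H, hH⟩).trans ?_
      rw [h3, zero_smul]
  have h : X ∈ LinearMap.ker (adMat H) := hle ⟨hX, sub_eq_zero.mpr hXA⟩
  rw [LinearMap.mem_ker, adMat_apply] at h
  exact (sub_eq_zero.mp h).symm

/-- The Lie algebra of a maximal torus of a reductive group is its own centraliser. -/
lemma mem_lieAlg_torus_of_commute (hG : IsConnectedReductive G) (hT : IsMaximalTorus G T)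
    {A₀ : lieAlg T} (hreg : IsRegular G T A₀) {X : Matrix (Fin n) (Fin n) ℂ} (hX : X ∈ lieAlg G)
    (hXA : Commute (A₀ : Matrix _ _ ℂ) X) : X ∈ lieAlg T := by
  obtain ⟨S, hS⟩ := hG.exists_dag
  obtain ⟨h, hd⟩ := hT.torus.diagonalizable
  have hle := lieAlg_mono hT.le
  have hjordan : ∀ Y ∈ lieAlg G, (∀ H ∈ lieAlg T, Commute Y H) →
      ∃ H ∈ lieAlg T, ∃ N, IsNilpotent N ∧ Y = H + N := by
    intro Y hY hYT
    obtain ⟨s, N, hs, hN, rfl, hcomm⟩ := exists_jordan Y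
    have hsG := semisimple_part_mem (fun X hX Y hY => lieAlg_commutator hX hY) hS hs hN hY hcomm
    exact ⟨s, hT.mem_lieAlg hG.algebraic hsG hs fun H hH => ((hcomm H (hYT H hH).symm).1).symm,
      N, hN, rfl⟩
  have htrN : ∀ N H : Matrix (Fin n) (Fin n) ℂ, IsNilpotent N → Commute N H →
      ∀ p : Polynomial ℂ, (N * Polynomial.aeval H p).trace = 0 := fun N H hN hNH p =>
    trace_mul_eq_zero_of_commute hN (by
      induction p using Polynomial.induction_on' with
      | add p q hp hq => rw [map_add]; exact hp.add_right hq
      | monomial m a =>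
        rw [Polynomial.aeval_monomial, ← Algebra.smul_def]
        exact (hNH.pow_right m).smul_right a)
  -- The toral part `H` of `N + N'` satisfies `Tr(H p(H)) = 0` for every `p`, because `p(H)` times a
  -- nilpotent commuting with `H` is traceless.
  have hadd : ∀ N ∈ lieAlg G, ∀ N' ∈ lieAlg G, IsNilpotent N → IsNilpotent N' →
      (∀ H ∈ lieAlg T, Commute N H) → (∀ H ∈ lieAlg T, Commute N' H) → IsNilpotent (N + N') := by
    intro N hN N' hN' hnil hnil' hc hc'
    obtain ⟨H, hH, M, hM, hsum⟩ := hjordan (N + N') ((lieAlg G).add_mem hN hN')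
      fun H hH => (hc H hH).add_left (hc' H hH)
    have hM' : M = N + N' - H := by rw [hsum]; abel
    have hMH : Commute M H := by
      rw [hM']
      exact ((hc H hH).add_left (hc' H hH)).sub_left (Commute.refl H)
    have hH0 : H = 0 := by
      refine eq_zero_of_trace_mul_aeval (isDiag_of_mem_lieAlg hd hH) fun p => ?_
      have h1 : H = N + N' - M := by rw [hsum]; abel
      have h2 : H * Polynomial.aeval H p = N * Polynomial.aeval H p + N' * Polynomial.aeval H p -
          M * Polynomial.aeval H p := by
        rw [← add_mul, ← sub_mul, ← h1]
      rw [h2, Matrix.trace_sub, Matrix.trace_add, htrN N H hnil (hc H hH),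
        htrN N' H hnil' (hc' H hH), htrN M H hM hMH, add_zero, sub_zero]
    rw [hsum, hH0, zero_add]
    exact hM
  have hsq : ∀ N : Matrix (Fin n) (Fin n) ℂ, IsNilpotent N → (N * N).trace = 0 := fun N hN =>
    trace_mul_eq_zero_of_commute hN (Commute.refl N)
  -- Write `N† = H + N' - [A₀, Y]` with `H ∈ 𝔱` and `N'` nilpotent centralising `𝔱`. Each summand is
  -- trace-orthogonal to `N`: the second by polarising `Tr((N + N')²) = 0`, the third because `N`
  -- commutes with `A₀`. Hence `Tr(N N†) = 0`.
  have hzero : ∀ N ∈ lieAlg G, IsNilpotent N → (∀ H ∈ lieAlg T, Commute N H) → N = 0 := by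
    intro N hN hnil hc
    apply eq_zero_of_trace_mul_dag (S := S)
    obtain ⟨Y, hY, hYc⟩ := exists_commutator_decomposition (hT.torus.isSemisimpleMat A₀.2)
      (fun Y hY => lieAlg_commutator (hle A₀.2) hY) (hS N hN)
    have hY₀ := (lieAlg G).add_mem (hS N hN) (lieAlg_commutator (hle A₀.2) hY)
    have hY₀T : ∀ H ∈ lieAlg T, Commute _ H := fun H hH => hreg.commute hT hY₀ hYc hH
    obtain ⟨H, hH, N', hN', hsum⟩ := hjordan _ hY₀ hY₀T
    have hN'eq : N' = dag S N + ((A₀ : Matrix (Fin n) (Fin n) ℂ) * Y - Y * A₀) - H := by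
      rw [hsum]; abel
    have hN'G : N' ∈ lieAlg G := by
      rw [hN'eq]; exact (lieAlg G).sub_mem hY₀ (hle hH)
    have hN'T : ∀ H' ∈ lieAlg T, Commute N' H' := fun H' hH' => by
      rw [hN'eq]; exact (hY₀T H' hH').sub_left (hT.torus.commute hH hH')
    have h1 : (N * H).trace = 0 := trace_mul_eq_zero_of_commute hnil (hc H hH)
    have h2 : (N * N').trace = 0 := by
      have h3 := hsq _ (hadd N hN N' hN'G hnil hN' hc hN'T)
      rw [add_mul, mul_add, mul_add, Matrix.trace_add, Matrix.trace_add, Matrix.trace_add,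
        hsq N hnil, hsq N' hN', Matrix.trace_mul_comm N' N, zero_add, add_zero, ← two_mul] at h3
      exact (mul_eq_zero.mp h3).resolve_left two_ne_zero
    have h4 : (N * ((A₀ : Matrix (Fin n) (Fin n) ℂ) * Y - Y * A₀)).trace = 0 := by
      rw [mul_sub, Matrix.trace_sub, ← mul_assoc, ← mul_assoc, Matrix.trace_mul_comm (N * Y),
        ← mul_assoc, (hc _ A₀.2).eq, sub_self]
    have h5 : dag S N = H + N' - ((A₀ : Matrix (Fin n) (Fin n) ℂ) * Y - Y * A₀) := by
      rw [← hsum]; abel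
    rw [h5, mul_sub, mul_add, Matrix.trace_sub, Matrix.trace_add, h1, h2, h4, add_zero, sub_zero]
  have hXT : ∀ H ∈ lieAlg T, Commute X H := fun H hH => hreg.commute hT hX hXA hH
  obtain ⟨H, hH, N, hN, rfl⟩ := hjordan X hX hXT
  have hN0 : N = 0 := by
    refine hzero N ?_ hN fun H' hH' => ?_
    · have := (lieAlg G).sub_mem hX (hle hH)
      rwa [add_sub_cancel_left] at this
    · have := (hXT H' hH').sub_left (hT.torus.commute hH hH')
      rwa [add_sub_cancel_left] at this
  rw [hN0, add_zero]
  exact hH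

end Centraliser

/-! ### Pull-backs along sections -/

section Pull

variable {E : Type*} [NormedAddCommGroup E] [NormedSpace ℂ E]
  {P : Type*} [TopologicalSpace P] [ChartedSpace E P]

/-- The chain rule, phrased in the model space `E` so that velocities at propositionally equal
points can be compared. -/
lemma mfderiv_curve_comp {V : Type*} [NormedAddCommGroup V] [NormedSpace ℂ V] {Φ : V → P}
    {γ : ℂ → V} {f : ℂ → P} {t : ℂ} {u v : V} (hv : γ t = v)
    (hΦ : MDifferentiableAt 𝓘(ℂ, V) 𝓘(ℂ, E) Φ v) (hγ : HasDerivAt γ u t)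
    (hf : f =ᶠ[𝓝 t] fun w => Φ (γ w)) :
    (show E from mfderiv 𝓘(ℂ, ℂ) 𝓘(ℂ, E) f t (1 : ℂ))
      = (show V →L[ℂ] E from mfderiv 𝓘(ℂ, V) 𝓘(ℂ, E) Φ v) u := by
  subst hv
  have h1 := hγ.differentiableAt.mdifferentiableAt
  have h2 : (show ℂ →L[ℂ] E from mfderiv 𝓘(ℂ, ℂ) 𝓘(ℂ, E) f t) =
      (show ℂ →L[ℂ] E from mfderiv 𝓘(ℂ, ℂ) 𝓘(ℂ, E) (Φ ∘ γ) t) := hf.mfderiv_eq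
  have h3 : (show ℂ →L[ℂ] E from mfderiv 𝓘(ℂ, ℂ) 𝓘(ℂ, E) (Φ ∘ γ) t) =
      (show V →L[ℂ] E from mfderiv 𝓘(ℂ, V) 𝓘(ℂ, E) Φ (γ t)).comp
        (show ℂ →L[ℂ] V from mfderiv 𝓘(ℂ, ℂ) 𝓘(ℂ, V) γ t) := mfderiv_comp t hΦ h1
  have h4 : (show ℂ →L[ℂ] V from mfderiv 𝓘(ℂ, ℂ) 𝓘(ℂ, V) γ t) (1 : ℂ) = u := by
    rw [mfderiv_eq_fderiv]
    exact (congrArg (fun L : ℂ →L[ℂ] V => L 1) hγ.hasFDerivAt.fderiv).trans (by simp)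
  calc _ = (show ℂ →L[ℂ] E from mfderiv 𝓘(ℂ, ℂ) 𝓘(ℂ, E) f t) (1 : ℂ) := rfl
    _ = _ := by rw [h2, h3, ContinuousLinearMap.comp_apply, h4]

variable [IsManifold 𝓘(ℂ, E) ω P]

lemma contMDiffAt_velocity {s : ℂ → P} {z : ℂ}
    (hs : ∀ᶠ w in 𝓝 z, ContMDiffAt 𝓘(ℂ, ℂ) 𝓘(ℂ, E) ω s w) :
    ContMDiffAt 𝓘(ℂ, ℂ) 𝓘(ℂ, E).tangent ω
      (fun w => (Bundle.TotalSpace.mk' E (s w) (mfderiv 𝓘(ℂ, ℂ) 𝓘(ℂ, E) s w (1 : ℂ)) :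
        TangentBundle 𝓘(ℂ, E) P)) z := by
  obtain ⟨U, hU, hUo, hzU⟩ := eventually_nhds_iff.1 hs
  have h1 : ContMDiffOn 𝓘(ℂ, ℂ) 𝓘(ℂ, E) ω s U := fun w hw => (hU w hw).contMDiffWithinAt
  have h2 := h1.contMDiffOn_tangentMapWithin (m := ω) (by simp) hUo.uniqueMDiffOn
  have h3 : ContMDiff 𝓘(ℂ, ℂ) 𝓘(ℂ, ℂ).tangent ω
      (fun w : ℂ => (Bundle.TotalSpace.mk' ℂ w (1 : ℂ) : TangentBundle 𝓘(ℂ, ℂ) ℂ)) := by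
    intro w
    refine (Bundle.contMDiffAt_section (F := ℂ) (E := TangentSpace 𝓘(ℂ, ℂ)) (n := ω)
      (IB := 𝓘(ℂ, ℂ)) (s := fun _ : ℂ => (1 : ℂ)) w).2 ?_
    refine (contMDiffAt_const (c := (1 : ℂ))).congr_of_eventuallyEq (.of_forall fun x => ?_)
    simp
  have h4 : ContMDiffOn 𝓘(ℂ, ℂ) 𝓘(ℂ, E).tangent ω _ U :=
    h2.comp (h3.contMDiffOn (s := U)) (fun w hw => hw)
  refine (h4.contMDiffAt (hUo.mem_nhds hzU)).congr_of_eventuallyEq ?_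
  filter_upwards [hUo.mem_nhds hzU] with w hw
  simp [tangentMapWithin, mfderivWithin_of_isOpen hUo hw]

lemma analyticAt_pullback {B : ∀ p : P, TangentSpace 𝓘(ℂ, E) p →L[ℂ] ℂ}
    (hB : IsHolomorphicOneForm B) {s : ℂ → P} {z : ℂ}
    (hs : ∀ᶠ w in 𝓝 z, ContMDiffAt 𝓘(ℂ, ℂ) 𝓘(ℂ, E) ω s w) :
    AnalyticAt ℂ (fun w => B (s w) (mfderiv 𝓘(ℂ, ℂ) 𝓘(ℂ, E) s w (1 : ℂ))) z := by
  have h1 := contMDiffAt_velocity hs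
  have h2 := (hB (s z)).comp z hs.self_of_nhds
  have h3 := ContMDiffAt.clm_bundle_apply (F₁ := E) (F₂ := ℂ)
    (E₁ := fun p : P => TangentSpace 𝓘(ℂ, E) p) (E₂ := Bundle.Trivial P ℂ)
    (b := s) (ϕ := fun w => B (s w)) (v := fun w => mfderiv 𝓘(ℂ, ℂ) 𝓘(ℂ, E) s w (1 : ℂ)) h2 h1
  have h4 := (Bundle.contMDiffAt_totalSpace.1 h3).2
  simp at h4
  exact h4.contDiffAt.analyticAt

end Pull

/-! ### Change of section -/

section Transition

variable {n : ℕ} {G : Subgroup (GL (Fin n) ℂ)}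

lemma analyticAt_matrix_det {F : Type*} [NormedAddCommGroup F] [NormedSpace ℂ F]
    {M : F → Matrix (Fin n) (Fin n) ℂ} {z : F} (h : ∀ i j, AnalyticAt ℂ (fun w => M w i j) z) :
    AnalyticAt ℂ (fun w => (M w).det) z := by
  simp only [Matrix.det_apply']
  refine Finset.analyticAt_fun_sum _ fun σ _ => ?_
  exact analyticAt_const.mul (Finset.analyticAt_fun_prod _ fun i _ => h _ _)

lemma analyticAt_matrix_mul {F : Type*} [NormedAddCommGroup F] [NormedSpace ℂ F]
    {M N : F → Matrix (Fin n) (Fin n) ℂ} {z : F}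
    (hM : ∀ i j, AnalyticAt ℂ (fun w => M w i j) z)
    (hN : ∀ i j, AnalyticAt ℂ (fun w => N w i j) z) (i j : Fin n) :
    AnalyticAt ℂ (fun w => (M w * N w) i j) z := by
  simp only [Matrix.mul_apply]
  exact Finset.analyticAt_fun_sum _ fun l _ => (hM i l).mul (hN l j)

@[simp] lemma toMat_mul (g h : G) : toMat (g * h) = toMat g * toMat h := rfl

@[simp] lemma toMat_one : toMat (1 : G) = 1 := rfl

lemma toMat_inv_mul (g : G) : toMat g⁻¹ * toMat g = 1 := by rw [← toMat_mul]; simp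

lemma toMat_mul_inv (g : G) : toMat g * toMat g⁻¹ = 1 := by rw [← toMat_mul]; simp

lemma analyticAt_toMat_inv {F : Type*} [NormedAddCommGroup F] [NormedSpace ℂ F] {g : F → G} {z : F}
    (h : ∀ i j, AnalyticAt ℂ (fun w => toMat (g w) i j) z) (i j : Fin n) :
    AnalyticAt ℂ (fun w => toMat (g w)⁻¹ i j) z := by
  have hinv : ∀ w, toMat (g w)⁻¹ = (toMat (g w))⁻¹ :=
    fun w => (Matrix.inv_eq_left_inv (toMat_inv_mul (g w))).symm
  have hdet : (toMat (g z)).det ≠ 0 := fun h0 => by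
    have := congrArg Matrix.det (toMat_inv_mul (g z))
    simp [h0] at this
  simp only [hinv, Matrix.inv_def, Ring.inverse_eq_inv', Matrix.smul_apply, smul_eq_mul,
    Matrix.adjugate_apply]
  refine ((analyticAt_matrix_det h).inv hdet).mul (analyticAt_matrix_det fun a c => ?_)
  by_cases ha : a = j
  · subst ha; simpa using analyticAt_const
  · simpa [Matrix.updateRow_ne ha] using h a c

variable {E : Type*} [NormedAddCommGroup E] [NormedSpace ℂ E]
  {P : Type*} [TopologicalSpace P] [ChartedSpace E P]
  {b : PrincipalBundle G E P}

lemma PrincipalBundle.act_injective (b : PrincipalBundle G E P) {p : P} {g h : G}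
    (e : b.act p g = b.act p h) : g = h :=
  (b.fibre p (b.act p h) (b.π_act p h).symm).unique e rfl

lemma PrincipalBundle.exists_transition (b : PrincipalBundle G E P) (s s' : ℂ → P) :
    ∃ g : ℂ → G, ∀ w, b.π (s w) = b.π (s' w) → b.act (s w) (g w) = s' w := by
  have key : ∀ w, ∃ g : G, b.π (s w) = b.π (s' w) → b.act (s w) g = s' w := fun w => by
    by_cases h : b.π (s w) = b.π (s' w)
    · obtain ⟨g, hg, -⟩ := b.fibre _ _ h
      exact ⟨g, fun _ => hg⟩
    · exact ⟨1, fun h' => absurd h' h⟩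
  exact ⟨fun w => (key w).choose, fun w => (key w).choose_spec⟩

lemma IsSectionNear.mem_base {s : ℂ → P} {z : ℂ} (hs : IsSectionNear b s z) : z ∈ b.base := by
  rw [← b.range_π]
  exact ⟨s z, (hs.self_of_nhds).2⟩

lemma IsSectionNear.analyticAt_comp {s : ℂ → P} {z : ℂ} (hs : IsSectionNear b s z) {U : Set ℂ}
    (hU : IsOpen U) (hz : z ∈ U) {f : P → ℂ}
    (hf : ContMDiffOn 𝓘(ℂ, E) 𝓘(ℂ, ℂ) ω f (b.π ⁻¹' U)) :
    AnalyticAt ℂ (fun w => f (s w)) z := by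
  have h1 : b.π ⁻¹' U ∈ 𝓝 (s z) :=
    (hU.preimage b.holomorphic_π.continuous).mem_nhds (by
      rw [Set.mem_preimage, hs.self_of_nhds.2]; exact hz)
  exact ((hf.contMDiffAt h1).comp z hs.self_of_nhds.1).contDiffAt.analyticAt

/-- In a local trivialisation with fibre coordinate `h`, the transition map is `h(s)⁻¹ h(s')`. -/
lemma analyticAt_transition {s s' : ℂ → P} {z : ℂ} (hs : IsSectionNear b s z)
    (hs' : IsSectionNear b s' z) {g : ℂ → G} (hg : ∀ᶠ w in 𝓝 z, b.act (s w) (g w) = s' w)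
    (i j : Fin n) : AnalyticAt ℂ (fun w => toMat (g w) i j) z := by
  obtain ⟨U, hU, hz, -, σ, -, -, h, hh, hhol⟩ := b.locally_trivial z hs.mem_base
  have h1 : ∀ i j, AnalyticAt ℂ (fun w => toMat (h (s w)) i j) z :=
    fun i j => hs.analyticAt_comp hU hz (hhol i j)
  have h2 : ∀ i j, AnalyticAt ℂ (fun w => toMat (h (s' w)) i j) z :=
    fun i j => hs'.analyticAt_comp hU hz (hhol i j)
  refine (analyticAt_matrix_mul (analyticAt_toMat_inv h1) h2 i j).congr ?_
  filter_upwards [hU.mem_nhds hz, hs, hs', hg] with w hw e1 e2 e3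
  have e4 := hh (s w) (by rw [e1.2]; exact hw)
  have e5 := hh (s' w) (by rw [e2.2]; exact hw)
  rw [e1.2] at e4
  rw [e2.2] at e5
  have : h (s w) * g w = h (s' w) := by
    apply b.act_injective (p := σ w)
    rw [b.act_mul, e4, e3, e5]
  rw [← this, ← toMat_mul]
  simp

lemma exists_transition_near {s s' : ℂ → P} (hs : IsSectionNear b s 0)
    (hs' : IsSectionNear b s' 0) (h0 : s 0 = s' 0) :
    ∃ g : ℂ → G, g 0 = 1 ∧ (∀ᶠ w in 𝓝 0, b.act (s w) (g w) = s' w) ∧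
      ∀ z, IsSectionNear b s z → IsSectionNear b s' z →
        ∀ i j, AnalyticAt ℂ (fun w => toMat (g w) i j) z := by
  obtain ⟨g, hg⟩ := b.exists_transition s s'
  have key : ∀ z, IsSectionNear b s z → IsSectionNear b s' z →
      ∀ᶠ w in 𝓝 z, b.act (s w) (g w) = s' w := fun z hs hs' => by
    filter_upwards [hs, hs'] with w h h'
    exact hg w (h.2.trans h'.2.symm)
  refine ⟨g, b.act_injective (p := s 0) ?_, key 0 hs hs',
    fun z hs hs' => analyticAt_transition hs hs' (key z hs hs')⟩
  rw [b.act_one, hg 0 (by rw [h0])]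
  exact h0.symm

variable [IsManifold 𝓘(ℂ, E) ω P] {k : ℕ}

/-- The gauge transformation law of the pull-back of a connection under a change of section. -/
lemma MeromorphicConnection.pull_transition (A : MeromorphicConnection b k) {s s' : ℂ → P} {z : ℂ}
    (hz : z ≠ 0) (hs : IsSectionNear b s z) (hs' : IsSectionNear b s' z) {g : ℂ → G}
    (hg : ∀ᶠ w in 𝓝 z, b.act (s w) (g w) = s' w) :
    A.pull s' z = toMat (g z)⁻¹ * A.pull s z * toMat (g z)
      - toMat (g z)⁻¹ * Matrix.of fun i j => deriv (fun w => toMat (g w) i j) z := by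
  have hga := analyticAt_transition hs hs' hg
  obtain ⟨U, hU, hzU, -, σ, -, hΦ, h, hh, hhol⟩ := b.locally_trivial z hs.mem_base
  have hha : ∀ i j, AnalyticAt ℂ (fun w => toMat (h (s w)) i j) z :=
    fun i j => hs.analyticAt_comp hU hzU (hhol i j)
  have ev : ∀ᶠ w in 𝓝 z, w ∈ U ∧ b.act (σ w) (h (s w)) = s w ∧
      (∀ i j, AnalyticAt ℂ (fun w => toMat (h (s w)) i j) w) ∧
      (∀ i j, AnalyticAt ℂ (fun w => toMat (g w) i j) w) ∧ b.act (s w) (g w) = s' w := by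
    filter_upwards [hU.mem_nhds hzU, hs, hg,
      Filter.eventually_all.2 fun i => Filter.eventually_all.2 fun j =>
        (hha i j).eventually_analyticAt,
      Filter.eventually_all.2 fun i => Filter.eventually_all.2 fun j =>
        (hga i j).eventually_analyticAt]
      with w hw e1 e2 e3 e4
    refine ⟨hw, ?_, e3, e4, e2⟩
    have := hh (s w) (by rw [e1.2]; exact hw)
    rwa [e1.2] at this
  obtain ⟨V, hV, hVo, hzV⟩ := eventually_nhds_iff.1 ev
  set W : Set (Fin 2 → ℂ) := {v | v 0 ∈ V ∧ v 1 ∈ V} with hW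
  have hWo : IsOpen W :=
    (hVo.preimage (continuous_apply 0)).inter (hVo.preimage (continuous_apply 1))
  have hpr : ∀ (l : Fin 2) (v : Fin 2 → ℂ), AnalyticAt ℂ (fun v : Fin 2 → ℂ => v l) v := fun l v =>
    (ContinuousLinearMap.proj (R := ℂ) (φ := fun _ : Fin 2 => ℂ) l).analyticAt v
  -- This is `s(u) · g(v)` in two independent variables, written through the local trivialisation
  -- because that is where joint holomorphy is given. The section `s'` is its diagonal, so its
  -- velocity is the sum of the two partial ones, governed by equivariance and by the vertical
  -- normalisation.
  set Φ : (Fin 2 → ℂ) → P := fun v => b.act (σ (v 0)) (h (s (v 0)) * g (v 1)) with hΦdef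
  have hΦW : ContMDiffOn 𝓘(ℂ, Fin 2 → ℂ) 𝓘(ℂ, E) ω Φ W := by
    refine hΦ 2 W (fun v => v 0) (fun v => h (s (v 0)) * g (v 1)) hWo (fun v _ => hpr 0 v)
      (fun v hv => (hV _ hv.1).1) fun i j v hv => ?_
    simp only [toMat_mul]
    refine analyticAt_matrix_mul (fun i j => ?_) (fun i j => ?_) i j
    · exact AnalyticAt.comp (f := fun v : Fin 2 → ℂ => v 0) (x := v)
        ((hV _ hv.1).2.2.1 i j) (hpr 0 v)
    · exact AnalyticAt.comp (f := fun v : Fin 2 → ℂ => v 1) (x := v)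
        ((hV _ hv.2).2.2.2.1 i j) (hpr 1 v)
  have hΦeq : ∀ v : Fin 2 → ℂ, v 0 ∈ V → Φ v = b.act (s (v 0)) (g (v 1)) := fun v hv => by
    simp only [hΦdef, b.act_mul, (hV _ hv).2.1]
  set v₀ : Fin 2 → ℂ := ![z, z] with hv₀
  have hΦd : MDifferentiableAt 𝓘(ℂ, Fin 2 → ℂ) 𝓘(ℂ, E) Φ v₀ :=
    (hΦW.contMDiffAt (hWo.mem_nhds ⟨hzV, hzV⟩)).mdifferentiableAt (by simp)
  have hnV := hVo.mem_nhds hzV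
  have hγ : ∀ {p q : ℂ → ℂ} {p' q' t : ℂ}, HasDerivAt p p' t → HasDerivAt q q' t →
      HasDerivAt (fun w => ![p w, q w]) ![p', q'] t := fun {p q p' q' t} hp hq => by
    rw [hasDerivAt_pi]
    intro l
    fin_cases l
    · simpa using hp
    · simpa using hq
  set c : ℂ → G := fun t => (g z)⁻¹ * g (z + t) with hc
  have hc0 : c 0 = 1 := by simp [hc]
  have hsz : b.act (s z) (g z) = s' z := (hV z hzV).2.2.2.2
  have hπ : b.π (s z) ≠ 0 := by rw [hs.self_of_nhds.2]; exact hz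
  have hπ' : b.π (s' z) ≠ 0 := by rw [hs'.self_of_nhds.2]; exact hz
  have hgs : ∀ i j, AnalyticAt ℂ (fun t => toMat (g (z + t)) i j) 0 := fun i j =>
    AnalyticAt.comp (f := fun t : ℂ => z + t) (g := fun w => toMat (g w) i j) (x := 0)
      (by simpa using hga i j) (analyticAt_const.add analyticAt_id)
  have d1 := mfderiv_curve_comp (f := s') (γ := fun w => ![w, w]) (t := z) rfl hΦd
    (hγ (hasDerivAt_id z) (hasDerivAt_id z)) (by
      filter_upwards [hnV] with w hw
      rw [hΦeq _ hw]; exact (hV w hw).2.2.2.2.symm)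
  have d2 := mfderiv_curve_comp (f := fun w => b.act (s w) (g z)) (γ := fun w => ![w, z]) (t := z)
    rfl hΦd (hγ (hasDerivAt_id z) (hasDerivAt_const z z)) (by
      filter_upwards [hnV] with w hw
      rw [hΦeq _ hw]; rfl)
  have d3 := mfderiv_curve_comp (f := fun t => b.act (s' z) (c t)) (γ := fun t => ![z, z + t])
    (t := 0) (by simp [hv₀]) hΦd
    (hγ (hasDerivAt_const 0 z) ((hasDerivAt_id (0 : ℂ)).const_add z)) (.of_forall fun t => by
      change b.act (s' z) (c t) = Φ ![z, z + t]
      rw [hΦeq _ hzV, ← hsz, ← b.act_mul]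
      simp [hc])
  have d4 : (show E from mfderiv 𝓘(ℂ, ℂ) 𝓘(ℂ, E) (fun w => b.act (s w) (g z)) z (1 : ℂ)) =
      (show E →L[ℂ] E from mfderiv 𝓘(ℂ, E) 𝓘(ℂ, E) (fun q => b.act q (g z)) (s z))
        (show E from mfderiv 𝓘(ℂ, ℂ) 𝓘(ℂ, E) s z (1 : ℂ)) :=
    congrArg (fun L : ℂ →L[ℂ] E => L 1) (mfderiv_comp z
      ((b.holomorphic_act (g z) (s z)).mdifferentiableAt (by simp))
      (hs.self_of_nhds.1.mdifferentiableAt (by simp)))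
  have d5 : (![1, 1] : Fin 2 → ℂ) = ![1, 0] + ![0, 1] := by simp
  let θ : P → E →ₗ[ℂ] Matrix (Fin n) (Fin n) ℂ := fun p => A.form p
  have f1 : θ (s' z) (show E from mfderiv 𝓘(ℂ, ℂ) 𝓘(ℂ, E) (fun w => b.act (s w) (g z)) z (1 : ℂ))
      = toMat (g z)⁻¹ * θ (s z) (show E from mfderiv 𝓘(ℂ, ℂ) 𝓘(ℂ, E) s z (1 : ℂ))
        * toMat (g z) := by
    rw [d4, ← hsz]
    exact A.equivariant (g z) (s z) hπ _
  have f2 : θ (s' z) (show E from mfderiv 𝓘(ℂ, ℂ) 𝓘(ℂ, E) (fun t => b.act (s' z) (c t)) 0 (1 : ℂ))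
      = toMat (g z)⁻¹ * Matrix.of fun i j => deriv (fun w => toMat (g w) i j) z := by
    ext i j
    have hv := A.vertical (s' z) hπ' c hc0 (analyticAt_matrix_mul (fun _ _ => analyticAt_const) hgs)
      i j
    have e : b.act (s' z) (c 0) = s' z := by rw [hc0, b.act_one]
    have hv' : θ (b.act (s' z) (c 0))
      (show E from mfderiv 𝓘(ℂ, ℂ) 𝓘(ℂ, E) (fun t => b.act (s' z) (c t)) 0 (1 : ℂ)) i j = _ := hv
    rw [e] at hv'
    refine hv'.trans ?_
    simp only [hc, toMat_mul, Matrix.mul_apply, Matrix.of_apply]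
    rw [deriv_fun_sum fun l _ => ((hgs l j).differentiableAt.const_mul _)]
    refine Finset.sum_congr rfl fun l _ => ?_
    rw [deriv_const_mul _ (hgs l j).differentiableAt,
      deriv_comp_const_add (fun w => toMat (g w) l j) z 0, add_zero]
  have f3 : θ (s' z) (show E from mfderiv 𝓘(ℂ, ℂ) 𝓘(ℂ, E) s' z (1 : ℂ)) =
      toMat (g z)⁻¹ * θ (s z) (show E from mfderiv 𝓘(ℂ, ℂ) 𝓘(ℂ, E) s z (1 : ℂ)) * toMat (g z) +
      toMat (g z)⁻¹ * Matrix.of fun i j => deriv (fun w => toMat (g w) i j) z := by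
    rw [d1, d5, map_add, map_add, ← d2, ← d3, f1, f2]
  change -θ (s' z) (show E from mfderiv 𝓘(ℂ, ℂ) 𝓘(ℂ, E) s' z (1 : ℂ)) =
    toMat (g z)⁻¹ * -θ (s z) (show E from mfderiv 𝓘(ℂ, ℂ) 𝓘(ℂ, E) s z (1 : ℂ)) * toMat (g z) - _
  rw [f3]
  noncomm_ring

end Transition

/-! ### Taylor expansions -/

section Taylor

/-- The Taylor series at `0` of a function of one complex variable. -/
def taylorSeries (f : ℂ → ℂ) : ℂ⟦X⟧ :=
  PowerSeries.mk fun m => iteratedDeriv m f 0 / (m.factorial : ℂ)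

lemma taylorSeries_congr {f g : ℂ → ℂ} (h : f =ᶠ[𝓝 0] g) : taylorSeries f = taylorSeries g := by
  ext m
  simp only [taylorSeries, PowerSeries.coeff_mk, h.iteratedDeriv_eq m]

lemma taylorSeries_const (c : ℂ) : taylorSeries (fun _ => c) = PowerSeries.C c := by
  ext m
  simp only [taylorSeries, PowerSeries.coeff_mk, PowerSeries.coeff_C, iteratedDeriv_const]
  split_ifs with h
  · simp [h]
  · simp

lemma taylorSeries_id : taylorSeries (fun z => z) = PowerSeries.X := by
  ext m
  rw [taylorSeries, PowerSeries.coeff_mk, iteratedDeriv_fun_id, PowerSeries.coeff_X]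
  split_ifs with h1 h2 h2 <;> simp_all

lemma taylorSeries_add {f g : ℂ → ℂ} (hf : AnalyticAt ℂ f 0) (hg : AnalyticAt ℂ g 0) :
    taylorSeries (fun z => f z + g z) = taylorSeries f + taylorSeries g := by
  ext m
  simp only [taylorSeries, PowerSeries.coeff_mk, map_add]
  rw [iteratedDeriv_fun_add hf.contDiffAt hg.contDiffAt, add_div]

lemma taylorSeries_mul {f g : ℂ → ℂ} (hf : AnalyticAt ℂ f 0) (hg : AnalyticAt ℂ g 0) :
    taylorSeries (fun z => f z * g z) = taylorSeries f * taylorSeries g := by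
  ext m
  rw [PowerSeries.coeff_mul, Finset.Nat.sum_antidiagonal_eq_sum_range_succ_mk, taylorSeries,
    PowerSeries.coeff_mk, iteratedDeriv_fun_mul hf.contDiffAt hg.contDiffAt, Finset.sum_div]
  refine Finset.sum_congr rfl fun i hi => ?_
  have hi' : i ≤ m := Nat.lt_succ_iff.mp (Finset.mem_range.mp hi)
  simp only [taylorSeries, PowerSeries.coeff_mk]
  rw [Nat.cast_choose ℂ hi']
  have h1 : (m.factorial : ℂ) ≠ 0 := by exact_mod_cast m.factorial_ne_zero
  have h2 : (i.factorial : ℂ) ≠ 0 := by exact_mod_cast i.factorial_ne_zero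
  have h3 : ((m - i).factorial : ℂ) ≠ 0 := by exact_mod_cast (m - i).factorial_ne_zero
  field_simp

lemma taylorSeries_sum {ι : Type*} (s : Finset ι) {f : ι → ℂ → ℂ}
    (hf : ∀ i ∈ s, AnalyticAt ℂ (f i) 0) :
    taylorSeries (fun z => ∑ i ∈ s, f i z) = ∑ i ∈ s, taylorSeries (f i) := by
  ext m
  simp only [taylorSeries, PowerSeries.coeff_mk, map_sum]
  rw [iteratedDeriv_fun_sum fun i hi => (hf i hi).contDiffAt, Finset.sum_div]

lemma taylorSeries_pow (k : ℕ) : taylorSeries (fun z => z ^ k) = PowerSeries.X ^ k := by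
  induction k with
  | zero => simpa using taylorSeries_const 1
  | succ k ih =>
    simp only [pow_succ]
    refine (taylorSeries_mul (analyticAt_id.pow k) analyticAt_id).trans ?_
    exact congrArg₂ _ ih taylorSeries_id

lemma taylorSeries_deriv (f : ℂ → ℂ) :
    taylorSeries (deriv f) = PowerSeries.derivative ℂ (taylorSeries f) := by
  ext m
  rw [PowerSeries.coeff_derivative, taylorSeries, taylorSeries, PowerSeries.coeff_mk,
    PowerSeries.coeff_mk, iteratedDeriv_succ', Nat.factorial_succ]
  have h1 : (m.factorial : ℂ) ≠ 0 := by exact_mod_cast m.factorial_ne_zero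
  have h2 : (m + 1 : ℂ) ≠ 0 := by exact_mod_cast m.succ_ne_zero
  push_cast
  field_simp

variable {n : ℕ}

lemma taylor_apply (M : ℂ → Matrix (Fin n) (Fin n) ℂ) (i j : Fin n) :
    taylor M i j = taylorSeries fun z => M z i j := rfl

lemma taylor_congr {M N : ℂ → Matrix (Fin n) (Fin n) ℂ} (h : M =ᶠ[𝓝 0] N) :
    taylor M = taylor N := by
  ext1 i j
  exact taylorSeries_congr (h.mono fun z hz => by simp only [hz])

lemma co_zero_taylor (M : ℂ → Matrix (Fin n) (Fin n) ℂ) : co 0 (taylor M) = M 0 := by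
  ext i j
  simp [taylor]

lemma taylor_mul {M N : ℂ → Matrix (Fin n) (Fin n) ℂ}
    (hM : ∀ i j, AnalyticAt ℂ (fun w => M w i j) 0)
    (hN : ∀ i j, AnalyticAt ℂ (fun w => N w i j) 0) :
    taylor (fun z => M z * N z) = taylor M * taylor N := by
  ext1 i j
  simp only [taylor_apply, Matrix.mul_apply]
  refine (taylorSeries_sum _ fun l _ => (hM i l).mul (hN l j)).trans ?_
  exact Finset.sum_congr rfl fun l _ => taylorSeries_mul (hM i l) (hN l j)

lemma taylor_add {M N : ℂ → Matrix (Fin n) (Fin n) ℂ}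
    (hM : ∀ i j, AnalyticAt ℂ (fun w => M w i j) 0)
    (hN : ∀ i j, AnalyticAt ℂ (fun w => N w i j) 0) :
    taylor (fun z => M z + N z) = taylor M + taylor N := by
  ext1 i j
  exact taylorSeries_add (hM i j) (hN i j)

lemma taylor_pow_smul {M : ℂ → Matrix (Fin n) (Fin n) ℂ}
    (hM : ∀ i j, AnalyticAt ℂ (fun w => M w i j) 0) (k : ℕ) :
    taylor (fun z => z ^ k • M z) = (PowerSeries.X : ℂ⟦X⟧) ^ k • taylor M := by
  ext1 i j
  rw [Matrix.smul_apply, smul_eq_mul, ← taylorSeries_pow]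
  exact taylorSeries_mul (analyticAt_id.pow k) (hM i j)

lemma taylor_deriv (M : ℂ → Matrix (Fin n) (Fin n) ℂ) :
    taylor (fun z => Matrix.of fun i j => deriv (fun w => M w i j) z) = dz (taylor M) := by
  ext1 i j
  exact taylorSeries_deriv _

lemma analyticAt_polyAt {M : ℂ → Matrix (Fin n) (Fin n) ℂ} {z : ℂ}
    (hM : ∀ i j, AnalyticAt ℂ (fun w => M w i j) z) (f : MvPolynomial (Fin n × Fin n) ℂ) :
    AnalyticAt ℂ (fun w => polyAt f (M w)) z :=
  AnalyticAt.aeval_mvPolynomial (f := fun w (ij : Fin n × Fin n) => M w ij.1 ij.2)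
    (fun ij => hM ij.1 ij.2) f

lemma polyAt_taylor {M : ℂ → Matrix (Fin n) (Fin n) ℂ}
    (hM : ∀ i j, AnalyticAt ℂ (fun w => M w i j) 0) (f : MvPolynomial (Fin n × Fin n) ℂ) :
    polyAt f (taylor M) = taylorSeries fun z => polyAt f (M z) := by
  induction f using MvPolynomial.induction_on with
  | C c => simp only [polyAt_C]; exact (taylorSeries_const c).symm
  | add f g hf hg =>
    simp only [polyAt_add]
    rw [hf, hg, taylorSeries_add (analyticAt_polyAt hM f) (analyticAt_polyAt hM g)]
  | mul_X f ij hf =>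
    simp only [polyAt_mul, polyAt_X]
    rw [hf, taylorSeries_mul (analyticAt_polyAt hM f) (hM ij.1 ij.2)]
    rfl

/-- Membership in `𝔤` is a family of linear equations. They extend over the puncture by the identity
theorem and hold coefficientwise. -/
lemma coMem_taylor {G : Subgroup (GL (Fin n) ℂ)} {M : ℂ → Matrix (Fin n) (Fin n) ℂ}
    (hM : ∀ i j, AnalyticAt ℂ (fun w => M w i j) 0) (h : ∀ᶠ z in 𝓝[≠] 0, M z ∈ lieAlg G) :
    CoMem (lieAlg G) (taylor M) := by
  intro m
  rw [mem_lieAlg_iff]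
  intro f hf
  have hterm : ∀ i j, AnalyticAt ℂ (fun z => M z i j * polyAt (MvPolynomial.pderiv (i, j) f)
    (1 : Matrix (Fin n) (Fin n) ℂ)) 0 := fun i j => (hM i j).mul analyticAt_const
  have hsum : ∀ i, AnalyticAt ℂ (fun z => ∑ j, M z i j * polyAt (MvPolynomial.pderiv (i, j) f)
    (1 : Matrix (Fin n) (Fin n) ℂ)) 0 := fun i => Finset.analyticAt_fun_sum _ fun j _ => hterm i j
  have han : AnalyticAt ℂ (fun z => dOne f (M z)) 0 :=
    Finset.analyticAt_fun_sum Finset.univ fun i _ => hsum i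
  have h0 : (fun z => dOne f (M z)) =ᶠ[𝓝 0] fun _ => 0 := by
    refine (han.frequently_eq_iff_eventually_eq analyticAt_const).1
      (Filter.Eventually.frequently ?_)
    filter_upwards [h] with z hz
    exact mem_lieAlg_iff.1 hz f hf
  have h1 := taylorSeries_congr h0
  rw [taylorSeries_const, map_zero] at h1
  have h2 : taylorSeries (fun z => dOne f (M z)) = ∑ i, ∑ j, taylor M i j *
      PowerSeries.C (polyAt (MvPolynomial.pderiv (i, j) f) (1 : Matrix (Fin n) (Fin n) ℂ)) := by
    refine (taylorSeries_sum Finset.univ fun i _ => hsum i).trans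
      (Finset.sum_congr rfl fun i _ => ?_)
    refine (taylorSeries_sum _ fun j _ => hterm i j).trans (Finset.sum_congr rfl fun j _ => ?_)
    rw [taylorSeries_mul (hM i j) analyticAt_const, taylorSeries_const]
    rfl
  have h3 := congrArg (PowerSeries.coeff m) (h2.symm.trans h1)
  simpa [dOne] using h3

end Taylor

/-! ### The holomorphic part of a connection near `0` -/

section HolPart

variable {n : ℕ} {G : Subgroup (GL (Fin n) ℂ)}
  {E : Type*} [NormedAddCommGroup E] [NormedSpace ℂ E]
  {P : Type*} [TopologicalSpace P] [ChartedSpace E P] [IsManifold 𝓘(ℂ, E) ω P]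
  {b : PrincipalBundle G E P} {k : ℕ}

/-- `Ah` is analytic at `0` and `A^s = Ah dz / z ^ k` near `0`. -/
def MeromorphicConnection.IsHolPartNear (A : MeromorphicConnection b k) (s : ℂ → P)
    (Ah : ℂ → Matrix (Fin n) (Fin n) ℂ) : Prop :=
  (∀ i j, AnalyticAt ℂ (fun w => Ah w i j) 0) ∧
    ∀ᶠ z in 𝓝[≠] 0, Ah z = z ^ k • A.pull s z

lemma MeromorphicConnection.IsHolPart.near {A : MeromorphicConnection b k} {s : ℂ → P}
    {Ah : ℂ → Matrix (Fin n) (Fin n) ℂ} (h : A.IsHolPart s Ah) : A.IsHolPartNear s Ah := by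
  refine ⟨h.1 0 (by simp), ?_⟩
  filter_upwards [nhdsWithin_le_nhds (Metric.closedBall_mem_nhds (0 : ℂ) one_pos),
    self_mem_nhdsWithin] with z hz hz0
  rw [h.2 z hz hz0, smul_smul, mul_inv_cancel₀ (pow_ne_zero k hz0), one_smul]

/-- The pull-back of the holomorphic extension of `z ^ k A` gives one function for all points,
independent of the values of `A` over `0`. -/
lemma MeromorphicConnection.exists_analytic_part (A : MeromorphicConnection b k) (s : ℂ → P) :
    ∃ Ah : ℂ → Matrix (Fin n) (Fin n) ℂ, ∀ z, IsSectionNear b s z →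
      (∀ i j, AnalyticAt ℂ (fun w => Ah w i j) z) ∧ (z ≠ 0 → Ah z = z ^ k • A.pull s z) := by
  obtain ⟨B, hB, hBA⟩ := A.pole
  refine ⟨fun w => Matrix.of fun i j => -B i j (s w) (mfderiv 𝓘(ℂ, ℂ) 𝓘(ℂ, E) s w (1 : ℂ)),
    fun z hs => ⟨fun i j => (analyticAt_pullback (hB i j) (hs.mono fun w hw => hw.1)).neg,
      fun hz => ?_⟩⟩
  have hπ := hs.self_of_nhds.2
  ext i j
  have := hBA i j (s z) (by rwa [hπ]) (mfderiv 𝓘(ℂ, ℂ) 𝓘(ℂ, E) s z (1 : ℂ))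
  rw [hπ] at this
  exact (congrArg Neg.neg this).trans (mul_neg _ _).symm

lemma IsTrivialisation.exists_isHolPart {s : ℂ → P} (hs : IsTrivialisation b s)
    (A : MeromorphicConnection b k) : ∃ Ah, A.IsHolPart s Ah := by
  obtain ⟨Ah, h⟩ := A.exists_analytic_part s
  refine ⟨Ah, fun z hz => (h z (hs z hz)).1, fun z hz hz0 => ?_⟩
  rw [(h z (hs z hz)).2 hz0, smul_smul, inv_mul_cancel₀ (pow_ne_zero k hz0), one_smul]

lemma IsSectionNear.exists_isHolPartNear {s : ℂ → P} (hs : IsSectionNear b s 0)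
    (A : MeromorphicConnection b k) : ∃ Ah, A.IsHolPartNear s Ah := by
  obtain ⟨Ah, h⟩ := A.exists_analytic_part s
  refine ⟨Ah, (h 0 hs).1, ?_⟩
  filter_upwards [nhdsWithin_le_nhds (eventually_eventually_nhds.2 hs), self_mem_nhdsWithin]
    with z hz hz0
  exact (h z hz).2 hz0

lemma eventuallyEq_of_punctured {M N : ℂ → Matrix (Fin n) (Fin n) ℂ}
    (hM : ∀ i j, AnalyticAt ℂ (fun w => M w i j) 0)
    (hN : ∀ i j, AnalyticAt ℂ (fun w => N w i j) 0) (h : ∀ᶠ z in 𝓝[≠] 0, M z = N z) :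
    M =ᶠ[𝓝 0] N := by
  have key : ∀ i j, ∀ᶠ z in 𝓝 (0 : ℂ), M z i j = N z i j := fun i j =>
    ((hM i j).frequently_eq_iff_eventually_eq (hN i j)).1
      (h.mono fun z hz => by rw [hz]).frequently
  filter_upwards [Filter.eventually_all.2 fun i => Filter.eventually_all.2 fun j => key i j]
    with z hz
  ext i j
  exact hz i j

lemma MeromorphicConnection.IsHolPartNear.taylor_unique {A : MeromorphicConnection b k}
    {s : ℂ → P} {Ah Ah' : ℂ → Matrix (Fin n) (Fin n) ℂ} (h : A.IsHolPartNear s Ah)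
    (h' : A.IsHolPartNear s Ah') : taylor Ah = taylor Ah' :=
  taylor_congr (eventuallyEq_of_punctured h.1 h'.1 (by
    filter_upwards [h.2, h'.2] with z e e'
    rw [e, e']))

lemma MeromorphicConnection.IsHolPartNear.coMem {A : MeromorphicConnection b k} {s : ℂ → P}
    (hs : IsSectionNear b s 0) {Ah : ℂ → Matrix (Fin n) (Fin n) ℂ} (h : A.IsHolPartNear s Ah) :
    CoMem (lieAlg G) (taylor Ah) := by
  refine coMem_taylor h.1 ?_
  filter_upwards [h.2, nhdsWithin_le_nhds hs, self_mem_nhdsWithin] with z e hz hz0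
  rw [e]
  exact (lieAlg G).smul_mem _ ((lieAlg G).neg_mem (A.mem_lieAlg _ (by rw [hz.2]; exact hz0) _))

lemma MeromorphicConnection.IsHolPartNear.transition {A : MeromorphicConnection b k}
    {s s' : ℂ → P} (hs : IsSectionNear b s 0) (hs' : IsSectionNear b s' 0)
    {Ah Ah' : ℂ → Matrix (Fin n) (Fin n) ℂ} (h : A.IsHolPartNear s Ah)
    (h' : A.IsHolPartNear s' Ah') {g : ℂ → G} (hg : ∀ᶠ w in 𝓝 0, b.act (s w) (g w) = s' w) :
    (fun z => toMat (g z) * Ah' z +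
      z ^ k • Matrix.of fun i j => deriv (fun w => toMat (g w) i j) z)
      =ᶠ[𝓝 0] fun z => Ah z * toMat (g z) := by
  have hga := analyticAt_transition hs hs' hg
  refine eventuallyEq_of_punctured (fun i j => (analyticAt_matrix_mul hga h'.1 i j).add
    ((analyticAt_id.pow k).mul (hga i j).deriv)) (analyticAt_matrix_mul h.1 hga) ?_
  filter_upwards [h.2, h'.2, nhdsWithin_le_nhds (eventually_eventually_nhds.2 hs),
    nhdsWithin_le_nhds (eventually_eventually_nhds.2 hs'),
    nhdsWithin_le_nhds (eventually_eventually_nhds.2 hg), self_mem_nhdsWithin]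
    with z e e' hsz hsz' hgz hz0
  rw [e, e', A.pull_transition hz0 hsz hsz' hgz, Matrix.mul_smul, mul_sub, ← mul_assoc, ← mul_assoc,
    ← mul_assoc, toMat_mul_inv, one_mul, one_mul, smul_sub, sub_add_cancel, Matrix.smul_mul]

lemma MeromorphicConnection.IsHolPartNear.taylor_transition {A : MeromorphicConnection b k}
    {s s' : ℂ → P} (hs : IsSectionNear b s 0) (hs' : IsSectionNear b s' 0)
    {Ah Ah' : ℂ → Matrix (Fin n) (Fin n) ℂ} (h : A.IsHolPartNear s Ah)
    (h' : A.IsHolPartNear s' Ah') {g : ℂ → G} (hg : ∀ᶠ w in 𝓝 0, b.act (s w) (g w) = s' w) :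
    taylor (fun z => toMat (g z)) * taylor Ah' +
      (PowerSeries.X : ℂ⟦X⟧) ^ k • dz (taylor fun z => toMat (g z)) =
      taylor Ah * taylor fun z => toMat (g z) := by
  have hga := analyticAt_transition hs hs' hg
  have hgd : ∀ i j, AnalyticAt ℂ
      (fun z => (Matrix.of fun i j => deriv (fun w => toMat (g w) i j) z) i j) 0 :=
    fun i j => (hga i j).deriv
  have hgk : ∀ i j, AnalyticAt ℂ
      (fun z => (z ^ k • Matrix.of fun i j => deriv (fun w => toMat (g w) i j) z) i j) 0 :=
    fun i j => (analyticAt_id.pow k).mul (hgd i j)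
  have e := taylor_congr (h.transition hs hs' h' hg)
  rw [taylor_mul h.1 hga] at e
  rw [← e, taylor_add (analyticAt_matrix_mul hga h'.1) hgk, taylor_mul hga h'.1,
    taylor_pow_smul hgd, taylor_deriv]

/-- Independence of the section: at `z = 0` the transition law has `g(0) = 1` and its derivative
term carries the factor `0 ^ k`. -/
lemma MeromorphicConnection.HasLeadingCoeff.eq_zero_value {A : MeromorphicConnection b k}
    (hk : k ≠ 0) {s₀ : P} {A₀ : Matrix (Fin n) (Fin n) ℂ} (h : A.HasLeadingCoeff s₀ A₀)
    {s : ℂ → P} (hs : IsSectionNear b s 0) (h0 : s 0 = s₀) {Ah : ℂ → Matrix (Fin n) (Fin n) ℂ}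
    (hA : A.IsHolPartNear s Ah) : Ah 0 = A₀ := by
  obtain ⟨s₁, hs₁, h10, hlim⟩ := h
  obtain ⟨Ah₁, hA₁⟩ := hs₁.exists_isHolPartNear A
  have e1 : Ah₁ 0 = A₀ := by
    have hc : ContinuousAt Ah₁ 0 :=
      continuousAt_pi.2 fun i => continuousAt_pi.2 fun j => (hA₁.1 i j).continuousAt
    refine tendsto_nhds_unique (hc.tendsto.mono_left nhdsWithin_le_nhds)
      (hlim.congr' ?_) (l := 𝓝[≠] 0)
    filter_upwards [hA₁.2] with z hz
    exact hz.symm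
  obtain ⟨g, hg0, hg, -⟩ := exists_transition_near hs₁ hs (h10.trans h0.symm)
  have e2 := (hA₁.transition hs₁ hs hA hg).self_of_nhds
  simpa [hg0, hk, e1] using e2

end HolPart

/-! ### Formal normalisations -/

section Normalisation

variable {n k : ℕ}

lemma atZero_eq_co (F : GL (Fin n) ℂ⟦X⟧) :
    atZero F = co 0 (F : Matrix (Fin n) (Fin n) ℂ⟦X⟧) := by
  ext i j
  simp [atZero]

lemma co_typeSeries (a : Fin k → Matrix (Fin n) (Fin n) ℂ) (m : ℕ) :
    co m (typeSeries a) = if h : m < k then a ⟨m, h⟩ else 0 := by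
  ext i j
  simp only [co_apply, typeSeries, Matrix.sum_apply, map_sum, Matrix.smul_apply, Matrix.map_apply,
    smul_eq_mul, PowerSeries.coeff_X_pow_mul', PowerSeries.coeff_C]
  split_ifs with h
  · rw [Finset.sum_eq_single ⟨m, h⟩]
    · simp
    · intro l _ hl
      have : (l : ℕ) ≠ m := fun e => hl (Fin.ext e)
      rw [ite_eq_right_iff]
      intro hle
      rw [if_neg (by omega)]
    · simp
  · refine Finset.sum_eq_zero fun l _ => ?_
    rw [ite_eq_right_iff]
    intro _
    rw [if_neg (by omega)]

lemma typeSeries_injective :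
    Function.Injective (typeSeries : (Fin k → Matrix (Fin n) (Fin n) ℂ) → _) := by
  intro a a' h
  funext m
  have := congrArg (co (m : ℕ)) h
  simpa [co_typeSeries] using this

lemma gauge_eq_iff (F : GL (Fin n) ℂ⟦X⟧) (α β : Matrix (Fin n) (Fin n) ℂ⟦X⟧) :
    gauge k F α = β ↔ (F : Matrix (Fin n) (Fin n) ℂ⟦X⟧) * α +
      (PowerSeries.X : ℂ⟦X⟧) ^ k • dz (F : Matrix (Fin n) (Fin n) ℂ⟦X⟧) = β * F := by
  have h : gauge k F α = ((F : Matrix (Fin n) (Fin n) ℂ⟦X⟧) * α +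
      (PowerSeries.X : ℂ⟦X⟧) ^ k • dz (F : Matrix (Fin n) (Fin n) ℂ⟦X⟧)) *
        ((F⁻¹ : GL (Fin n) ℂ⟦X⟧) : Matrix (Fin n) (Fin n) ℂ⟦X⟧) := by
    rw [add_mul, Matrix.smul_mul]
    rfl
  rw [h, Units.mul_inv_eq_iff_eq_mul]

variable {G T : Subgroup (GL (Fin n) ℂ)}

lemma formal_unique_of_gauge (hG : IsConnectedReductive G) (hT : IsMaximalTorus G T) (hk : 2 ≤ k)
    {A₀ : lieAlg T} (hreg : IsRegular G T A₀) {F₁ F₂ : GL (Fin n) ℂ⟦X⟧}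
    {α₁ α₂ β : Matrix (Fin n) (Fin n) ℂ⟦X⟧}
    (hF₁ : HasLogDeriv (lieAlg G) (F₁ : Matrix (Fin n) (Fin n) ℂ⟦X⟧))
    (hF₂ : HasLogDeriv (lieAlg G) (F₂ : Matrix (Fin n) (Fin n) ℂ⟦X⟧))
    (h₁ : CoMem (lieAlg T) α₁) (h₂ : CoMem (lieAlg T) α₂) (h₁₀ : co 0 α₁ = A₀)
    (h₂₀ : co 0 α₂ = A₀) (h₁k : ∀ m, k ≤ m → co m α₁ = 0) (h₂k : ∀ m, k ≤ m → co m α₂ = 0)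
    (e₁ : (F₁ : Matrix (Fin n) (Fin n) ℂ⟦X⟧) * α₁ +
      (PowerSeries.X : ℂ⟦X⟧) ^ k • dz (F₁ : Matrix (Fin n) (Fin n) ℂ⟦X⟧) = β * F₁)
    (e₂ : (F₂ : Matrix (Fin n) (Fin n) ℂ⟦X⟧) * α₂ +
      (PowerSeries.X : ℂ⟦X⟧) ^ k • dz (F₂ : Matrix (Fin n) (Fin n) ℂ⟦X⟧) = β * F₂) :
    F₁ = F₂ ∧ α₁ = α₂ := by
  -- The quotient `F₂⁻¹ F₁` transforms the first normal form into the second, without reference to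
  -- `β`.
  set C : Matrix (Fin n) (Fin n) ℂ⟦X⟧ :=
    ((F₂⁻¹ : GL (Fin n) ℂ⟦X⟧) : Matrix (Fin n) (Fin n) ℂ⟦X⟧) * F₁ with hC
  have hFC : (F₂ : Matrix (Fin n) (Fin n) ℂ⟦X⟧) * C = F₁ := by
    rw [hC, ← mul_assoc, ← Units.val_mul, mul_inv_cancel, Units.val_one, one_mul]
  have hV : ∀ X ∈ lieAlg G, ∀ Y ∈ lieAlg G, X * Y - Y * X ∈ lieAlg G :=
    fun X hX Y hY => lieAlg_commutator hX hY
  have hCG : HasLogDeriv (lieAlg G) C := (hF₂.inv hV).mul hV hF₁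
  clear_value C
  have e : C * α₁ + (PowerSeries.X : ℂ⟦X⟧) ^ k • dz C = α₂ * C := by
    apply F₂.isUnit.mul_left_cancel
    rw [← hFC, dz_mul, ← mul_assoc β, ← e₂, smul_add, add_mul, Matrix.smul_mul] at e₁
    rw [mul_add, Matrix.mul_smul, ← mul_assoc, ← mul_assoc]
    have : ∀ p q r t : Matrix (Fin n) (Fin n) ℂ⟦X⟧, p + (q + r) = t + q → p + r = t := by
      intro p q r t h
      rw [← add_right_cancel_iff (a := q), ← h]
      abel
    exact this _ _ _ _ e₁
  obtain ⟨rfl, hα⟩ := formal_unique hk (fun X hX Y hY => hT.torus.commute hX hY) A₀.2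
    (fun X hX hXA => mem_lieAlg_torus_of_commute hG hT hreg hX hXA)
    (fun X hX => (hT.torus.isSemisimpleMat A₀.2).commute_of_commute_commutator hX)
    hCG h₁ h₂ h₁₀ h₂₀ h₁k h₂k e
  refine ⟨Units.ext ?_, hα⟩
  rw [← hFC, mul_one]

lemma formal_exists_of_isRegular (hG : IsConnectedReductive G) (hT : IsMaximalTorus G T)
    (hk : 2 ≤ k) {A₀ : lieAlg T} (hreg : IsRegular G T A₀) {β : Matrix (Fin n) (Fin n) ℂ⟦X⟧}
    (hβ : CoMem (lieAlg G) β) (hβ₀ : co 0 β = A₀) :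
    ∃ (F : GL (Fin n) ℂ⟦X⟧) (a : Fin k → Matrix (Fin n) (Fin n) ℂ), IsFormalPoint G F ∧
      atZero F = 1 ∧ (∀ m, a m ∈ lieAlg T) ∧ (∀ m : Fin k, (m : ℕ) = 0 → a m = A₀) ∧
      gauge k F (typeSeries a) = β := by
  have hle := lieAlg_mono hT.le
  obtain ⟨F, α, hF, hα, hαk, hα₀, e⟩ := formal_exists hk
    (fun X hX Y hY => lieAlg_commutator hX hY) hle
    (fun X hX Y hY => hT.torus.commute hX hY) A₀.2 (fun X hX => by
      obtain ⟨Y, hY, hc⟩ := exists_commutator_decomposition (hT.torus.isSemisimpleMat A₀.2)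
        (fun Y hY => lieAlg_commutator (hle A₀.2) hY) hX
      exact ⟨Y, hY, mem_lieAlg_torus_of_commute hG hT hreg
        ((lieAlg G).add_mem hX (lieAlg_commutator (hle A₀.2) hY)) hc⟩) hβ hβ₀
  obtain ⟨U, rfl⟩ := exists_inverse hF.1
  have hαa : typeSeries (fun m : Fin k => co (m : ℕ) α) = α := by
    refine co_ext fun m => ?_
    rw [co_typeSeries]
    split_ifs with h
    · rfl
    · exact (hαk m (not_lt.mp h)).symm
  refine ⟨U, fun m => co m α, (isFormalPoint_iff_hasLogDeriv hF.1).2 hF, ?_, fun m => hα m,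
    fun m hm => ?_, ?_⟩
  · rw [atZero_eq_co, hF.1]
  · change co (m : ℕ) α = A₀
    rw [hm, hα₀]
  · rw [hαa, gauge_eq_iff, e]

variable {E : Type*} [NormedAddCommGroup E] [NormedSpace ℂ E]
  {P : Type*} [TopologicalSpace P] [ChartedSpace E P] [IsManifold 𝓘(ℂ, E) ω P]
  {b : PrincipalBundle G E P}

lemma IsFormalNormalisation.unique (hG : IsConnectedReductive G) (hT : IsMaximalTorus G T)
    (hk : 2 ≤ k) {A : MeromorphicConnection b k} {A₀ : lieAlg T} (hreg : IsRegular G T A₀)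
    {s : ℂ → P} {F₁ F₂ : GL (Fin n) ℂ⟦X⟧} {a₁ a₂ : Fin k → Matrix (Fin n) (Fin n) ℂ}
    (h₁ : IsFormalNormalisation T A A₀ s F₁ a₁) (h₂ : IsFormalNormalisation T A A₀ s F₂ a₂) :
    F₁ = F₂ ∧ a₁ = a₂ := by
  have hlog : ∀ {F : GL (Fin n) ℂ⟦X⟧} {a : Fin k → Matrix (Fin n) (Fin n) ℂ},
      IsFormalNormalisation T A A₀ s F a →
        HasLogDeriv (lieAlg G) (F : Matrix (Fin n) (Fin n) ℂ⟦X⟧) := fun {F a} h =>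
    (isFormalPoint_iff_hasLogDeriv (by rw [← atZero_eq_co, h.at_zero])).1 h.formal
  have hmem : ∀ {F : GL (Fin n) ℂ⟦X⟧} {a : Fin k → Matrix (Fin n) (Fin n) ℂ},
      IsFormalNormalisation T A A₀ s F a → CoMem (lieAlg T) (typeSeries a) := fun {F a} h m => by
    rw [co_typeSeries]
    split_ifs
    · exact h.mem_torus _
    · exact Submodule.zero_mem _
  have hzero : ∀ {F : GL (Fin n) ℂ⟦X⟧} {a : Fin k → Matrix (Fin n) (Fin n) ℂ},
      IsFormalNormalisation T A A₀ s F a → co 0 (typeSeries a) = A₀ := fun {F a} h => by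
    rw [co_typeSeries, dif_pos (by omega)]
    exact h.leading _ rfl
  have hlarge : ∀ (a : Fin k → Matrix (Fin n) (Fin n) ℂ) (m : ℕ), k ≤ m →
      co m (typeSeries a) = 0 := fun a m hm => by
    rw [co_typeSeries, dif_neg (not_lt.mpr hm)]
  obtain ⟨Ah₁, hA₁, e₁⟩ := h₁.gauge_eq
  obtain ⟨Ah₂, hA₂, e₂⟩ := h₂.gauge_eq
  rw [hA₂.near.taylor_unique hA₁.near] at e₂
  obtain ⟨hF, ha⟩ := formal_unique_of_gauge hG hT hk hreg (hlog h₁) (hlog h₂) (hmem h₁) (hmem h₂)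
    (hzero h₁) (hzero h₂) (hlarge a₁) (hlarge a₂) ((gauge_eq_iff _ _ _).1 e₁)
    ((gauge_eq_iff _ _ _).1 e₂)
  exact ⟨hF, typeSeries_injective ha⟩

/-- A change of trivialisation acts on formal normalisations by left multiplication. -/
lemma IsFormalNormalisation.transition {A : MeromorphicConnection b k}
    {A₀ : Matrix (Fin n) (Fin n) ℂ} {s s' : ℂ → P} (hs : IsSectionNear b s 0)
    (hs' : IsTrivialisation b s') {g : ℂ → G} (hg0 : g 0 = 1)
    (hg : ∀ᶠ w in 𝓝 0, b.act (s' w) (g w) = s w) {F : GL (Fin n) ℂ⟦X⟧}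
    {a : Fin k → Matrix (Fin n) (Fin n) ℂ} (h : IsFormalNormalisation T A A₀ s F a)
    {U : GL (Fin n) ℂ⟦X⟧}
    (hU : (U : Matrix (Fin n) (Fin n) ℂ⟦X⟧) = taylor fun z => toMat (g z)) :
    IsFormalNormalisation T A A₀ s' (U * F) a := by
  have hs0 : IsSectionNear b s' 0 := hs' 0 (by simp)
  have hga := analyticAt_transition hs0 hs hg
  have hU0 : co 0 (U : Matrix (Fin n) (Fin n) ℂ⟦X⟧) = 1 := by
    rw [hU, co_zero_taylor, hg0, toMat_one]
  have hF0 : co 0 (F : Matrix (Fin n) (Fin n) ℂ⟦X⟧) = 1 := by rw [← atZero_eq_co, h.at_zero]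
  have hUF0 : co 0 ((U * F : GL (Fin n) ℂ⟦X⟧) : Matrix (Fin n) (Fin n) ℂ⟦X⟧) = 1 := by
    rw [Units.val_mul, co_zero_mul, hU0, hF0, one_mul]
  -- Evaluating polynomials commutes with Taylor expansion, and `f(g(z))` vanishes identically.
  have hUG : IsFormalPoint G U := fun f hf => by
    have h0 : (fun z => polyAt f (toMat (g z))) = fun _ => 0 := funext fun z => hf _ (g z).2
    rw [hU, polyAt_taylor hga, h0, taylorSeries_const, map_zero]
  have hV : ∀ X ∈ lieAlg G, ∀ Y ∈ lieAlg G, X * Y - Y * X ∈ lieAlg G :=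
    fun X hX Y hY => lieAlg_commutator hX hY
  obtain ⟨Ah, hA, e⟩ := h.gauge_eq
  obtain ⟨Ah', hA'⟩ := hs'.exists_isHolPart A
  refine ⟨?_, by rw [atZero_eq_co, hUF0], h.mem_torus, h.leading, Ah', hA', ?_⟩
  · rw [isFormalPoint_iff_hasLogDeriv hUF0, Units.val_mul]
    exact ((isFormalPoint_iff_hasLogDeriv hU0).1 hUG).mul hV
      ((isFormalPoint_iff_hasLogDeriv hF0).1 h.formal)
  · have e1 := hA'.near.taylor_transition hs0 hs hA.near hg
    rw [← hU] at e1
    rw [gauge_eq_iff] at e ⊢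
    rw [Units.val_mul, dz_mul, ← mul_assoc (taylor Ah'), ← e1, add_mul, mul_assoc _ (taylor Ah),
      ← e, mul_add, smul_add, Matrix.mul_smul, Matrix.smul_mul, mul_assoc]
    abel

end Normalisation

end FormalType

end

/-! ### Assembly of the theorem. -/

open FormalType in
theorem mainTheorem9 {n : ℕ} (G T : Subgroup (GL (Fin n) ℂ))
    (hG : IsConnectedReductive G) (hT : IsMaximalTorus G T)
    {E : Type*} [NormedAddCommGroup E] [NormedSpace ℂ E] [FiniteDimensional ℂ E]
    {P : Type*} [TopologicalSpace P] [ChartedSpace E P] [IsManifold 𝓘(ℂ, E) ω P]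
    (b : PrincipalBundle G E P) (k : ℕ) (hk : 2 ≤ k) (A : MeromorphicConnection b k)
    (s₀ : P) (hs₀ : b.π s₀ = 0)
    (A₀ : lieAlg T) (hlead : A.HasLeadingCoeff s₀ A₀) (hreg : IsRegular G T A₀) :
    (∀ s : ℂ → P, IsTrivialisation b s → s 0 = s₀ →
      ∃! x : GL (Fin n) ℂ⟦X⟧ × (Fin k → Matrix (Fin n) (Fin n) ℂ),
        IsFormalNormalisation T A A₀ s x.1 x.2) ∧
    (∀ s s' : ℂ → P, IsTrivialisation b s → IsTrivialisation b s' → s 0 = s₀ → s' 0 = s₀ →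
      ∀ (F F' : GL (Fin n) ℂ⟦X⟧) (a a' : Fin k → Matrix (Fin n) (Fin n) ℂ),
        IsFormalNormalisation T A A₀ s F a → IsFormalNormalisation T A A₀ s' F' a' →
        a' = a ∧ ∃ g : ℂ → G, IsHolomorphicMap G g ∧ g 0 = 1 ∧
          (F' : Matrix (Fin n) (Fin n) ℂ⟦X⟧) =
            taylor (fun z => toMat (g z)) * (F : Matrix (Fin n) (Fin n) ℂ⟦X⟧)) := by
  refine ⟨fun s hs h0 => ?_, fun s s' hs hs' h0 h0' F F' a a' hF hF' => ?_⟩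
  · have hs0 : IsSectionNear b s 0 := hs 0 (by simp)
    obtain ⟨Ah, hA⟩ := hs.exists_isHolPart A
    obtain ⟨F, a, h1, h2, h3, h4, h5⟩ := formal_exists_of_isRegular hG hT hk hreg
      (hA.near.coMem hs0)
      (by rw [co_zero_taylor, hlead.eq_zero_value (by omega) hs0 h0 hA.near])
    have hFa : IsFormalNormalisation T A A₀ s F a := ⟨h1, h2, h3, h4, Ah, hA, h5⟩
    refine ⟨(F, a), hFa, fun x hx => ?_⟩
    obtain ⟨e1, e2⟩ := IsFormalNormalisation.unique hG hT hk hreg hx hFa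
    exact Prod.ext e1 e2
  · have hz : (0 : ℂ) ∈ Δ := by simp
    -- The transition is taken as `s = s' · g`, the direction in which `g` carries `A^s` to
    -- `A^{s'}`, hence `F` to a normalisation for `s'`.
    obtain ⟨g, hg0, hg, hga⟩ := exists_transition_near (hs' 0 hz) (hs 0 hz) (h0'.trans h0.symm)
    obtain ⟨U, hU⟩ := exists_inverse (F := taylor fun z => toMat (g z))
      (by rw [co_zero_taylor, hg0, toMat_one])
    obtain ⟨e1, e2⟩ := IsFormalNormalisation.unique hG hT hk hreg hF'
      (hF.transition (hs 0 hz) hs' hg0 hg hU)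
    exact ⟨e2, g, fun z hz => hga z (hs' z hz) (hs z hz), hg0, by rw [e1, Units.val_mul, hU]⟩
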